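/- For $\lambda>0$ let $\mathcal P_\lambda=-i\nabla-\tfrac{\lambda}{2}X^\perp$ on $L^2(\mathbb R^2)$, where $x^\perp=(-x_2,x_1)$. For bounded smooth real potentials $v^\circ,W$ and $\tau>0$ let $$h^\circ_\lambda=\mathcal P_\lambda^2+\lambda^2v^\circ(X),\qquad h_\lambda=h^\circ_\lambda+\tau W(X)$$ (self-adjoint realizations, i.e. closures from $C_c^\infty(\mathbb R^2)$). A ground state eigenpair is a pair $(e,\varphi)$ with $e=\min\sigma(h)$, $h\varphi=e\varphi$, $\|\varphi\|_{L^2}=1$. **Proposition.** Let $c_1,C_1>0$. There are $C_2,\tau_0,\lambda_0>0$ depending only on $c_1,C_1$, and for all $r_0,c_{\rm gap}>0$ there is $C>0$ depending only on $c_1,C_1,r_0,c_{\rm gap}$, such that the following holds. Suppose that * $v^\circ,W:\mathbb R^2\to(-\infty,0]$ are smooth with $\|v^\circ\|_\infty,\|W\|_\infty\le C_1$; $v^\circ$ is radial with $\operatorname{supp}v^\circ\subset B_{r_0}(0)$; $\operatorname{supp}W\subset\mathbb R^2\setminus B_{r_0+D}(0)$ with $D\ge C_2$; * $0<\tau<\tau_0$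 and $\lambda\ge\lambda_0$; * $h^\circ_\lambda$ has a ground state eigenpair $(e^\circ_\lambda,\varphi^\circ_\lambda)$, with $e^\circ_\lambda$ non-degenerate, $-C_1\lambda^2\le e^\circ_\lambda\le -c_1\lambda^2$ and $\operatorname{dist}\big(e^\circ_\lambda,\sigma(h^\circ_\lambda)\setminus\{e^\circ_\lambda\}\big)\ge c_{\rm gap}$. Then $h_\lambda$ has a ground state eigenpair; write $e_\lambda=\min\sigma(h_\lambda)$. Moreover: 1. $|e_\lambda-e^\circ_\lambda|\le\|W\|_\infty\,\tau$. 2. $\varphi^\circ_\lambda$ has a continuous representative, which satisfies $|\varphi^\circ_\lambda(x)|\le C\lambda^2\exp\!\big(-\tfrac{\lambda}{4}\operatorname{dist}(x,\operatorname{supp}v^\circ)^2\big)$ for all $x\in\operatorname{supp}W$. 3. For every ground state $\varphi_\lambda$ of $h_\lambda$ with phase chosen so that $\langle\varphi^\circ_\lambda,\varphi_\lambda\rangle\ge0$, $\ \|\varphi_\lambda-\varphi^\circ_\lambda\|_{L^2}\le C\,\tau\,\lambda^2\exp\!\big(-\tfrac{\lambda}{4}D^2\big)$. -/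

import Mathlib

open MeasureTheory
open scoped ContDiff

/-- The Euclidean plane `ℝ²`. -/
abbrev Plane : Type := EuclideanSpace ℝ (Fin 2)

/-- The complex Hilbert space `L²(ℝ²)` (Lebesgue measure). -/
abbrev PlaneL2 : Type := Lp ℂ 2 (volume : Measure Plane)

/-- `x^⊥ = (-x₂, x₁)`. -/
noncomputable def planePerp (x : Plane) : Plane := !₂[-(x 1), x 0]

/-- The `j`-th component of the magnetic momentum `P - (λ/2) X^⊥`, with `P = -i∇`,
acting on (differentiable) functions. -/
noncomputable def magMomentum (lam : ℝ) (j : Fin 2) (f : Plane → ℂ) : Plane → ℂ :=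
  fun x => -Complex.I * fderiv ℝ f x (EuclideanSpace.single j 1)
    - ((lam / 2 * planePerp x j : ℝ) : ℂ) * f x

/-- The differential expression `(P - (λ/2) X^⊥)² f + V f`. -/
noncomputable def schrodingerExpr (lam : ℝ) (V : Plane → ℝ) (f : Plane → ℂ) : Plane → ℂ :=
  fun x => magMomentum lam 0 (magMomentum lam 0 f) x + magMomentum lam 1 (magMomentum lam 1 f) x
    + (V x : ℂ) * f x

theorem magMomentum_contDiff {lam : ℝ} {j : Fin 2} {f : Plane → ℂ} (hf : ContDiff ℝ ∞ f) :
    ContDiff ℝ ∞ (magMomentum lam j f) := by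
  have h1 : ContDiff ℝ ∞ (fun x : Plane => fderiv ℝ f x (EuclideanSpace.single j 1)) :=
    (hf.fderiv_right (m := ∞) (by simp)).clm_apply contDiff_const
  have h2 : ContDiff ℝ ∞ (fun x : Plane => (planePerp x j : ℝ)) := by
    fin_cases j
    · simpa [planePerp] using (by fun_prop : ContDiff ℝ ∞ (fun x : Plane => -(x 1)))
    · simpa [planePerp] using (by fun_prop : ContDiff ℝ ∞ (fun x : Plane => x 0))
  have h3 : ContDiff ℝ ∞ (fun x : Plane => ((lam / 2 * planePerp x j : ℝ) : ℂ)) :=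
    Complex.ofRealCLM.contDiff.comp (contDiff_const.mul h2)
  exact (contDiff_const.mul h1).sub (h3.mul hf)

theorem magMomentum_add {lam : ℝ} {j : Fin 2} {f g : Plane → ℂ}
    (hf : ContDiff ℝ ∞ f) (hg : ContDiff ℝ ∞ g) :
    magMomentum lam j (f + g) = magMomentum lam j f + magMomentum lam j g := by
  funext x
  have h1 : DifferentiableAt ℝ f x := (hf.differentiable (by simp)).differentiableAt
  have h2 : DifferentiableAt ℝ g x := (hg.differentiable (by simp)).differentiableAt
  simp only [magMomentum, Pi.add_apply, fderiv_add h1 h2, _root_.add_apply]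
  ring

theorem magMomentum_smul {lam : ℝ} {j : Fin 2} {f : Plane → ℂ} (c : ℂ)
    (hf : ContDiff ℝ ∞ f) :
    magMomentum lam j (c • f) = c • magMomentum lam j f := by
  funext x
  have h1 : DifferentiableAt ℝ f x := (hf.differentiable (by simp)).differentiableAt
  simp only [magMomentum, Pi.smul_apply, fderiv_const_smul h1, _root_.smul_apply, smul_eq_mul]
  ring

/-- The graph, in `L² × L²`, of `f ↦ (P - (λ/2) X^⊥)² f + V f` on `f ∈ C_c^∞(ℝ²)`. -/
noncomputable def coreGraph (lam : ℝ) (V : Plane → ℝ) : Submodule ℂ (PlaneL2 × PlaneL2) where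
  carrier := {p | ∃ f : Plane → ℂ, ContDiff ℝ ∞ f ∧ HasCompactSupport f ∧
    p.1 =ᵐ[volume] f ∧ p.2 =ᵐ[volume] schrodingerExpr lam V f}
  zero_mem' := by
    refine ⟨0, contDiff_const, HasCompactSupport.zero, Lp.coeFn_zero _ _ _, ?_⟩
    have : schrodingerExpr lam V 0 = 0 := by
      have h : ∀ j, magMomentum lam j (0 : Plane → ℂ) = 0 := by
        intro j; funext x; simp [magMomentum]
      funext x; simp [schrodingerExpr, h]
    rw [this]
    exact Lp.coeFn_zero _ _ _
  add_mem' := by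
    rintro ⟨a, b⟩ ⟨a', b'⟩ ⟨f, hf, hfc, h1, h2⟩ ⟨g, hg, hgc, h3, h4⟩
    refine ⟨f + g, hf.add hg, hfc.add hgc, ?_, ?_⟩
    · exact (Lp.coeFn_add a a').trans (h1.add h3)
    · have : schrodingerExpr lam V (f + g) = schrodingerExpr lam V f + schrodingerExpr lam V g := by
        funext x
        simp only [schrodingerExpr, magMomentum_add hf hg,
          magMomentum_add (magMomentum_contDiff hf) (magMomentum_contDiff hg), Pi.add_apply]
        ring
      rw [this]
      exact (Lp.coeFn_add b b').trans (h2.add h4)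
  smul_mem' := by
    rintro c ⟨a, b⟩ ⟨f, hf, hfc, h1, h2⟩
    refine ⟨c • f, contDiff_const.smul hf, ?_, ?_, ?_⟩
    · exact hfc.mono (Function.support_const_smul_subset c f)
    · exact (Lp.coeFn_smul c a).trans (h1.const_smul c)
    · have : schrodingerExpr lam V (c • f) = c • schrodingerExpr lam V f := by
        funext x
        simp only [schrodingerExpr, magMomentum_smul c hf,
          magMomentum_smul c (magMomentum_contDiff hf), Pi.smul_apply, smul_eq_mul]
        ring
      rw [this]
      exact (Lp.coeFn_smul c b).trans (h2.const_smul c)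

/-- `coreGraph` is the graph of an operator, so that passing to a `LinearPMap` loses nothing. -/
theorem coreGraph_single_valued (lam : ℝ) (V : Plane → ℝ) :
    ∀ p ∈ coreGraph lam V, p.1 = 0 → p.2 = 0 := by
  rintro ⟨a, b⟩ ⟨f, hf, -, h1, h2⟩ h0
  simp only at h0 h1 h2
  have hf0 : f = 0 := by
    have : f =ᵐ[volume] (0 : Plane → ℂ) := by
      rw [h0] at h1
      exact h1.symm.trans (Lp.coeFn_zero _ _ _)
    exact hf.continuous.ae_eq_iff_eq volume continuous_zero |>.1 this
  have h : ∀ j, magMomentum lam j (0 : Plane → ℂ) = 0 := by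
    intro j; funext x; simp [magMomentum]
  have hz : schrodingerExpr lam V f = 0 := by
    subst hf0; funext x; simp [schrodingerExpr, h]
  rw [hz] at h2
  exact Lp.ext (h2.trans (Lp.coeFn_zero _ _ _).symm)

/-- The magnetic Schrödinger operator `(P - (λ/2) X^⊥)² + V(X)` on `L²(ℝ²)`: the closure of the
operator defined by the differential expression on `C_c^∞(ℝ²)`. (For bounded continuous `V` the
latter is essentially self-adjoint, and this is its unique self-adjoint extension.) -/
noncomputable def magneticHamiltonian (lam : ℝ) (V : Plane → ℝ) : PlaneL2 →ₗ.[ℂ] PlaneL2 :=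
  (coreGraph lam V).toLinearPMap.closure

/-- The resolvent set of an unbounded operator: those `z` for which `T - z : dom T → L²` has a
bounded everywhere defined two-sided inverse. -/
def opResolventSet (T : PlaneL2 →ₗ.[ℂ] PlaneL2) : Set ℂ :=
  {z | ∃ R : PlaneL2 →L[ℂ] PlaneL2,
    (∀ g : PlaneL2, ∃ hg : R g ∈ T.domain, T ⟨R g, hg⟩ - z • R g = g) ∧
    ∀ ψ : T.domain, R (T ψ - z • (ψ : PlaneL2)) = ψ}

/-- The spectrum of an unbounded operator. -/
def opSpectrum (T : PlaneL2 →ₗ.[ℂ] PlaneL2) : Set ℂ := (opResolventSet T)ᶜ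

/-- `T ψ = e ψ` (with `ψ ∈ dom T`; `ψ = 0` is allowed). -/
def SatisfiesEigenEq (T : PlaneL2 →ₗ.[ℂ] PlaneL2) (e : ℝ) (ψ : PlaneL2) : Prop :=
  ∃ h : ψ ∈ T.domain, T ⟨ψ, h⟩ = (e : ℂ) • ψ

/-- `e` is the bottom of the spectrum of `T`. -/
def IsGroundEnergy (T : PlaneL2 →ₗ.[ℂ] PlaneL2) (e : ℝ) : Prop :=
  (e : ℂ) ∈ opSpectrum T ∧ ∀ z ∈ opSpectrum T, e ≤ z.re

/-- `(e, φ)` is a ground state eigenpair of `T`: `e` is the bottom of the spectrum, and `φ` is an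
`L²`-normalized eigenfunction for the eigenvalue `e`. -/
def IsGroundState (T : PlaneL2 →ₗ.[ℂ] PlaneL2) (e : ℝ) (φ : PlaneL2) : Prop :=
  IsGroundEnergy T e ∧ ‖φ‖ = 1 ∧ SatisfiesEigenEq T e φ

/-- The ground state eigenvalue `e`, with eigenfunction `φ`, is non-degenerate and lies at distance
at least `c` from the rest of the spectrum. -/
def HasSimpleGap (T : PlaneL2 →ₗ.[ℂ] PlaneL2) (e : ℝ) (φ : PlaneL2) (c : ℝ) : Prop :=
  (∀ ψ, SatisfiesEigenEq T e ψ → ∃ a : ℂ, ψ = a • φ) ∧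
  ∀ z ∈ opSpectrum T, z ≠ (e : ℂ) → c ≤ ‖z - (e : ℂ)‖

/-!
Write `A = (lam / 2) x^⊥`, so that the Hamiltonian is `(P - A)² + V`. The Landau Hamiltonian
`(P - A)²` has an explicit heat kernel (Mehler's formula) whose modulus is a Gaussian of rate at
least `lam / 4`, at all times. Integrating `exp(-tE)` times the heat kernel over `t` gives the
resolvent `((P - A)² + E)⁻¹` for `E > lam` as an integral operator whose kernel is at most
`exp(-(lam / 4) |x - y|²)` times an integrable function of `x - y`. All Gaussian factors in the
theorem come from this one bound.

The resolvent formula is proved with the heat kernel as a test function: a weak solution of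
`((P - A)² + E) u = F` satisfies `-∂ₜ (exp(-tE) Sₜ u) = exp(-tE) Sₜ F` for the heat semigroup `Sₜ`
(`IsWeakSolution.hasDerivAt_heatInt`). Applied to test functions this identifies the integral
operator as a left inverse (`landauResolvent_testFunction`), and applied to `F = 0` it shows that
the equation `((P - A)² + E) u = 0` has no nonzero weak solution in `L²` (`IsWeakSolution.eq_zero`),
which is essential self-adjointness. Hence the closure of the operator on test functions has the
integral operator as its resolvent (`exists_isResolventAt_landau`).

Let `V = lam² v`, let `U = τ W`, and let `R` be the resolvent of `(P - A)²` at an energy `e < -lam`.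

* *Existence and energy.* The perturbed operator is symmetric and bounded below, so it has a bottom
  `e` of the spectrum, and `e₀ - sup |U| ≤ e ≤ e₀`, by a Neumann series for the lower bound and `φ₀`
  as a trial function for the upper bound. The operator `R V` is compact
  (`isCompactOperator_resolvent_mul_mulOp`) and `‖R U‖ < 1`, so by the Fredholm alternative `e` is
  an eigenvalue (`exists_isGroundState_add`).
* *Pointwise decay.* The eigenvalue equation reads `φ₀ = -R V φ₀`, and the kernel bound gives
  continuity and Gaussian decay away from the support of `v` (`exists_continuous_eigenfunction`).
* *Closeness.* A perturbed ground state satisfies `φ = -R V φ - R U φ`. Since `W` and `v` have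
  supports at distance at least `D`, this makes `U φ` of order `τ exp(-(lam / 4) D²)`
  (`norm_mulOp_eigenfunction_le`). The component of `φ` orthogonal to `φ₀` solves an equation with
  source `U φ`, so the spectral gap bounds it by a multiple of `‖U φ‖`
  (`IsPerturbation.norm_sub_le_of_gap`).

Unbounded operators are handled through their graphs: `IsResolventAt`, `GraphSymmetric` and
`IsPerturbation` are conditions on the graph, which for `magneticHamiltonian` is the closure of the
core graph (`magneticHamiltonian_graph`).
-/

/-! ### Resolvents of unbounded operators -/

/-- `R` is the resolvent `(T - z)⁻¹`, expressed through the graph of `T`. -/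
def IsResolventAt (T : PlaneL2 →ₗ.[ℂ] PlaneL2) (z : ℂ) (R : PlaneL2 →L[ℂ] PlaneL2) : Prop :=
  ∀ ψ η : PlaneL2, (ψ, η) ∈ T.graph ↔ R (η - z • ψ) = ψ

theorem mem_opResolventSet_iff {T : PlaneL2 →ₗ.[ℂ] PlaneL2} {z : ℂ} :
    z ∈ opResolventSet T ↔ ∃ R, IsResolventAt T z R := by
  constructor
  · rintro ⟨R, h1, h2⟩
    refine ⟨R, fun ψ η => ⟨fun h => ?_, fun h => ?_⟩⟩
    · obtain ⟨y, hy1, hy2⟩ := LinearPMap.mem_graph_iff _ |>.1 h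
      simp only at hy1 hy2
      rw [← hy1, ← hy2]
      exact h2 y
    · obtain ⟨hg, h3⟩ := h1 (η - z • ψ)
      refine LinearPMap.mem_graph_iff _ |>.2 ⟨⟨_, hg⟩, h, ?_⟩
      have h4 : T ⟨_, hg⟩ - z • ψ = η - z • ψ :=
        (congrArg (fun y => T ⟨_, hg⟩ - z • y) h.symm).trans h3
      exact sub_left_injective h4
  · rintro ⟨R, h⟩
    refine ⟨R, fun g => ?_, fun ψ => ?_⟩
    · have : (R g, g + z • R g) ∈ T.graph := (h _ _).2 (by simp)
      obtain ⟨y, hy1, hy2⟩ := LinearPMap.mem_graph_iff _ |>.1 this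
      simp only at hy1 hy2
      refine ⟨hy1 ▸ y.2, ?_⟩
      have : (⟨R g, hy1 ▸ y.2⟩ : T.domain) = y := Subtype.ext hy1.symm
      rw [this, hy2]; simp
    · exact (h _ _).1 (LinearPMap.mem_graph T ψ)

theorem satisfiesEigenEq_iff {T : PlaneL2 →ₗ.[ℂ] PlaneL2} {e : ℝ} {ψ : PlaneL2} :
    SatisfiesEigenEq T e ψ ↔ (ψ, (e : ℂ) • ψ) ∈ T.graph := by
  constructor
  · rintro ⟨h, h2⟩
    exact LinearPMap.mem_graph_iff _ |>.2 ⟨⟨ψ, h⟩, rfl, h2⟩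
  · intro h
    obtain ⟨y, hy1, hy2⟩ := LinearPMap.mem_graph_iff _ |>.1 h
    simp only at hy1 hy2
    subst hy1
    exact ⟨y.2, hy2⟩

/-- `T` is symmetric, expressed through its graph. -/
def GraphSymmetric (T : PlaneL2 →ₗ.[ℂ] PlaneL2) : Prop :=
  ∀ ψ η ψ' η', (ψ, η) ∈ T.graph → (ψ', η') ∈ T.graph → inner ℂ ψ η' = inner ℂ η ψ'

namespace IsResolventAt

variable {T : PlaneL2 →ₗ.[ℂ] PlaneL2} {z : ℂ} {R : PlaneL2 →L[ℂ] PlaneL2}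

theorem apply_mem_graph (h : IsResolventAt T z R) (g : PlaneL2) :
    (R g, g + z • R g) ∈ T.graph :=
  (h _ _).2 (by simp)

theorem isSelfAdjoint {μ : ℝ} (h : IsResolventAt T (μ : ℂ) R) (hT : GraphSymmetric T) :
    IsSelfAdjoint R := by
  rw [ContinuousLinearMap.isSelfAdjoint_iff_isSymmetric]
  intro x y
  change inner ℂ (R x) y = inner ℂ x (R y)
  have := (hT _ _ _ _ (h.apply_mem_graph x) (h.apply_mem_graph y)).symm
  rw [inner_add_left, inner_add_right, inner_smul_left, inner_smul_right] at this
  simp only [Complex.conj_ofReal] at this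
  have h2 := add_right_cancel this
  exact h2.symm

/-- The resolvent identity that relates the resolvents at `z` and at `z'`. -/
theorem resolvent_identity (h : IsResolventAt T z R) {z' : ℂ} {R' : PlaneL2 →L[ℂ] PlaneL2}
    (h' : IsResolventAt T z' R') (g : PlaneL2) : R' g = R g + (z' - z) • R (R' g) := by
  have := (h _ _).1 (h'.apply_mem_graph g)
  rw [← map_smul, ← map_add, sub_smul]
  rw [← add_sub_assoc]
  exact this.symm

/-- Points of the resolvent set of `T` give points of the resolvent set of the bounded operator
`(T - z)⁻¹`. -/
theorem inv_sub_notMem_spectrum (h : IsResolventAt T z R) {z' : ℂ} (hz : z' ≠ z)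
    (h' : z' ∈ opResolventSet T) : (z' - z)⁻¹ ∉ spectrum ℂ R := by
  obtain ⟨R', h'⟩ := mem_opResolventSet_iff.1 h'
  have hw : z' - z ≠ 0 := sub_ne_zero.2 hz
  rw [spectrum.notMem_iff]
  have e1 : (algebraMap ℂ (PlaneL2 →L[ℂ] PlaneL2) (z' - z)⁻¹ - R) *
      ((z' - z) • (1 + (z' - z) • R')) = 1 := by
    ext1 g
    have := h.resolvent_identity h' g
    simp only [Algebra.algebraMap_eq_smul_one, mul_apply_eq_comp, sub_apply,
      smul_apply, one_apply_eq_self, add_apply, map_smul, map_add]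
    have h4 : (z' - z) • R (R' g) = R' g - R g := eq_sub_of_add_eq' this.symm
    have h5 : (z' - z) • ((z' - z)⁻¹ • g - R g + (z' - z) • ((z' - z)⁻¹ • R' g - R (R' g))) =
        ((z' - z) * (z' - z)⁻¹) • g - (z' - z) • R g +
        (z' - z) • (((z' - z) * (z' - z)⁻¹) • R' g - (z' - z) • R (R' g)) := by module
    rw [h5, h4, mul_inv_cancel₀ hw]
    module
  have e2 : ((z' - z) • (1 + (z' - z) • R')) *
      (algebraMap ℂ (PlaneL2 →L[ℂ] PlaneL2) (z' - z)⁻¹ - R) = 1 := by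
    ext1 g
    have := h'.resolvent_identity h g
    simp only [Algebra.algebraMap_eq_smul_one, mul_apply_eq_comp, sub_apply,
      smul_apply, one_apply_eq_self, add_apply, map_smul, map_sub]
    have h4 : (z' - z) • R' (R g) = R' g - R g := by
      have h3 : (z' - z) • R' (R g) = -((z - z') • R' (R g)) := by module
      rw [h3, eq_sub_of_add_eq' this.symm, neg_sub]
    rw [inv_smul_smul₀ hw, smul_add, ← smul_add, smul_add, h4]
    module
  exact ⟨⟨_, _, e1, e2⟩, rfl⟩

/-- Points of the spectrum of `T` give points of the spectrum of the bounded operator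
`(T - z)⁻¹`. -/
theorem inv_sub_mem_spectrum (h : IsResolventAt T z R) {z' : ℂ} (hz : z' ≠ z)
    (h' : z' ∈ opSpectrum T) : (z' - z)⁻¹ ∈ spectrum ℂ R := by
  by_contra hn
  apply h'
  have hw : z' - z ≠ 0 := sub_ne_zero.2 hz
  rw [spectrum.notMem_iff] at hn
  obtain ⟨U, hU⟩ := hn
  set w := (z' - z)⁻¹ with hwdef
  have hw0 : w ≠ 0 := inv_ne_zero hw
  have hwz : w * (z' - z) = 1 := inv_mul_cancel₀ hw
  refine mem_opResolventSet_iff.2 ⟨w • ((↑U⁻¹ : PlaneL2 →L[ℂ] PlaneL2) * R), fun ψ η => ?_⟩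
  rw [h ψ η]
  have hU' : ∀ x y : PlaneL2, (↑U⁻¹ : PlaneL2 →L[ℂ] PlaneL2) x = y ↔ x = w • y - R y := by
    intro x y
    have hval : ∀ y, (↑U : PlaneL2 →L[ℂ] PlaneL2) y = w • y - R y := by
      intro y; rw [hU]; simp [Algebra.algebraMap_eq_smul_one]
    rw [← hval]
    constructor
    · rintro rfl
      rw [← mul_apply_eq_comp, Units.mul_inv, one_apply_eq_self]
    · rintro rfl
      rw [← mul_apply_eq_comp, Units.inv_mul, one_apply_eq_self]
  simp only [smul_apply, mul_apply_eq_comp]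
  rw [← map_smul, hU', ← map_smul]
  have e3 : w • (η - z' • ψ) = w • (η - z • ψ) - ψ := by
    rw [smul_sub, smul_sub, smul_smul, smul_smul, sub_sub]
    congr 1
    have : w * z' = w * z + 1 := by rw [← hwz]; ring
    rw [this, add_smul, one_smul]
  rw [e3, map_sub R (w • _), map_smul, sub_left_inj]
  constructor
  · intro h; rw [h]
  · intro h; exact smul_right_injective _ hw0 h

end IsResolventAt

/-! ### Self-adjoint bounded operators with spectral information -/

/-- A self-adjoint operator with spectrum in `[0, c]` satisfies `R² ≤ c R`. -/
theorem norm_sq_apply_le_of_spectrum {H : Type*} [NormedAddCommGroup H] [InnerProductSpace ℂ H]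
    [CompleteSpace H] {R : H →L[ℂ] H} (hR : IsSelfAdjoint R) {c : ℝ}
    (hc : ∀ x ∈ spectrum ℝ R, 0 ≤ x ∧ x ≤ c) (g : H) :
    ‖R g‖ ^ 2 ≤ c * (inner ℂ (R g) g).re := by
  have h0 : 0 ≤ cfc (fun x : ℝ => c * x - x * x) R := by
    apply cfc_nonneg
    intro x hx
    nlinarith [hc x hx]
  have h1 : cfc (fun x : ℝ => c * x - x * x) R = c • R - R * R := by
    rw [cfc_sub (fun x : ℝ => c * x) (fun x : ℝ => x * x) R, cfc_const_mul c (fun x => x) R,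
      cfc_mul (fun x : ℝ => x) (fun x : ℝ => x) R, cfc_id' ℝ R]
  rw [h1, ContinuousLinearMap.nonneg_iff_isPositive] at h0
  have h2 := h0.re_inner_nonneg_left g
  simp only [sub_apply, smul_apply, mul_apply_eq_comp, inner_sub_left] at h2
  have h3 : inner ℂ (R (R g)) g = inner ℂ (R g) (R g) :=
    (ContinuousLinearMap.isSelfAdjoint_iff_isSymmetric.1 hR) _ _
  rw [h3] at h2
  have h4 : inner ℂ (c • R g) g = (c : ℂ) * inner ℂ (R g) g := by
    rw [← Complex.coe_smul, inner_smul_left]; simp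
  rw [h4] at h2
  rw [← @inner_self_eq_norm_sq ℂ]
  simp only [map_sub, RCLike.re_to_complex, Complex.re_ofReal_mul] at h2 ⊢
  linarith

/-- If `w` is a simple eigenvalue of the self-adjoint operator `R` with eigenvector `φ` and the rest
of the spectrum of `R` lies in `[-c, c]`, then `‖R g‖ ≤ c ‖g‖` on the orthogonal complement of `φ`.
The spectral projection at `w` is available because `w` is isolated in the spectrum. -/
theorem norm_apply_le_of_simple_eigenvalue {H : Type*} [NormedAddCommGroup H]
    [InnerProductSpace ℂ H] [CompleteSpace H] {R : H →L[ℂ] H} (hR : IsSelfAdjoint R)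
    {w c : ℝ} {φ : H} (hc0 : 0 ≤ c) (hcw : c < w)
    (hsimple : ∀ ψ, R ψ = w • ψ → ∃ a : ℂ, ψ = a • φ)
    (hspec : ∀ x ∈ spectrum ℝ R, x ≠ w → |x| ≤ c) {g : H} (hg : inner ℂ φ g = 0) :
    ‖R g‖ ≤ c * ‖g‖ := by
  classical
  set f : ℝ → ℝ := fun x => if x = w then 1 else 0 with hf
  have hcont : ContinuousOn f (spectrum ℝ R) := by
    intro x hx
    by_cases hxw : x = w
    · have : f =ᶠ[nhdsWithin x (spectrum ℝ R)] fun _ => 1 := by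
        have h1 : Set.Ioi c ∈ nhds x := Ioi_mem_nhds (hxw ▸ hcw)
        filter_upwards [mem_nhdsWithin_of_mem_nhds h1, self_mem_nhdsWithin] with y hy hys
        have : y = w := by
          by_contra hne
          exact absurd (hspec y hys hne) (not_le.2 (lt_of_lt_of_le hy (le_abs_self y)))
        simp [hf, this]
      exact (continuousWithinAt_const).congr_of_eventuallyEq this (by simp [hf, hxw])
    · have : f =ᶠ[nhdsWithin x (spectrum ℝ R)] fun _ => 0 := by
        filter_upwards [mem_nhdsWithin_of_mem_nhds (isOpen_ne.mem_nhds hxw)] with y hy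
        simp only [hf, if_neg hy]
      exact (continuousWithinAt_const).congr_of_eventuallyEq this (by simp [hf, hxw])
  set p := cfc f R with hp
  have hpsa : IsSelfAdjoint p := cfc_predicate f R
  have hRp : R * p = w • p := by
    calc R * p = cfc (fun x : ℝ => x) R * cfc f R := by rw [cfc_id' ℝ R]
      _ = cfc (fun x : ℝ => x * f x) R := (cfc_mul (fun x : ℝ => x) f R).symm
      _ = cfc (fun x : ℝ => w * f x) R := by
        congr 1; ext x; simp only [hf]; split_ifs with h <;> simp [h]
      _ = w • p := cfc_const_mul w f R
  have hpp : p * p = p := by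
    rw [hp, ← cfc_mul f f R hcont hcont]
    congr 1; ext x; simp only [hf]; split_ifs <;> simp
  have hpg : p g = 0 := by
    obtain ⟨a, ha⟩ := hsimple (p g) (by
      rw [← mul_apply_eq_comp, hRp]; rfl)
    have h1 : inner ℂ (p g) (p g) = 0 := by
      have h2 : inner ℂ (p g) (p g) = inner ℂ (p (p g)) g :=
        ((ContinuousLinearMap.isSelfAdjoint_iff_isSymmetric.1 hpsa) _ _).symm
      rw [h2, ← mul_apply_eq_comp, hpp, ha, inner_smul_left, hg, mul_zero]
    exact inner_self_eq_zero.1 h1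
  have hRg : R g = (R - R * p) g := by
    simp [mul_apply_eq_comp, hpg]
  have hnorm : ‖R - R * p‖ ≤ c := by
    have : R - R * p = cfc (fun x => x - x * f x) R := by
      rw [cfc_sub (fun x : ℝ => x) (fun x => x * f x) R, cfc_mul (fun x : ℝ => x) f R,
        cfc_id' ℝ R]
    rw [this]
    refine norm_cfc_le hc0 fun x hx => ?_
    by_cases hxw : x = w
    · simp [hf, hxw, hc0]
    · simpa [hf, hxw] using hspec x hx hxw
  rw [hRg]
  exact (ContinuousLinearMap.le_opNorm _ _).trans (by gcongr)

/-! ### Spectral bounds for symmetric operators -/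

theorem ofReal_mem_opSpectrum_of_mem_spectrum {T : PlaneL2 →ₗ.[ℂ] PlaneL2} {μ : ℝ}
    {R : PlaneL2 →L[ℂ] PlaneL2} (h : IsResolventAt T μ R) {x : ℝ} (hx0 : x ≠ 0)
    (hx : x ∈ spectrum ℝ R) : ((μ + x⁻¹ : ℝ) : ℂ) ∈ opSpectrum T := by
  intro hn
  have h1 : ((μ + x⁻¹ : ℝ) : ℂ) ≠ μ := by
    simpa using hx0
  have h2 := h.inv_sub_notMem_spectrum h1 hn
  apply h2
  have : (((μ + x⁻¹ : ℝ) : ℂ) - μ)⁻¹ = algebraMap ℝ ℂ x := by simp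
  rw [this, spectrum.algebraMap_mem_iff]
  exact hx

/-- If the spectrum of `T` lies in `Re z ≥ e`, then the resolvent at a real point `μ < e` has its
spectrum in `[0, 1/(e - μ)]`. -/
theorem spectrum_resolvent_bounds {T : PlaneL2 →ₗ.[ℂ] PlaneL2} {e μ : ℝ}
    (he : ∀ z ∈ opSpectrum T, e ≤ z.re) (hμ : μ < e)
    {R : PlaneL2 →L[ℂ] PlaneL2} (h : IsResolventAt T μ R) :
    ∀ x ∈ spectrum ℝ R, 0 ≤ x ∧ x ≤ (e - μ)⁻¹ := by
  intro x hx
  have hpos : 0 < e - μ := sub_pos.2 hμ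
  rcases eq_or_ne x 0 with rfl | hx0
  · exact ⟨le_rfl, by positivity⟩
  have h1 := he _ (ofReal_mem_opSpectrum_of_mem_spectrum h hx0 hx)
  rw [Complex.ofReal_re] at h1
  have h2 : e - μ ≤ x⁻¹ := by linarith
  have h3 : 0 < x := inv_pos.1 (hpos.trans_le h2)
  exact ⟨h3.le, (le_inv_comm₀ hpos h3).1 h2⟩

theorem exists_resolvent_of_lt {T : PlaneL2 →ₗ.[ℂ] PlaneL2} {e μ : ℝ}
    (he : ∀ z ∈ opSpectrum T, e ≤ z.re) (hμ : μ < e) : ∃ R, IsResolventAt T μ R := by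
  rw [← mem_opResolventSet_iff]
  by_contra hn
  have := he _ hn
  rw [Complex.ofReal_re] at this
  linarith

/-- The quadratic form of a symmetric operator is bounded below by the bottom of its spectrum. -/
theorem GraphSymmetric.le_re_inner {T : PlaneL2 →ₗ.[ℂ] PlaneL2} (hT : GraphSymmetric T) {e : ℝ}
    (he : ∀ z ∈ opSpectrum T, e ≤ z.re) {ψ η : PlaneL2} (hψ : (ψ, η) ∈ T.graph) :
    e * ‖ψ‖ ^ 2 ≤ (inner ℂ ψ η).re := by
  obtain ⟨R, hR⟩ := exists_resolvent_of_lt he (sub_one_lt e)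
  have h1 := norm_sq_apply_le_of_spectrum (hR.isSelfAdjoint hT)
    (spectrum_resolvent_bounds he (sub_one_lt e) hR) (η - ((e - 1 : ℝ) : ℂ) • ψ)
  rw [(hR ψ η).1 hψ, inner_sub_right, inner_smul_right, inner_self_eq_norm_sq_to_K] at h1
  have h2 : (((e - 1 : ℝ) : ℂ) * ((‖ψ‖ : ℝ) : ℂ) ^ 2).re = (e - 1) * ‖ψ‖ ^ 2 := by
    rw [← Complex.ofReal_pow, ← Complex.ofReal_mul, Complex.ofReal_re]
  simp only [Complex.sub_re, Complex.coe_algebraMap, sub_sub_cancel, inv_one, one_mul] at h1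
  rw [h2] at h1
  linarith

/-- With a spectral gap `c` above a simple ground state `φ`, the resolvent at a real point `μ` below
the ground energy `e` has norm at most `1/(e + c - μ)` on the orthogonal complement of `φ`. -/
theorem norm_resolvent_le_of_gap {T : PlaneL2 →ₗ.[ℂ] PlaneL2} (hT : GraphSymmetric T) {e c μ : ℝ}
    {φ : PlaneL2} (he : IsGroundEnergy T e) (hgap : HasSimpleGap T e φ c) (hc : 0 < c)
    (hμ : μ < e) {R : PlaneL2 →L[ℂ] PlaneL2} (h : IsResolventAt T μ R) {g : PlaneL2}
    (hg : inner ℂ φ g = 0) : ‖R g‖ ≤ (e + c - μ)⁻¹ * ‖g‖ := by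
  have hpos : 0 < e - μ := sub_pos.2 hμ
  refine norm_apply_le_of_simple_eigenvalue (h.isSelfAdjoint hT) (w := (e - μ)⁻¹) (φ := φ)
    (by rw [inv_nonneg]; linarith) (inv_strictAnti₀ hpos (by linarith)) ?_ ?_ hg
  · intro ψ hψ
    apply hgap.1
    rw [satisfiesEigenEq_iff, h]
    have h1 : (e : ℂ) • ψ - (μ : ℂ) • ψ = ((e - μ : ℝ) : ℂ) • ψ := by
      push_cast; module
    rw [h1, map_smul, hψ, ← Complex.coe_smul, smul_smul, ← Complex.ofReal_mul,
      mul_inv_cancel₀ hpos.ne', Complex.ofReal_one, one_smul]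
  · intro x hx hxw
    have hb := spectrum_resolvent_bounds he.2 hμ h x hx
    rw [abs_of_nonneg hb.1]
    rcases eq_or_ne x 0 with rfl | hx0
    · rw [inv_nonneg]; linarith
    have hx1 : 0 < x := lt_of_le_of_ne hb.1 hx0.symm
    have hs := ofReal_mem_opSpectrum_of_mem_spectrum h hx0 hx
    have h1 := he.2 _ hs
    have h2 := hgap.2 _ hs (by
      intro heq
      have := Complex.ofReal_injective heq
      apply hxw
      rw [← this]; simp)
    rw [← Complex.ofReal_sub, Complex.norm_real, Real.norm_eq_abs] at h2
    rw [Complex.ofReal_re] at h1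
    rw [abs_of_nonneg (by linarith)] at h2
    rw [le_inv_comm₀ hx1 (by linarith)]
    linarith

/-- A symmetric operator that is bounded below and has a resolvent at a real point `μ` below this
bound has a bottom of the spectrum, namely `μ + 1 / ‖(T - μ)⁻¹‖`. -/
theorem exists_isGroundEnergy {T : PlaneL2 →ₗ.[ℂ] PlaneL2} (hT : GraphSymmetric T) {μ : ℝ}
    {R : PlaneL2 →L[ℂ] PlaneL2} (h : IsResolventAt T μ R)
    (hbelow : ∀ ψ η, (ψ, η) ∈ T.graph → μ * ‖ψ‖ ^ 2 ≤ (inner ℂ ψ η).re)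
    [Nontrivial PlaneL2] : ∃ e : ℝ, IsGroundEnergy T e := by
  have hRsa := h.isSelfAdjoint hT
  have hpos : 0 ≤ R := by
    rw [ContinuousLinearMap.nonneg_iff_isPositive, ContinuousLinearMap.isPositive_def']
    refine ⟨hRsa, fun g => ?_⟩
    have h1 := hbelow _ _ (h.apply_mem_graph g)
    rw [inner_add_right, inner_smul_right, inner_self_eq_norm_sq_to_K] at h1
    have h2 : ((μ : ℂ) * ((‖R g‖ : ℝ) : ℂ) ^ 2).re = μ * ‖R g‖ ^ 2 := by
      rw [← Complex.ofReal_pow, ← Complex.ofReal_mul, Complex.ofReal_re]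
    simp only [Complex.add_re, Complex.coe_algebraMap] at h1
    rw [h2] at h1
    rw [ContinuousLinearMap.reApplyInnerSelf_apply]
    simp only [RCLike.re_to_complex]
    linarith
  have hR0 : R ≠ 0 := by
    rintro rfl
    obtain ⟨g, hg⟩ := exists_ne (0 : PlaneL2)
    exact hg (T.graph_fst_eq_zero_snd (by simpa using h.apply_mem_graph g) rfl)
  have hw : 0 < ‖R‖ := norm_pos_iff.2 hR0
  have hmem : ‖R‖ ∈ spectrum ℝ R := CStarAlgebra.norm_mem_spectrum_of_nonneg
  refine ⟨μ + ‖R‖⁻¹, ofReal_mem_opSpectrum_of_mem_spectrum h hw.ne' hmem, fun z hz => ?_⟩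
  have hzμ : z ≠ μ := by
    rintro rfl
    exact hz (mem_opResolventSet_iff.2 ⟨R, h⟩)
  have hwz : z - μ ≠ 0 := sub_ne_zero.2 hzμ
  have h1 := h.inv_sub_mem_spectrum hzμ hz
  obtain ⟨x, hx⟩ : ∃ x : ℝ, (z - μ)⁻¹ = x :=
    ⟨_, hRsa.mem_spectrum_eq_re h1⟩
  rw [hx] at h1
  have h2 : x ∈ spectrum ℝ R := (spectrum.algebraMap_mem_iff ℂ).1 h1
  have h3 : 0 ≤ x := spectrum_nonneg_of_nonneg hpos h2
  have hx0 : x ≠ 0 := by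
    rintro rfl
    exact inv_ne_zero hwz (by simpa using hx)
  have h4 : x ≤ ‖R‖ := (Real.le_norm_self x).trans (spectrum.norm_le_norm_of_mem h2)
  have h5 : z = ((μ + x⁻¹ : ℝ) : ℂ) := by
    rw [← inv_inj, inv_inv] at hx
    push_cast; rw [← hx]; ring
  rw [h5, Complex.ofReal_re]
  have : ‖R‖⁻¹ ≤ x⁻¹ := inv_anti₀ (lt_of_le_of_ne h3 hx0.symm) h4
  linarith

/-! ### Bounded perturbations -/

/-- `T'` is the perturbation `T + M` of `T` by the bounded operator `M`, in terms of graphs. -/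
def IsPerturbation (T T' : PlaneL2 →ₗ.[ℂ] PlaneL2) (M : PlaneL2 →L[ℂ] PlaneL2) : Prop :=
  ∀ ψ η, (ψ, η) ∈ T'.graph ↔ (ψ, η - M ψ) ∈ T.graph

/-- If `1 + (T - z)⁻¹ M` is invertible, then `z` is in the resolvent set of `T + M`. -/
theorem IsPerturbation.exists_isResolventAt {T T' : PlaneL2 →ₗ.[ℂ] PlaneL2}
    {M R : PlaneL2 →L[ℂ] PlaneL2} {z : ℂ} (hM : IsPerturbation T T' M) (h : IsResolventAt T z R)
    (hU : IsUnit (1 + R * M)) : ∃ R', IsResolventAt T' z R' := by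
  obtain ⟨U, hU⟩ := hU
  refine ⟨(↑U⁻¹ : PlaneL2 →L[ℂ] PlaneL2) * R, fun ψ η => ?_⟩
  rw [hM, h]
  have hval : (↑U : PlaneL2 →L[ℂ] PlaneL2) ψ = ψ + R (M ψ) := by rw [hU]; rfl
  have e1 : η - M ψ - z • ψ = η - z • ψ - M ψ := by abel
  rw [e1, map_sub, sub_eq_iff_eq_add, ← hval]
  constructor
  · intro h1
    rw [mul_apply_eq_comp, h1, ← mul_apply_eq_comp, Units.inv_mul]; rfl
  · intro h1
    conv_rhs => rw [← h1]
    rw [← mul_apply_eq_comp, ← mul_assoc, Units.mul_inv, one_mul]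

/-- Neumann series. -/
theorem isUnit_one_add_of_norm_lt_one {A : PlaneL2 →L[ℂ] PlaneL2} (hA : ‖A‖ < 1) :
    IsUnit (1 + A) := by
  simpa using isUnit_one_sub_of_norm_lt_one (x := -A) (by simpa using hA)

/-- Fredholm alternative: if `(T - z)⁻¹ A` is compact and `‖(T - z)⁻¹ B‖ < 1`, then either `z` is in
the resolvent set of `T + A + B` or `z` is an eigenvalue. -/
theorem IsPerturbation.exists_eigenvector {T T' : PlaneL2 →ₗ.[ℂ] PlaneL2}
    {A B R : PlaneL2 →L[ℂ] PlaneL2} {z : ℂ} (hM : IsPerturbation T T' (A + B))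
    (h : IsResolventAt T z R) (hA : IsCompactOperator (R * A)) (hB : ‖R * B‖ < 1)
    (hz : z ∈ opSpectrum T') : ∃ ψ : PlaneL2, ψ ≠ 0 ∧ (ψ, z • ψ) ∈ T'.graph := by
  obtain ⟨U, hU⟩ := isUnit_one_add_of_norm_lt_one hB
  set K : PlaneL2 →L[ℂ] PlaneL2 := ↑U⁻¹ * (R * A) with hK
  have hKc : IsCompactOperator K := hA.clm_comp (↑U⁻¹ : PlaneL2 →L[ℂ] PlaneL2)
  have hUK : (↑U : PlaneL2 →L[ℂ] PlaneL2) * (1 + K) = 1 + R * (A + B) := by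
    rw [mul_add, mul_one, hK, ← mul_assoc, Units.mul_inv, one_mul, hU, mul_add]
    abel
  rcases hKc.hasEigenvalue_or_mem_resolventSet (μ := -1) (by simp) with h1 | h1
  · obtain ⟨ψ, hψ⟩ := h1.exists_hasEigenvector
    refine ⟨ψ, hψ.2, ?_⟩
    have h2 : K ψ = -ψ := by simpa using hψ.apply_eq_smul
    rw [hM, h]
    have h3 : (1 + R * (A + B)) ψ = 0 := by
      rw [← hUK, mul_apply_eq_comp]
      simp [h2]
    have h4 : ψ + R ((A + B) ψ) = 0 := h3
    have e1 : z • ψ - (A + B) ψ - z • ψ = - (A + B) ψ := by abel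
    rw [e1, ← eq_neg_iff_add_eq_zero] at *
    rw [map_neg]
    exact h4.symm
  · exfalso
    apply hz
    rw [mem_opResolventSet_iff]
    apply hM.exists_isResolventAt h
    rw [← hUK]
    refine U.isUnit.mul ?_
    have h2 : IsUnit (algebraMap ℂ (PlaneL2 →L[ℂ] PlaneL2) (-1) - K) := h1
    rw [map_neg, map_one] at h2
    have h3 := h2.neg
    rwa [neg_sub, sub_neg_eq_add, add_comm] at h3

/-! ### Test functions and the closed operator -/

open ComplexConjugate in
theorem inner_eq_integral_conj_mul {a b : PlaneL2} {f g : Plane → ℂ} (ha : a =ᵐ[volume] f)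
    (hb : b =ᵐ[volume] g) : inner ℂ a b = ∫ x, conj (f x) * g x := by
  rw [L2.inner_def]
  refine integral_congr_ae ?_
  filter_upwards [ha, hb] with x h1 h2
  rw [h1, h2, RCLike.inner_apply, mul_comm]

theorem magMomentum_hasCompactSupport {lam : ℝ} {j : Fin 2} {f : Plane → ℂ}
    (hf : HasCompactSupport f) : HasCompactSupport (magMomentum lam j f) := by
  have h1 := (hf.fderiv_apply (𝕜 := ℝ) (EuclideanSpace.single j 1)).mul_left
    (f := fun _ => -Complex.I)
  have h2 := hf.mul_left (f := fun x => ((lam / 2 * planePerp x j : ℝ) : ℂ))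
  exact h1.sub h2

theorem schrodingerExpr_zero_contDiff {lam : ℝ} {f : Plane → ℂ} (hf : ContDiff ℝ ∞ f) :
    ContDiff ℝ ∞ (schrodingerExpr lam (fun _ => 0) f) := by
  have h := fun j => magMomentum_contDiff (lam := lam) (j := j)
    (magMomentum_contDiff (lam := lam) (j := j) hf)
  have : schrodingerExpr lam (fun _ => 0) f = fun x => magMomentum lam 0 (magMomentum lam 0 f) x +
      magMomentum lam 1 (magMomentum lam 1 f) x := by
    funext x; simp [schrodingerExpr]
  rw [this]
  exact (h 0).add (h 1)

theorem schrodingerExpr_eq_add {lam : ℝ} (V : Plane → ℝ) (f : Plane → ℂ) (x : Plane) :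
    schrodingerExpr lam V f x = schrodingerExpr lam (fun _ => 0) f x + (V x : ℂ) * f x := by
  simp [schrodingerExpr]

theorem schrodingerExpr_continuous {lam : ℝ} {V : Plane → ℝ} (hV : Continuous V) {f : Plane → ℂ}
    (hf : ContDiff ℝ ∞ f) : Continuous (schrodingerExpr lam V f) := by
  have : schrodingerExpr lam V f = fun x =>
      schrodingerExpr lam (fun _ => 0) f x + (V x : ℂ) * f x :=
    funext (schrodingerExpr_eq_add V f)
  rw [this]
  exact (schrodingerExpr_zero_contDiff hf).continuous.add
    ((Complex.continuous_ofReal.comp hV).mul hf.continuous)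

theorem schrodingerExpr_hasCompactSupport {lam : ℝ} {V : Plane → ℝ} {f : Plane → ℂ}
    (hf : HasCompactSupport f) : HasCompactSupport (schrodingerExpr lam V f) := by
  have h := fun j => magMomentum_hasCompactSupport (lam := lam) (j := j)
    (magMomentum_hasCompactSupport (lam := lam) (j := j) hf)
  exact ((h 0).add (h 1)).add (hf.mul_left (f := fun x => (V x : ℂ)))

open ComplexConjugate in
/-- Integration by parts: the magnetic momentum is symmetric. -/
theorem integral_conj_magMomentum_mul {lam : ℝ} {j : Fin 2} {f g : Plane → ℂ}
    (hf : ContDiff ℝ ∞ f) (hg : ContDiff ℝ ∞ g) (hgc : HasCompactSupport g) :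
    ∫ x, conj (magMomentum lam j f x) * g x = ∫ x, conj (f x) * magMomentum lam j g x := by
  set e : Plane := EuclideanSpace.single j 1
  have hcf : ContDiff ℝ ∞ (fun x => conj (f x)) := Complex.conjCLE.contDiff.comp hf
  have hfd : Continuous (fun x => fderiv ℝ (fun x => conj (f x)) x e) :=
    (hcf.continuous_fderiv (by simp)).clm_apply continuous_const
  have hgd : Continuous (fun x => fderiv ℝ g x e) :=
    (hg.continuous_fderiv (by simp)).clm_apply continuous_const
  have hA : Continuous (fun x : Plane => ((lam / 2 * planePerp x j : ℝ) : ℂ)) := by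
    apply Complex.continuous_ofReal.comp
    fin_cases j
    · simp [planePerp]; fun_prop
    · simp [planePerp]; fun_prop
  have hgdc : HasCompactSupport (fun x => fderiv ℝ g x e) := hgc.fderiv_apply (𝕜 := ℝ) e
  have i1 : Integrable (fun x => fderiv ℝ (fun x => conj (f x)) x e * g x) :=
    (hfd.mul hg.continuous).integrable_of_hasCompactSupport hgc.mul_left
  have i2 : Integrable (fun x => conj (f x) * fderiv ℝ g x e) :=
    (hcf.continuous.mul hgd).integrable_of_hasCompactSupport hgdc.mul_left
  have i3 : Integrable (fun x => conj (f x) * g x) :=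
    (hcf.continuous.mul hg.continuous).integrable_of_hasCompactSupport hgc.mul_left
  have i4 : Integrable (fun x => ((lam / 2 * planePerp x j : ℝ) : ℂ) * (conj (f x) * g x)) :=
    (hA.mul (hcf.continuous.mul hg.continuous)).integrable_of_hasCompactSupport
      hgc.mul_left.mul_left
  have hparts := integral_mul_fderiv_eq_neg_fderiv_mul_of_integrable i1 i2 i3
    (fun x _ => (hcf.differentiable (by simp)).differentiableAt)
    (fun x _ => (hg.differentiable (by simp)).differentiableAt)
  have hconj : ∀ x, fderiv ℝ (fun x => conj (f x)) x e = conj (fderiv ℝ f x e) := by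
    intro x
    have hd : DifferentiableAt ℝ f x := (hf.differentiable (by simp)).differentiableAt
    have := (Complex.conjCLE.toContinuousLinearMap.hasFDerivAt.comp x hd.hasFDerivAt).fderiv
    have h2 := congrArg (fun L => L e) this
    exact h2
  have e1 : ∀ x, conj (magMomentum lam j f x) * g x =
      Complex.I * (fderiv ℝ (fun x => conj (f x)) x e * g x) -
        ((lam / 2 * planePerp x j : ℝ) : ℂ) * (conj (f x) * g x) := by
    intro x
    rw [hconj]
    simp only [magMomentum, map_sub, map_mul, map_neg, Complex.conj_I, Complex.conj_ofReal]
    ring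
  have e2 : ∀ x, conj (f x) * magMomentum lam j g x =
      -Complex.I * (conj (f x) * fderiv ℝ g x e) -
        ((lam / 2 * planePerp x j : ℝ) : ℂ) * (conj (f x) * g x) := by
    intro x
    simp only [magMomentum]
    ring
  simp_rw [e1, e2]
  rw [integral_sub (i1.const_mul _) i4, integral_sub (i2.const_mul _) i4, integral_const_mul,
    integral_const_mul, hparts]
  ring

open ComplexConjugate in
/-- Symmetry of `(P - A)² + V`; only one of the two functions has compact support. -/
theorem integral_conj_schrodingerExpr_mul {lam : ℝ} {V : Plane → ℝ} (hV : Continuous V)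
    {f g : Plane → ℂ} (hf : ContDiff ℝ ∞ f) (hg : ContDiff ℝ ∞ g) (hgc : HasCompactSupport g) :
    ∫ x, conj (schrodingerExpr lam V f x) * g x = ∫ x, conj (f x) * schrodingerExpr lam V g x := by
  have hM : ∀ j, ∫ x, conj (magMomentum lam j (magMomentum lam j f) x) * g x =
      ∫ x, conj (f x) * magMomentum lam j (magMomentum lam j g) x := fun j => by
    rw [integral_conj_magMomentum_mul (magMomentum_contDiff hf) hg hgc,
      integral_conj_magMomentum_mul hf (magMomentum_contDiff hg)
        (magMomentum_hasCompactSupport hgc)]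
  have hVc : Continuous (fun x => (V x : ℂ)) := Complex.continuous_ofReal.comp hV
  have hcf : Continuous (fun x => conj (f x)) := Complex.continuous_conj.comp hf.continuous
  have i1 : ∀ j, Integrable (fun x => conj (magMomentum lam j (magMomentum lam j f) x) * g x) :=
    fun j => ((Complex.continuous_conj.comp
      (magMomentum_contDiff (magMomentum_contDiff hf)).continuous).mul
        hg.continuous).integrable_of_hasCompactSupport hgc.mul_left
  have i2 : ∀ j, Integrable (fun x => conj (f x) * magMomentum lam j (magMomentum lam j g) x) :=
    fun j => (hcf.mul
      (magMomentum_contDiff (magMomentum_contDiff hg)).continuous).integrable_of_hasCompactSupport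
        (magMomentum_hasCompactSupport (magMomentum_hasCompactSupport hgc)).mul_left
  have i3 : Integrable (fun x => conj (f x) * ((V x : ℂ) * g x)) :=
    (hcf.mul (hVc.mul hg.continuous)).integrable_of_hasCompactSupport hgc.mul_left.mul_left
  have e1 : ∀ x, conj (schrodingerExpr lam V f x) * g x =
      conj (magMomentum lam 0 (magMomentum lam 0 f) x) * g x +
      conj (magMomentum lam 1 (magMomentum lam 1 f) x) * g x + conj (f x) * ((V x : ℂ) * g x) := by
    intro x
    simp only [schrodingerExpr, map_add, map_mul, Complex.conj_ofReal]
    ring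
  have e2 : ∀ x, conj (f x) * schrodingerExpr lam V g x =
      conj (f x) * magMomentum lam 0 (magMomentum lam 0 g) x +
      conj (f x) * magMomentum lam 1 (magMomentum lam 1 g) x + conj (f x) * ((V x : ℂ) * g x) := by
    intro x
    simp only [schrodingerExpr]
    ring
  simp_rw [e1, e2]
  have s1 : Integrable (fun x => conj (magMomentum lam 0 (magMomentum lam 0 f) x) * g x +
      conj (magMomentum lam 1 (magMomentum lam 1 f) x) * g x) := (i1 0).add (i1 1)
  have s2 : Integrable (fun x => conj (f x) * magMomentum lam 0 (magMomentum lam 0 g) x +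
      conj (f x) * magMomentum lam 1 (magMomentum lam 1 g) x) := (i2 0).add (i2 1)
  rw [integral_add s1 i3, integral_add s2 i3, integral_add (i1 0) (i1 1),
    integral_add (i2 0) (i2 1), hM, hM]

open ComplexConjugate in
/-- The kinetic energy of a test function is non-negative. -/
theorem re_integral_conj_mul_schrodingerExpr_nonneg {lam : ℝ}
    {f : Plane → ℂ} (hf : ContDiff ℝ ∞ f) (hfc : HasCompactSupport f) :
    0 ≤ (∫ x, conj (f x) * schrodingerExpr lam (fun _ => 0) f x).re := by
  have i2 : ∀ j, Integrable (fun x => conj (f x) * magMomentum lam j (magMomentum lam j f) x) :=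
    fun j => ((Complex.continuous_conj.comp hf.continuous).mul
      (magMomentum_contDiff (magMomentum_contDiff hf)).continuous).integrable_of_hasCompactSupport
        (magMomentum_hasCompactSupport (magMomentum_hasCompactSupport hfc)).mul_left
  have h : ∀ j, 0 ≤ (∫ x, conj (f x) * magMomentum lam j (magMomentum lam j f) x).re := fun j => by
    rw [← integral_conj_magMomentum_mul hf (magMomentum_contDiff hf)
      (magMomentum_hasCompactSupport hfc)]
    have : ∀ x, conj (magMomentum lam j f x) * magMomentum lam j f x =
        ((‖magMomentum lam j f x‖ ^ 2 : ℝ) : ℂ) := fun x => by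
      rw [mul_comm, Complex.mul_conj, Complex.normSq_eq_norm_sq]
    simp_rw [this]
    rw [integral_complex_ofReal, Complex.ofReal_re]
    exact integral_nonneg fun x => by positivity
  have e2 : ∀ x, conj (f x) * schrodingerExpr lam (fun _ => 0) f x =
      conj (f x) * magMomentum lam 0 (magMomentum lam 0 f) x +
      conj (f x) * magMomentum lam 1 (magMomentum lam 1 f) x := by
    intro x
    simp only [schrodingerExpr, Complex.ofReal_zero, zero_mul, add_zero]
    ring
  simp_rw [e2]
  rw [integral_add (i2 0) (i2 1), Complex.add_re]
  exact add_nonneg (h 0) (h 1)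

theorem testFunction_memLp {f : Plane → ℂ} (hf : Continuous f) (hfc : HasCompactSupport f) :
    MemLp f 2 (volume : Measure Plane) :=
  hf.memLp_of_hasCompactSupport hfc

/-- Each test function `f` gives the element `(f, (P - A)² f + V f)` of the core graph. -/
theorem toLp_mem_coreGraph {lam : ℝ} {V : Plane → ℝ} (hV : Continuous V) {f : Plane → ℂ}
    (hf : ContDiff ℝ ∞ f) (hfc : HasCompactSupport f) :
    ((testFunction_memLp hf.continuous hfc).toLp,
      (testFunction_memLp (schrodingerExpr_continuous (lam := lam) hV hf)
        (schrodingerExpr_hasCompactSupport hfc)).toLp) ∈ coreGraph lam V :=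
  ⟨f, hf, hfc, MemLp.coeFn_toLp (testFunction_memLp hf.continuous hfc),
    MemLp.coeFn_toLp (testFunction_memLp (schrodingerExpr_continuous (lam := lam) hV hf)
      (schrodingerExpr_hasCompactSupport hfc))⟩

open ComplexConjugate in
/-- An `L²` function that is orthogonal to all test functions vanishes. -/
theorem eq_zero_of_forall_integral_conj_mul {u : PlaneL2}
    (h : ∀ f : Plane → ℂ, ContDiff ℝ ∞ f → HasCompactSupport f → ∫ x, conj (f x) * u x = 0) :
    u = 0 := by
  have h1 : LocallyIntegrable (u : Plane → ℂ) volume :=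
    (Lp.memLp u).locallyIntegrable (by norm_num)
  have h2 := ae_eq_zero_of_integral_contDiff_smul_eq_zero h1 (fun g hg hgc => by
    have h3 := h (fun x => (g x : ℂ)) (Complex.ofRealCLM.contDiff.comp hg)
      (hgc.comp_left (g := fun r : ℝ => (r : ℂ)) (by simp))
    simpa using h3)
  exact Lp.ext (Filter.EventuallyEq.trans h2 (Lp.coeFn_zero _ _ _).symm)

theorem coreGraph_symmetric {lam : ℝ} {V : Plane → ℝ} (hV : Continuous V) {p q : PlaneL2 × PlaneL2}
    (hp : p ∈ coreGraph lam V) (hq : q ∈ coreGraph lam V) :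
    inner ℂ p.1 q.2 = inner ℂ p.2 q.1 := by
  obtain ⟨f, hf, hfc, h1, h2⟩ := hp
  obtain ⟨g, hg, hgc, h3, h4⟩ := hq
  rw [inner_eq_integral_conj_mul h1 h4, inner_eq_integral_conj_mul h2 h3,
    integral_conj_schrodingerExpr_mul hV hf hg hgc]

theorem coreGraph_closure_symmetric {lam : ℝ} {V : Plane → ℝ} (hV : Continuous V)
    {p q : PlaneL2 × PlaneL2}
    (hp : p ∈ (coreGraph lam V).topologicalClosure)
    (hq : q ∈ (coreGraph lam V).topologicalClosure) :
    inner ℂ p.1 q.2 = inner ℂ p.2 q.1 := by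
  have h1 : ∀ q ∈ coreGraph lam V, ∀ p ∈ (coreGraph lam V).topologicalClosure,
      inner ℂ p.1 q.2 = inner ℂ p.2 q.1 := by
    intro q hq p hp
    have hcl : IsClosed {p : PlaneL2 × PlaneL2 | inner ℂ p.1 q.2 = inner ℂ p.2 q.1} :=
      isClosed_eq (by fun_prop) (by fun_prop)
    exact closure_minimal (fun p hp => coreGraph_symmetric hV hp hq) hcl hp
  have hcl : IsClosed {q : PlaneL2 × PlaneL2 | inner ℂ p.1 q.2 = inner ℂ p.2 q.1} :=
    isClosed_eq (by fun_prop) (by fun_prop)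
  exact closure_minimal (fun q hq => h1 q hq p hp) hcl hq

/-- The operator on test functions is closable (being symmetric), so the graph of
`magneticHamiltonian` is the closure of the core graph. -/
theorem magneticHamiltonian_graph {lam : ℝ} {V : Plane → ℝ} (hV : Continuous V) :
    (magneticHamiltonian lam V).graph = (coreGraph lam V).topologicalClosure := by
  have hg : (coreGraph lam V).toLinearPMap.graph = coreGraph lam V :=
    Submodule.toLinearPMap_graph_eq _ (fun p hp h => coreGraph_single_valued lam V p hp h)
  have hclos : (coreGraph lam V).toLinearPMap.IsClosable := by
    refine ⟨(coreGraph lam V).topologicalClosure.toLinearPMap, ?_⟩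
    rw [hg, Submodule.toLinearPMap_graph_eq]
    intro p hp h0
    refine eq_zero_of_forall_integral_conj_mul fun f hf hfc => ?_
    have h1 := coreGraph_closure_symmetric hV hp
      (Submodule.le_topologicalClosure _ (toLp_mem_coreGraph (lam := lam) hV hf hfc))
    rw [h0, inner_zero_left] at h1
    rw [← inner_eq_integral_conj_mul (MemLp.coeFn_toLp (testFunction_memLp hf.continuous hfc))
      (Filter.EventuallyEq.refl _ _), ← inner_conj_symm, ← h1, map_zero]
  rw [magneticHamiltonian, ← hclos.graph_closure_eq_closure_graph, hg]

theorem magneticHamiltonian_symmetric {lam : ℝ} {V : Plane → ℝ} (hV : Continuous V) :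
    GraphSymmetric (magneticHamiltonian lam V) := by
  intro ψ η ψ' η' h h'
  rw [magneticHamiltonian_graph hV] at h h'
  exact coreGraph_closure_symmetric hV h h'

theorem magneticHamiltonian_zero_nonneg {lam : ℝ} {ψ η : PlaneL2}
    (h : (ψ, η) ∈ (magneticHamiltonian lam (fun _ => 0)).graph) : 0 ≤ (inner ℂ ψ η).re := by
  rw [magneticHamiltonian_graph continuous_const] at h
  have hcl : IsClosed {p : PlaneL2 × PlaneL2 | 0 ≤ (inner ℂ p.1 p.2).re} :=
    isClosed_le continuous_const (Complex.continuous_re.comp (by fun_prop))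
  refine closure_minimal ?_ hcl h
  rintro p ⟨f, hf, hfc, h1, h2⟩
  rw [Set.mem_ofPred_eq, inner_eq_integral_conj_mul h1 h2]
  exact re_integral_conj_mul_schrodingerExpr_nonneg hf hfc

/-! ### Multiplication by a bounded potential -/

theorem memLp_ofReal_mul {V : Plane → ℝ} (hV : Continuous V) {C : ℝ} (hC : ∀ x, |V x| ≤ C)
    {f : Plane → ℂ} (hf : MemLp f 2 (volume : Measure Plane)) :
    MemLp (fun x => (V x : ℂ) * f x) 2 (volume : Measure Plane) := by
  refine hf.of_le_mul (c := C)
    ((Complex.continuous_ofReal.comp hV).aestronglyMeasurable.mul hf.1) ?_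
  refine Filter.Eventually.of_forall fun x => ?_
  rw [norm_mul, Complex.norm_real]
  exact mul_le_mul_of_nonneg_right (hC x) (norm_nonneg _)

/-- Multiplication by the bounded continuous real function `V`, as a bounded operator on `L²`. -/
noncomputable def mulOp (V : Plane → ℝ) (hV : Continuous V) {C : ℝ} (hC : ∀ x, |V x| ≤ C) :
    PlaneL2 →L[ℂ] PlaneL2 :=
  LinearMap.mkContinuous
    { toFun := fun ψ => (memLp_ofReal_mul hV hC (Lp.memLp ψ)).toLp
      map_add' := fun ψ ψ' => by
        refine Lp.ext ?_
        filter_upwards [MemLp.coeFn_toLp (memLp_ofReal_mul hV hC (Lp.memLp (ψ + ψ'))),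
          MemLp.coeFn_toLp (memLp_ofReal_mul hV hC (Lp.memLp ψ)),
          MemLp.coeFn_toLp (memLp_ofReal_mul hV hC (Lp.memLp ψ')), Lp.coeFn_add ψ ψ',
          Lp.coeFn_add (memLp_ofReal_mul hV hC (Lp.memLp ψ)).toLp
            (memLp_ofReal_mul hV hC (Lp.memLp ψ')).toLp] with x h1 h2 h3 h4 h5
        rw [h1, h5, Pi.add_apply, h2, h3, h4, Pi.add_apply, mul_add]
      map_smul' := fun c ψ => by
        refine Lp.ext ?_
        filter_upwards [MemLp.coeFn_toLp (memLp_ofReal_mul hV hC (Lp.memLp (c • ψ))),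
          MemLp.coeFn_toLp (memLp_ofReal_mul hV hC (Lp.memLp ψ)), Lp.coeFn_smul c ψ,
          Lp.coeFn_smul c (memLp_ofReal_mul hV hC (Lp.memLp ψ)).toLp] with x h1 h2 h3 h4
        rw [RingHom.id_apply, h1, h4, Pi.smul_apply, h2, h3, Pi.smul_apply, smul_eq_mul,
          smul_eq_mul]
        ring } C fun ψ => by
    refine Lp.norm_le_mul_norm_of_ae_le_mul ?_
    filter_upwards [MemLp.coeFn_toLp (memLp_ofReal_mul hV hC (Lp.memLp ψ))] with x h1
    change ‖(MemLp.toLp _ (memLp_ofReal_mul hV hC (Lp.memLp ψ)) : PlaneL2) x‖ ≤ _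
    rw [h1, norm_mul, Complex.norm_real]
    exact mul_le_mul_of_nonneg_right (hC x) (norm_nonneg _)

section mulOp

variable {V : Plane → ℝ} {hV : Continuous V} {C : ℝ} {hC : ∀ x, |V x| ≤ C}

theorem mulOp_coeFn (ψ : PlaneL2) : mulOp V hV hC ψ =ᵐ[volume] fun x => (V x : ℂ) * ψ x :=
  MemLp.coeFn_toLp (memLp_ofReal_mul hV hC (Lp.memLp ψ))

theorem norm_mulOp_apply_le (ψ : PlaneL2) : ‖mulOp V hV hC ψ‖ ≤ C * ‖ψ‖ := by
  refine Lp.norm_le_mul_norm_of_ae_le_mul ?_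
  filter_upwards [mulOp_coeFn (hV := hV) (hC := hC) ψ] with x h1
  rw [h1, norm_mul, Complex.norm_real]
  exact mul_le_mul_of_nonneg_right (hC x) (norm_nonneg _)

theorem norm_mulOp_le : ‖mulOp V hV hC‖ ≤ C :=
  ContinuousLinearMap.opNorm_le_bound _ ((abs_nonneg _).trans (hC 0)) norm_mulOp_apply_le

theorem abs_re_inner_mulOp_le (ψ : PlaneL2) :
    |(inner ℂ ψ (mulOp V hV hC ψ)).re| ≤ C * ‖ψ‖ ^ 2 := by
  refine (Complex.abs_re_le_norm _).trans ((norm_inner_le_norm _ _).trans ?_)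
  rw [pow_two, ← mul_assoc, mul_comm]
  exact mul_le_mul_of_nonneg_right (norm_mulOp_apply_le ψ) (norm_nonneg _)

theorem re_inner_mulOp_nonpos (h : ∀ x, V x ≤ 0) (ψ : PlaneL2) :
    (inner ℂ ψ (mulOp V hV hC ψ)).re ≤ 0 := by
  rw [inner_eq_integral_conj_mul (Filter.EventuallyEq.refl _ _) (mulOp_coeFn ψ)]
  have : ∀ x, (starRingEnd ℂ) (ψ x) * ((V x : ℂ) * ψ x) = ((V x * ‖ψ x‖ ^ 2 : ℝ) : ℂ) := fun x => by
    rw [mul_left_comm, mul_comm ((starRingEnd ℂ) _), Complex.mul_conj, Complex.normSq_eq_norm_sq,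
      ← Complex.ofReal_mul]
  simp_rw [this]
  rw [integral_complex_ofReal, Complex.ofReal_re]
  exact integral_nonpos fun x => mul_nonpos_of_nonpos_of_nonneg (h x) (by positivity)

end mulOp

/-- Adding a bounded potential `V` to the potential `V₀` is a bounded perturbation of the closed
operator. -/
theorem magneticHamiltonian_isPerturbation {lam : ℝ} {V₀ V V₁ : Plane → ℝ} (hV₀ : Continuous V₀)
    (hV : Continuous V) {C : ℝ} (hC : ∀ x, |V x| ≤ C) (hV₁ : ∀ x, V₁ x = V₀ x + V x) :
    IsPerturbation (magneticHamiltonian lam V₀) (magneticHamiltonian lam V₁) (mulOp V hV hC) := by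
  intro ψ η
  have hcV₁ : Continuous V₁ := by
    rw [show V₁ = fun x => V₀ x + V x from funext hV₁]; exact hV₀.add hV
  rw [magneticHamiltonian_graph hcV₁, magneticHamiltonian_graph hV₀]
  set M := mulOp V hV hC
  let Φ : PlaneL2 × PlaneL2 ≃ₜ PlaneL2 × PlaneL2 :=
    { toFun := fun p => (p.1, p.2 - M p.1)
      invFun := fun p => (p.1, p.2 + M p.1)
      left_inv := fun p => by simp
      right_inv := fun p => by simp
      continuous_toFun := by fun_prop
      continuous_invFun := by fun_prop }
  have hcore : (coreGraph lam V₁ : Set (PlaneL2 × PlaneL2)) = Φ ⁻¹' (coreGraph lam V₀) := by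
    ext p
    have hM := mulOp_coeFn (hV := hV) (hC := hC) p.1
    have key : ∀ f : Plane → ℂ, p.1 =ᵐ[volume] f →
        (p.2 =ᵐ[volume] schrodingerExpr lam V₁ f ↔
          ((p.2 - M p.1 : PlaneL2) : Plane → ℂ) =ᵐ[volume] schrodingerExpr lam V₀ f) := by
      intro f hf
      constructor
      · intro h
        filter_upwards [h, hM, Lp.coeFn_sub p.2 (M p.1), hf] with x h1 h2 h3 h4
        rw [h3, Pi.sub_apply, h1, h2, h4, schrodingerExpr_eq_add V₁, schrodingerExpr_eq_add V₀, hV₁]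
        push_cast; ring
      · intro h
        filter_upwards [h, hM, Lp.coeFn_sub p.2 (M p.1), hf] with x h1 h2 h3 h4
        rw [h3, Pi.sub_apply, h2, h4, sub_eq_iff_eq_add] at h1
        rw [h1, schrodingerExpr_eq_add V₁, schrodingerExpr_eq_add V₀, hV₁]
        push_cast; ring
    constructor
    · rintro ⟨f, hf, hfc, h1, h2⟩
      exact ⟨f, hf, hfc, h1, (key f h1).1 h2⟩
    · rintro ⟨f, hf, hfc, h1, h2⟩
      exact ⟨f, hf, hfc, h1, (key f h1).2 h2⟩
  change (ψ, η) ∈ closure (coreGraph lam V₁ : Set (PlaneL2 × PlaneL2)) ↔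
    Φ (ψ, η) ∈ closure (coreGraph lam V₀ : Set (PlaneL2 × PlaneL2))
  rw [hcore, ← Φ.preimage_closure]
  rfl

/-! ### Cutoffs and weak solutions -/

theorem magMomentum_mul {lam : ℝ} {j : Fin 2} {χ f : Plane → ℂ} (hχ : ContDiff ℝ ∞ χ)
    (hf : ContDiff ℝ ∞ f) :
    magMomentum lam j (fun y => χ y * f y) = fun y => χ y * magMomentum lam j f y -
      Complex.I * (fderiv ℝ χ y (EuclideanSpace.single j 1) * f y) := by
  funext y
  have h1 : DifferentiableAt ℝ χ y := (hχ.differentiable (by simp)).differentiableAt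
  have h2 : DifferentiableAt ℝ f y := (hf.differentiable (by simp)).differentiableAt
  simp only [magMomentum]
  rw [fderiv_fun_mul h1 h2]
  simp only [add_apply, smul_apply, smul_eq_mul]
  ring

theorem contDiff_fderiv_single {χ : Plane → ℂ} (hχ : ContDiff ℝ ∞ χ) (j : Fin 2) :
    ContDiff ℝ ∞ (fun y => fderiv ℝ χ y (EuclideanSpace.single j 1)) :=
  (hχ.fderiv_right (m := ∞) (by simp)).clm_apply contDiff_const

theorem magMomentum_sub {lam : ℝ} {j : Fin 2} {f g : Plane → ℂ}
    (hf : ContDiff ℝ ∞ f) (hg : ContDiff ℝ ∞ g) (y : Plane) :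
    magMomentum lam j (fun y => f y - g y) y = magMomentum lam j f y - magMomentum lam j g y := by
  have h1 : DifferentiableAt ℝ f y := (hf.differentiable (by simp)).differentiableAt
  have h2 : DifferentiableAt ℝ g y := (hg.differentiable (by simp)).differentiableAt
  simp only [magMomentum, fderiv_fun_sub h1 h2, _root_.sub_apply]
  ring

/-- Leibniz rule for the square of the magnetic momentum. -/
theorem magMomentum_magMomentum_mul {lam : ℝ} {j : Fin 2} {χ f : Plane → ℂ} (hχ : ContDiff ℝ ∞ χ)
    (hf : ContDiff ℝ ∞ f) (y : Plane) :
    magMomentum lam j (magMomentum lam j (fun y => χ y * f y)) y =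
      χ y * magMomentum lam j (magMomentum lam j f) y
      - 2 * Complex.I * (fderiv ℝ χ y (EuclideanSpace.single j 1) * magMomentum lam j f y)
      - fderiv ℝ (fun y => fderiv ℝ χ y (EuclideanSpace.single j 1)) y
          (EuclideanSpace.single j 1) * f y := by
  have hd := contDiff_fderiv_single hχ j
  rw [magMomentum_mul hχ hf, magMomentum_sub (hχ.mul (magMomentum_contDiff hf))
    (contDiff_const.mul (hd.mul hf)), magMomentum_mul hχ (magMomentum_contDiff hf)]
  have h1 : magMomentum lam j
      (fun y => Complex.I * (fderiv ℝ χ y (EuclideanSpace.single j 1) * f y)) y =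
      Complex.I *
        magMomentum lam j (fun y => fderiv ℝ χ y (EuclideanSpace.single j 1) * f y) y := by
    have := congrFun (magMomentum_smul (lam := lam) (j := j) Complex.I (hd.mul hf)) y
    exact this
  rw [h1, magMomentum_mul hd hf]
  ring_nf
  rw [Complex.I_sq]
  ring

open ComplexConjugate in
/-- `(P - A)² u + E u = F` in the sense of distributions. -/
def IsWeakSolution (lam E : ℝ) (u F : Plane → ℂ) : Prop :=
  ∀ f : Plane → ℂ, ContDiff ℝ ∞ f → HasCompactSupport f →
    ∫ y, conj (schrodingerExpr lam (fun _ => 0) f y + E * f y) * u y = ∫ y, conj (f y) * F y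

/-- Along a sequence of slowly varying cutoffs, `(P - A)² (χ f)` tends to `(P - A)² f`. The bound by
a multiple of `g` serves as the dominating function. -/
theorem exists_cutoff {lam : ℝ} {f : Plane → ℂ} (hf : ContDiff ℝ ∞ f) {g : Plane → ℝ}
    (h0 : ∀ y, ‖f y‖ ≤ g y) (h1 : ∀ j y, ‖magMomentum lam j f y‖ ≤ g y)
    (h2 : ∀ j y, ‖magMomentum lam j (magMomentum lam j f) y‖ ≤ g y) :
    ∃ (F : ℕ → Plane → ℂ) (C : ℝ), 0 ≤ C ∧ (∀ n, ContDiff ℝ ∞ (F n) ∧ HasCompactSupport (F n)) ∧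
      (∀ n y, ‖F n y‖ ≤ C * g y) ∧
      (∀ n y, ‖schrodingerExpr lam (fun _ => 0) (F n) y‖ ≤ C * g y) ∧
      (∀ y, Filter.Tendsto (fun n => F n y) Filter.atTop (nhds (f y))) ∧
      (∀ y, Filter.Tendsto (fun n => schrodingerExpr lam (fun _ => 0) (F n) y) Filter.atTop
        (nhds (schrodingerExpr lam (fun _ => 0) f y))) := by
  -- the cutoffs are `η (ε n • y)` with `ε n → 0`: each derivative of a cutoff gains a factor `ε n`
  let χ : ContDiffBump (0 : Plane) := ⟨1, 2, one_pos, one_lt_two⟩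
  let η : Plane → ℂ := fun y => ((χ y : ℝ) : ℂ)
  have hη : ContDiff ℝ ∞ η := Complex.ofRealCLM.contDiff.comp χ.contDiff
  have hηc : HasCompactSupport η := χ.hasCompactSupport.comp_left (g := fun r : ℝ => (r : ℂ)) rfl
  have hη0 : η 0 = 1 := by
    have : χ (0 : Plane) = 1 := χ.one_of_mem_closedBall (by simp [χ])
    simp [η, this]
  let d1 : Fin 2 → Plane → ℂ := fun j y => fderiv ℝ η y (EuclideanSpace.single j 1)
  let d2 : Fin 2 → Plane → ℂ := fun j y => fderiv ℝ (d1 j) y (EuclideanSpace.single j 1)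
  have hd1 : ∀ j, ContDiff ℝ ∞ (d1 j) := fun j => contDiff_fderiv_single hη j
  have hd2 : ∀ j, ContDiff ℝ ∞ (d2 j) := fun j => contDiff_fderiv_single (hd1 j) j
  have hd1c : ∀ j, HasCompactSupport (d1 j) := fun j => hηc.fderiv_apply (𝕜 := ℝ) _
  have hd2c : ∀ j, HasCompactSupport (d2 j) := fun j => (hd1c j).fderiv_apply (𝕜 := ℝ) _
  obtain ⟨B0, hB0⟩ := hηc.exists_bound_of_continuous hη.continuous
  have hb1 : ∀ j, ∃ B, ∀ y, ‖d1 j y‖ ≤ B :=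
    fun j => (hd1c j).exists_bound_of_continuous (hd1 j).continuous
  have hb2 : ∀ j, ∃ B, ∀ y, ‖d2 j y‖ ≤ B :=
    fun j => (hd2c j).exists_bound_of_continuous (hd2 j).continuous
  choose B1 hB1 using hb1
  choose B2 hB2 using hb2
  have hg : ∀ y, 0 ≤ g y := fun y => (norm_nonneg _).trans (h0 y)
  have hB0' : 0 ≤ B0 := (norm_nonneg _).trans (hB0 0)
  have hB1' : ∀ j, 0 ≤ B1 j := fun j => (norm_nonneg _).trans (hB1 j 0)
  have hB2' : ∀ j, 0 ≤ B2 j := fun j => (norm_nonneg _).trans (hB2 j 0)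
  let ε : ℕ → ℝ := fun n => 1 / ((n : ℝ) + 1)
  have hε : Filter.Tendsto ε Filter.atTop (nhds 0) := tendsto_one_div_add_atTop_nhds_zero_nat
  have hε0 : ∀ n, 0 < ε n := fun n => by positivity
  have hε1 : ∀ n, ε n ≤ 1 := fun n => by
    rw [div_le_one (by positivity)]; linarith [(Nat.cast_nonneg n : (0 : ℝ) ≤ n)]
  have hχn : ∀ n, ContDiff ℝ ∞ (fun y => η (ε n • y)) := fun n =>
    hη.comp (contDiff_const_smul (ε n))
  have hder : ∀ (ξ : Plane → ℂ) n j y, fderiv ℝ (fun y => ξ (ε n • y)) y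
      (EuclideanSpace.single j 1) = ε n * fderiv ℝ ξ (ε n • y) (EuclideanSpace.single j 1) := by
    intro ξ n j y
    rw [fderiv_comp_smul, smul_apply, Complex.real_smul]
  have hder2 : ∀ n j y, fderiv ℝ (fun y => fderiv ℝ (fun y => η (ε n • y)) y
      (EuclideanSpace.single j 1)) y (EuclideanSpace.single j 1) =
      (ε n : ℂ) ^ 2 * d2 j (ε n • y) := by
    intro n j y
    have e1 : (fun y => fderiv ℝ (fun y => η (ε n • y)) y (EuclideanSpace.single j 1)) =
        fun y => (ε n : ℂ) * (fun y => d1 j (ε n • y)) y := by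
      funext y; exact hder η n j y
    have hdiff : DifferentiableAt ℝ (fun y => d1 j (ε n • y)) y :=
      (((hd1 j).comp (contDiff_const_smul (ε n))).differentiable (by simp)).differentiableAt
    rw [e1, fderiv_const_mul hdiff, smul_apply, hder]
    simp only [smul_eq_mul, d2]
    ring
  have key : ∀ n y, schrodingerExpr lam (fun _ => 0) (fun y => η (ε n • y) * f y) y =
      η (ε n • y) * schrodingerExpr lam (fun _ => 0) f y
      - 2 * Complex.I * (ε n * d1 0 (ε n • y) * magMomentum lam 0 f y)
      - 2 * Complex.I * (ε n * d1 1 (ε n • y) * magMomentum lam 1 f y)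
      - (ε n : ℂ) ^ 2 * d2 0 (ε n • y) * f y - (ε n : ℂ) ^ 2 * d2 1 (ε n • y) * f y := by
    intro n y
    simp only [schrodingerExpr]
    rw [magMomentum_magMomentum_mul (hχn n) hf, magMomentum_magMomentum_mul (hχn n) hf, hder2,
      hder2, hder, hder]
    simp only [d1, Complex.ofReal_zero, zero_mul, add_zero]
    ring
  have hεn : ∀ n, ‖(ε n : ℂ)‖ ≤ 1 := fun n => by
    rw [Complex.norm_real, Real.norm_of_nonneg (hε0 n).le]; exact hε1 n
  have hεc : Filter.Tendsto (fun n => (ε n : ℂ)) Filter.atTop (nhds 0) := by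
    have := (Complex.continuous_ofReal.tendsto 0).comp hε
    rwa [Complex.ofReal_zero] at this
  have hlim : ∀ (ξ : Plane → ℂ), Continuous ξ → ∀ y,
      Filter.Tendsto (fun n => ξ (ε n • y)) Filter.atTop (nhds (ξ 0)) := by
    intro ξ hξ y
    have h3 : Filter.Tendsto (fun n => ε n • y) Filter.atTop (nhds ((0 : ℝ) • y)) :=
      hε.smul_const y
    rw [zero_smul] at h3
    exact (hξ.tendsto 0).comp h3
  refine ⟨fun n y => η (ε n • y) * f y, 2 * B0 + 2 * B1 0 + 2 * B1 1 + B2 0 + B2 1, ?_, ?_, ?_, ?_,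
    ?_, ?_⟩
  · have := hB1' 0; have := hB1' 1; have := hB2' 0; have := hB2' 1
    positivity
  · intro n
    refine ⟨(hχn n).mul hf, ?_⟩
    exact (hηc.comp_homeomorph (Homeomorph.smulOfNeZero (ε n) (hε0 n).ne')).mul_right
  · intro n y
    rw [norm_mul]
    calc _ ≤ B0 * g y := mul_le_mul (hB0 _) (h0 y) (norm_nonneg _) hB0'
      _ ≤ _ := by
        apply mul_le_mul_of_nonneg_right _ (hg y)
        linarith [hB1' 0, hB1' 1, hB2' 0, hB2' 1]
  · intro n y
    rw [key]
    have hH : ‖schrodingerExpr lam (fun _ => 0) f y‖ ≤ 2 * g y := by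
      simp only [schrodingerExpr, Complex.ofReal_zero, zero_mul, add_zero]
      exact (norm_add_le _ _).trans (by linarith [h2 0 y, h2 1 y])
    have n1 : ‖η (ε n • y) * schrodingerExpr lam (fun _ => 0) f y‖ ≤ B0 * (2 * g y) := by
      rw [norm_mul]; exact mul_le_mul (hB0 _) hH (norm_nonneg _) hB0'
    have n2 : ∀ j, ‖2 * Complex.I * (ε n * d1 j (ε n • y) * magMomentum lam j f y)‖ ≤
        2 * (B1 j * g y) := by
      intro j
      rw [norm_mul, norm_mul, norm_mul, norm_mul, Complex.norm_I]
      have a1 := hεn n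
      have a2 := hB1 j (ε n • y)
      have a3 := h1 j y
      have : ‖(ε n : ℂ)‖ * ‖d1 j (ε n • y)‖ * ‖magMomentum lam j f y‖ ≤ 1 * B1 j * g y := by
        gcongr
        simpa using hB1' j
      simp only [Complex.norm_ofNat]
      linarith
    have n3 : ∀ j, ‖(ε n : ℂ) ^ 2 * d2 j (ε n • y) * f y‖ ≤ B2 j * g y := by
      intro j
      rw [norm_mul, norm_mul, norm_pow]
      have a1 : ‖(ε n : ℂ)‖ ^ 2 ≤ 1 := pow_le_one₀ (norm_nonneg _) (hεn n)
      have a2 := hB2 j (ε n • y)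
      have a3 := h0 y
      have : ‖(ε n : ℂ)‖ ^ 2 * ‖d2 j (ε n • y)‖ * ‖f y‖ ≤ 1 * B2 j * g y := by
        gcongr
        simpa using hB2' j
      linarith
    refine (norm_sub_le _ _).trans ?_
    refine (add_le_add_left (norm_sub_le _ _) _).trans ?_
    refine (add_le_add_left (add_le_add_left (norm_sub_le _ _) _) _).trans ?_
    refine (add_le_add_left (add_le_add_left (add_le_add_left (norm_sub_le _ _) _) _) _).trans ?_
    linarith [n2 0, n2 1, n3 0, n3 1]
  · intro y
    have := (hlim η hη.continuous y).mul_const (f y)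
    rwa [hη0, one_mul] at this
  · intro y
    simp_rw [key]
    have t0 := (hlim η hη.continuous y).mul_const (schrodingerExpr lam (fun _ => 0) f y)
    have t1 : ∀ j, Filter.Tendsto (fun n => 2 * Complex.I *
        (ε n * d1 j (ε n • y) * magMomentum lam j f y)) Filter.atTop (nhds 0) := fun j => by
      have := (((hεc.mul (hlim (d1 j) (hd1 j).continuous y)).mul_const
        (magMomentum lam j f y)).const_mul (2 * Complex.I))
      simpa using this
    have t2 : ∀ j, Filter.Tendsto (fun n => (ε n : ℂ) ^ 2 * d2 j (ε n • y) * f y)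
        Filter.atTop (nhds 0) := fun j => by
      have := (((hεc.pow 2).mul (hlim (d2 j) (hd2 j).continuous y)).mul_const (f y))
      simpa using this
    have := (((t0.sub (t1 0)).sub (t1 1)).sub (t2 0)).sub (t2 1)
    simpa [hη0] using this

open ComplexConjugate in
/-- A weak solution may be tested against functions that are not compactly supported, if they
decay. -/
theorem IsWeakSolution.integral_eq {lam E : ℝ} {u F : Plane → ℂ} (h : IsWeakSolution lam E u F)
    (hu : MemLp u 2 (volume : Measure Plane)) (hF : MemLp F 2 (volume : Measure Plane))
    {f : Plane → ℂ} (hf : ContDiff ℝ ∞ f) {g : Plane → ℝ} (hg : MemLp g 2 (volume : Measure Plane))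
    (h0 : ∀ y, ‖f y‖ ≤ g y) (h1 : ∀ j y, ‖magMomentum lam j f y‖ ≤ g y)
    (h2 : ∀ j y, ‖magMomentum lam j (magMomentum lam j f) y‖ ≤ g y) :
    ∫ y, conj (schrodingerExpr lam (fun _ => 0) f y + E * f y) * u y = ∫ y, conj (f y) * F y := by
  obtain ⟨f', C, hC, hf', hb0, hb1, hl0, hl1⟩ := exists_cutoff hf h0 h1 h2
  have hcont : ∀ n, Continuous fun y => conj (f' n y) := fun n =>
    Complex.continuous_conj.comp (hf' n).1.continuous
  have hcont2 : ∀ n, Continuous fun y =>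
      conj (schrodingerExpr lam (fun _ => 0) (f' n) y + E * f' n y) := fun n =>
    Complex.continuous_conj.comp ((schrodingerExpr_zero_contDiff (hf' n).1).continuous.add
      (continuous_const.mul (hf' n).1.continuous))
  have hgu : Integrable (fun y => g y * ‖u y‖) := MemLp.integrable_mul hg hu.norm
  have hgF : Integrable (fun y => g y * ‖F y‖) := MemLp.integrable_mul hg hF.norm
  have T1 : Filter.Tendsto (fun n => ∫ y,
      conj (schrodingerExpr lam (fun _ => 0) (f' n) y + E * f' n y) * u y) Filter.atTop
      (nhds (∫ y, conj (schrodingerExpr lam (fun _ => 0) f y + E * f y) * u y)) := by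
    refine tendsto_integral_of_dominated_convergence (fun y => (C + |E| * C) * (g y * ‖u y‖))
      (fun n => (hcont2 n).aestronglyMeasurable.mul hu.1) (hgu.const_mul _) (fun n => ?_) ?_
    · refine Filter.Eventually.of_forall fun y => ?_
      rw [norm_mul, RCLike.norm_conj, ← mul_assoc]
      refine mul_le_mul_of_nonneg_right ?_ (norm_nonneg _)
      refine (norm_add_le _ _).trans ?_
      rw [norm_mul, Complex.norm_real, Real.norm_eq_abs, add_mul, mul_assoc |E|]
      exact add_le_add (hb1 n y) (mul_le_mul_of_nonneg_left (hb0 n y) (abs_nonneg _))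
    · refine Filter.Eventually.of_forall fun y => ?_
      exact ((Complex.continuous_conj.tendsto _).comp
        ((hl1 y).add ((hl0 y).const_mul (E : ℂ)))).mul_const (u y)
  have T2 : Filter.Tendsto (fun n => ∫ y, conj (f' n y) * F y) Filter.atTop
      (nhds (∫ y, conj (f y) * F y)) := by
    refine tendsto_integral_of_dominated_convergence (fun y => C * (g y * ‖F y‖))
      (fun n => (hcont n).aestronglyMeasurable.mul hF.1) (hgF.const_mul _) (fun n => ?_) ?_
    · refine Filter.Eventually.of_forall fun y => ?_
      rw [norm_mul, RCLike.norm_conj, ← mul_assoc]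
      exact mul_le_mul_of_nonneg_right (hb0 n y) (norm_nonneg _)
    · refine Filter.Eventually.of_forall fun y => ?_
      exact ((Complex.continuous_conj.tendsto _).comp (hl0 y)).mul_const (F y)
  refine tendsto_nhds_unique T1 (T2.congr fun n => ?_)
  exact (h _ (hf' n).1 (hf' n).2).symm

/-! ### The heat kernel of the Landau Hamiltonian -/

/-- Amplitude of the heat kernel of the Landau Hamiltonian. -/
noncomputable def heatAmp (lam t : ℝ) : ℝ := lam / (4 * Real.pi * Real.sinh (lam * t))

/-- Gaussian rate of the heat kernel of the Landau Hamiltonian. -/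
noncomputable def heatRate (lam t : ℝ) : ℝ :=
  lam * Real.cosh (lam * t) / (4 * Real.sinh (lam * t))

/-- The heat kernel `exp(-t (P - A)²)(y, x)` of the Landau Hamiltonian (Mehler's formula), as a
function of `y` with parameter `x`: a Gaussian around `x` times a magnetic phase. -/
noncomputable def heatKernel (lam t : ℝ) (x y : Plane) : ℂ :=
  (heatAmp lam t : ℂ) * Complex.exp (((-(heatRate lam t * ‖y - x‖ ^ 2) : ℝ) : ℂ) +
    ((lam / 2 * (x 0 * y 1 - x 1 * y 0) : ℝ) : ℂ) * Complex.I)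

section params

variable {lam t : ℝ}

theorem sinh_mul_pos (hl : 0 < lam) (ht : 0 < t) : 0 < Real.sinh (lam * t) :=
  Real.sinh_pos_iff.2 (mul_pos hl ht)

theorem heatAmp_pos (hl : 0 < lam) (ht : 0 < t) : 0 < heatAmp lam t := by
  have := sinh_mul_pos hl ht
  unfold heatAmp; positivity

/-- The rate is at least its large time limit `lam / 4`; the difference is explicit. -/
theorem heatRate_eq (hl : 0 < lam) (ht : 0 < t) :
    heatRate lam t = lam / 4 + Real.pi * heatAmp lam t * Real.exp (-(lam * t)) := by
  have := (sinh_mul_pos hl ht).ne'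
  have := Real.pi_ne_zero
  rw [heatRate, heatAmp, ← Real.cosh_sub_sinh]
  field_simp
  ring

theorem heatRate_ge (hl : 0 < lam) (ht : 0 < t) : lam / 4 ≤ heatRate lam t := by
  rw [heatRate_eq hl ht]
  have := heatAmp_pos hl ht
  have := Real.pi_pos
  have : 0 ≤ Real.pi * heatAmp lam t * Real.exp (-(lam * t)) := by positivity
  linarith

theorem heatRate_pos (hl : 0 < lam) (ht : 0 < t) : 0 < heatRate lam t :=
  lt_of_lt_of_le (by linarith) (heatRate_ge hl ht)

/-- One of the two ordinary differential equations to which the heat equation reduces. -/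
theorem hasDerivAt_heatAmp (hl : 0 < lam) (ht : 0 < t) :
    HasDerivAt (heatAmp lam) (-(4 * heatRate lam t) * heatAmp lam t) t := by
  have hs := (sinh_mul_pos hl ht).ne'
  have hp := Real.pi_ne_zero
  have h1 : HasDerivAt (fun t => 4 * Real.pi * Real.sinh (lam * t))
      (4 * Real.pi * (Real.cosh (lam * t) * (lam * 1))) t :=
    (((hasDerivAt_id t).const_mul lam).sinh).const_mul _
  have h2 := (hasDerivAt_const t lam).div h1 (by positivity)
  refine h2.congr_deriv ?_
  rw [heatRate, heatAmp]
  field_simp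
  ring

/-- The other ordinary differential equation, of Riccati type. -/
theorem hasDerivAt_heatRate (hl : 0 < lam) (ht : 0 < t) :
    HasDerivAt (heatRate lam) (lam ^ 2 / 4 - 4 * heatRate lam t ^ 2) t := by
  have hs := (sinh_mul_pos hl ht).ne'
  have h1 : HasDerivAt (fun t => 4 * Real.sinh (lam * t))
      (4 * (Real.cosh (lam * t) * (lam * 1))) t :=
    (((hasDerivAt_id t).const_mul lam).sinh).const_mul _
  have h0 : HasDerivAt (fun t => lam * Real.cosh (lam * t))
      (lam * (Real.sinh (lam * t) * (lam * 1))) t :=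
    (((hasDerivAt_id t).const_mul lam).cosh).const_mul _
  have h2 := h0.div h1 (by positivity)
  refine h2.congr_deriv ?_
  rw [heatRate]
  field_simp

end params

theorem norm_sub_sq_coord (x y : Plane) : ‖y - x‖ ^ 2 = (y 0 - x 0) ^ 2 + (y 1 - x 1) ^ 2 := by
  rw [EuclideanSpace.real_norm_sq_eq, Fin.sum_univ_two]; rfl

theorem abs_coord_sub_le (x y : Plane) (i : Fin 2) : |y i - x i| ≤ ‖y - x‖ := by
  have := PiLp.norm_apply_le (y - x) i
  simpa using this

theorem norm_heatKernel {lam t : ℝ} (hl : 0 < lam) (ht : 0 < t) (x y : Plane) :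
    ‖heatKernel lam t x y‖ = heatAmp lam t * Real.exp (-(heatRate lam t * ‖y - x‖ ^ 2)) := by
  rw [heatKernel, norm_mul, Complex.norm_real, Real.norm_of_nonneg (heatAmp_pos hl ht).le,
    Complex.norm_exp]
  congr 2
  rw [Complex.add_re, Complex.ofReal_re, Complex.re_ofReal_mul, Complex.I_re, mul_zero, add_zero]

open ComplexConjugate in
/-- The heat kernel is Hermitian. -/
theorem conj_heatKernel (lam t : ℝ) (x y : Plane) :
    conj (heatKernel lam t x y) = heatKernel lam t y x := by
  rw [heatKernel, heatKernel, map_mul, Complex.conj_ofReal, ← Complex.exp_conj, map_add, map_mul,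
    Complex.conj_ofReal, Complex.conj_ofReal, Complex.conj_I, norm_sub_rev]
  congr 3
  push_cast; ring

theorem contDiff_heatKernel (lam t : ℝ) (x : Plane) : ContDiff ℝ ∞ (heatKernel lam t x) := by
  have h1 : ContDiff ℝ ∞ (fun y : Plane => (-(heatRate lam t * ‖y - x‖ ^ 2) : ℝ)) := by
    simp_rw [norm_sub_sq_coord]
    fun_prop
  have h2 : ContDiff ℝ ∞ (fun y : Plane => (lam / 2 * (x 0 * y 1 - x 1 * y 0) : ℝ)) := by fun_prop
  exact contDiff_const.mul ((Complex.ofRealCLM.contDiff.comp h1).add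
    ((Complex.ofRealCLM.contDiff.comp h2).mul contDiff_const)).cexp

/-- The factor `q` such that `(P - A)_j K = q K` for the heat kernel `K`. -/
noncomputable def heatFactor (lam t : ℝ) (x : Plane) (j : Fin 2) (y : Plane) : ℂ :=
  ((2 * heatRate lam t * (y j - x j) : ℝ) : ℂ) * Complex.I -
    ((lam / 2 * planePerp (y - x) j : ℝ) : ℂ)

theorem planePerp_contDiff (x : Plane) (j : Fin 2) :
    ContDiff ℝ ∞ (fun y : Plane => (planePerp (y - x) j : ℝ)) := by
  fin_cases j
  · have : ContDiff ℝ ∞ (fun y : Plane => -((y 1 : ℝ) - x 1)) := by fun_prop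
    simpa [planePerp] using this
  · have : ContDiff ℝ ∞ (fun y : Plane => ((y 0 : ℝ) - x 0)) := by fun_prop
    simpa [planePerp] using this

theorem contDiff_heatFactor (lam t : ℝ) (x : Plane) (j : Fin 2) :
    ContDiff ℝ ∞ (heatFactor lam t x j) := by
  have h1 : ContDiff ℝ ∞ (fun y : Plane => (2 * heatRate lam t * (y j - x j) : ℝ)) := by fun_prop
  have h2 := contDiff_const (c := lam / 2).mul (planePerp_contDiff x j)
  exact ((Complex.ofRealCLM.contDiff.comp h1).mul contDiff_const).sub
    (Complex.ofRealCLM.contDiff.comp h2)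

theorem fderiv_eq_of_hasLineDerivAt {f : Plane → ℂ} (hf : ContDiff ℝ ∞ f) {y v : Plane} {f' : ℂ}
    (h : HasLineDerivAt ℝ f f' y v) : fderiv ℝ f y v = f' := by
  have hd : DifferentiableAt ℝ f y := (hf.differentiable (by simp)).differentiableAt
  rw [← hd.lineDeriv_eq_fderiv, h.lineDeriv]

theorem magMomentum_heatKernel (lam t : ℝ) (x : Plane) (j : Fin 2) :
    magMomentum lam j (heatKernel lam t x) =
      fun y => heatFactor lam t x j y * heatKernel lam t x y := by
  funext y
  have hl : fderiv ℝ (heatKernel lam t x) y (EuclideanSpace.single j 1) =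
      (((-(heatRate lam t * (2 * (y j - x j))) : ℝ) : ℂ) +
        ((lam / 2 * planePerp x j : ℝ) : ℂ) * Complex.I) * heatKernel lam t x y := by
    apply fderiv_eq_of_hasLineDerivAt (contDiff_heatKernel lam t x)
    have hexp : HasDerivAt (fun s : ℝ =>
        ((-(heatRate lam t * ‖(y + s • EuclideanSpace.single j (1 : ℝ)) - x‖ ^ 2) : ℝ) : ℂ) +
        ((lam / 2 * (x 0 * (y + s • EuclideanSpace.single j (1 : ℝ) : Plane) 1 -
          x 1 * (y + s • EuclideanSpace.single j (1 : ℝ) : Plane) 0) : ℝ) : ℂ) * Complex.I)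
        (((-(heatRate lam t * (2 * (y j - x j))) : ℝ) : ℂ) +
        ((lam / 2 * planePerp x j : ℝ) : ℂ) * Complex.I) 0 := by
      refine HasDerivAt.add (HasDerivAt.ofReal_comp ?_) ((HasDerivAt.ofReal_comp ?_).mul_const _)
      · simp_rw [norm_sub_sq_coord]
        fin_cases j
        · have : HasDerivAt (fun s : ℝ => -(heatRate lam t * ((y 0 + s - x 0) ^ 2 +
              (y 1 - x 1) ^ 2))) (-(heatRate lam t * (2 * (y 0 + 0 - x 0) ^ 1 * 1))) 0 :=
            (((((hasDerivAt_id (0 : ℝ)).const_add (y 0)).sub_const (x 0)).pow 2).add_const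
              ((y 1 - x 1) ^ 2)).const_mul (heatRate lam t) |>.neg
          simpa using this
        · have : HasDerivAt (fun s : ℝ => -(heatRate lam t * ((y 0 - x 0) ^ 2 +
              (y 1 + s - x 1) ^ 2))) (-(heatRate lam t * (2 * (y 1 + 0 - x 1) ^ 1 * 1))) 0 :=
            (((((hasDerivAt_id (0 : ℝ)).const_add (y 1)).sub_const (x 1)).pow 2).const_add
              ((y 0 - x 0) ^ 2)).const_mul (heatRate lam t) |>.neg
          simpa using this
      · fin_cases j
        · have : HasDerivAt (fun s : ℝ => lam / 2 * (x 0 * y 1 - x 1 * (y 0 + s)))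
              (lam / 2 * (-(x 1 * 1))) 0 :=
            ((((hasDerivAt_id (0 : ℝ)).const_add (y 0)).const_mul (x 1)).const_sub
              (x 0 * y 1)).const_mul _
          simpa [planePerp] using this
        · have : HasDerivAt (fun s : ℝ => lam / 2 * (x 0 * (y 1 + s) - x 1 * y 0))
              (lam / 2 * (x 0 * 1)) 0 :=
            ((((hasDerivAt_id (0 : ℝ)).const_add (y 1)).const_mul (x 0)).sub_const
              (x 1 * y 0)).const_mul _
          simpa [planePerp] using this
    have := hexp.cexp.const_mul (heatAmp lam t : ℂ)
    refine this.congr_deriv ?_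
    simp only [heatKernel, zero_smul, add_zero]
    ring
  rw [magMomentum, hl, heatFactor]
  have hperp : planePerp (y - x) j = planePerp y j - planePerp x j := by
    fin_cases j <;> simp [planePerp]; ring
  rw [hperp]
  push_cast
  linear_combination (-(lam / 2 * planePerp x j : ℂ)) * heatKernel lam t x y * Complex.I_sq

theorem magMomentum_magMomentum_heatKernel (lam t : ℝ) (x y : Plane) (j : Fin 2) :
    magMomentum lam j (magMomentum lam j (heatKernel lam t x)) y =
      (heatFactor lam t x j y ^ 2 + 2 * heatRate lam t) * heatKernel lam t x y := by
  have hq : fderiv ℝ (heatFactor lam t x j) y (EuclideanSpace.single j 1) =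
      2 * heatRate lam t * Complex.I := by
    apply fderiv_eq_of_hasLineDerivAt (contDiff_heatFactor lam t x j)
    have h1 : HasDerivAt (fun s : ℝ => 2 * heatRate lam t * (y j + s - x j))
        (2 * heatRate lam t * 1) 0 :=
      (((hasDerivAt_id (0 : ℝ)).const_add (y j)).sub_const (x j)).const_mul _
    have h2 := (h1.ofReal_comp.mul_const Complex.I).sub_const
      (((lam / 2 * planePerp (y - x) j : ℝ) : ℂ))
    have e1 : (fun s : ℝ => heatFactor lam t x j (y + s • EuclideanSpace.single j 1)) =
        fun s : ℝ => ((2 * heatRate lam t * (y j + s - x j) : ℝ) : ℂ) * Complex.I -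
          ((lam / 2 * planePerp (y - x) j : ℝ) : ℂ) := by
      funext s
      fin_cases j <;> simp [heatFactor, planePerp]
    rw [HasLineDerivAt, e1]
    refine h2.congr_deriv ?_
    push_cast; ring
  rw [magMomentum_heatKernel, magMomentum_mul (contDiff_heatFactor lam t x j)
    (contDiff_heatKernel lam t x), magMomentum_heatKernel]
  simp only [hq]
  linear_combination (-2 * heatRate lam t * heatKernel lam t x y) * Complex.I_sq

/-- The factor `p` such that `(P - A)² K = p K` for the heat kernel `K`. -/
noncomputable def heatSymbol (lam t : ℝ) (x y : Plane) : ℝ :=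
  4 * heatRate lam t + (lam ^ 2 / 4 - 4 * heatRate lam t ^ 2) * ‖y - x‖ ^ 2

theorem schrodingerExpr_heatKernel (lam t : ℝ) (x y : Plane) :
    schrodingerExpr lam (fun _ => 0) (heatKernel lam t x) y =
      heatSymbol lam t x y * heatKernel lam t x y := by
  simp only [schrodingerExpr, magMomentum_magMomentum_heatKernel, Complex.ofReal_zero, zero_mul,
    add_zero]
  rw [heatSymbol, norm_sub_sq_coord]
  simp only [heatFactor, planePerp]
  simp
  ring_nf
  rw [Complex.I_sq]
  ring

/-- The heat equation. -/
theorem hasDerivAt_heatKernel {lam t : ℝ} (hl : 0 < lam) (ht : 0 < t) (x y : Plane) :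
    HasDerivAt (fun t => heatKernel lam t x y)
      (-(heatSymbol lam t x y * heatKernel lam t x y)) t := by
  have h1 := (((hasDerivAt_heatRate hl ht).mul_const (‖y - x‖ ^ 2)).neg).ofReal_comp.add_const
    (((lam / 2 * (x 0 * y 1 - x 1 * y 0) : ℝ) : ℂ) * Complex.I)
  have h2 := (hasDerivAt_heatAmp hl ht).ofReal_comp.mul h1.cexp
  refine h2.congr_deriv ?_
  simp only [heatKernel, heatSymbol, Pi.neg_apply]
  push_cast
  ring

/-! ### Gaussian integrals -/

theorem integral_gaussian_plane {b : ℝ} (hb : 0 < b) :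
    ∫ v : Plane, Real.exp (-b * ‖v‖ ^ 2) = Real.pi / b := by
  rw [GaussianFourier.integral_rexp_neg_mul_sq_norm hb]
  simp

theorem integrable_gaussian_plane {b : ℝ} (hb : 0 < b) :
    Integrable (fun v : Plane => Real.exp (-b * ‖v‖ ^ 2)) := by
  apply Integrable.of_integral_ne_zero
  rw [integral_gaussian_plane hb]
  have := Real.pi_pos
  positivity

theorem memLp_gaussian {b : ℝ} (hb : 0 < b) (x : Plane) :
    MemLp (fun y : Plane => Real.exp (-(b * ‖y - x‖ ^ 2))) 2 volume := by
  rw [memLp_two_iff_integrable_sq_norm (by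
    exact (by fun_prop : Continuous fun y : Plane =>
      Real.exp (-(b * ‖y - x‖ ^ 2))).aestronglyMeasurable)]
  have h := (integrable_gaussian_plane (b := 2 * b) (by linarith)).comp_sub_right x
  refine h.congr (Filter.Eventually.of_forall fun y => ?_)
  simp only
  rw [Real.norm_of_nonneg (Real.exp_pos _).le, ← Real.exp_nat_mul]
  congr 1; push_cast; ring

theorem memLp_poly_gaussian {b : ℝ} (hb : 0 < b) (C : ℝ) (x : Plane) :
    MemLp (fun y : Plane => C * (1 + ‖y - x‖ ^ 2) * Real.exp (-(b * ‖y - x‖ ^ 2))) 2 volume := by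
  refine (memLp_gaussian (half_pos hb) x).of_le_mul (c := |C| * (1 + 2 / b))
    (by exact (by fun_prop : Continuous fun y : Plane => C * (1 + ‖y - x‖ ^ 2) *
      Real.exp (-(b * ‖y - x‖ ^ 2))).aestronglyMeasurable)
    (Filter.Eventually.of_forall fun y => ?_)
  set s := ‖y - x‖ ^ 2 with hs
  have hs0 : 0 ≤ s := by positivity
  rw [norm_mul, norm_mul, Real.norm_of_nonneg (Real.exp_pos _).le,
    Real.norm_of_nonneg (Real.exp_pos _).le, Real.norm_eq_abs, Real.norm_of_nonneg (by positivity)]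
  have h1 : 1 + s ≤ (1 + 2 / b) * Real.exp (b / 2 * s) := by
    have h2 : b / 2 * s + 1 ≤ Real.exp (b / 2 * s) := Real.add_one_le_exp _
    have h3 : s = 2 / b * (b / 2 * s) := by field_simp
    have h4 : 2 / b * (b / 2 * s) ≤ 2 / b * Real.exp (b / 2 * s) :=
      mul_le_mul_of_nonneg_left (by linarith) (by positivity)
    have h5 : 0 ≤ b / 2 * s := by positivity
    linarith
  have h6 : Real.exp (-(b * s)) = Real.exp (-(b / 2 * s)) * Real.exp (-(b / 2 * s)) := by
    rw [← Real.exp_add]; congr 1; ring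
  have h7 : Real.exp (b / 2 * s) * Real.exp (-(b / 2 * s)) = 1 := by
    rw [← Real.exp_add]; simp
  calc |C| * (1 + s) * Real.exp (-(b * s))
      ≤ |C| * ((1 + 2 / b) * Real.exp (b / 2 * s)) * Real.exp (-(b * s)) := by gcongr
    _ = |C| * (1 + 2 / b) * Real.exp (-(b / 2 * s)) *
        (Real.exp (b / 2 * s) * Real.exp (-(b / 2 * s))) := by rw [h6]; ring
    _ = _ := by rw [h7, mul_one]

/-- Cauchy–Schwarz for lower integrals. -/
theorem lintegral_mul_sq_le {α : Type*} [MeasurableSpace α] {μ : Measure α} {f g : α → ENNReal}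
    (hf : AEMeasurable f μ) (hg : AEMeasurable g μ) :
    (∫⁻ a, f a * g a ∂μ) ^ 2 ≤ (∫⁻ a, f a ^ 2 ∂μ) * ∫⁻ a, g a ^ 2 ∂μ := by
  have h := ENNReal.lintegral_mul_le_Lp_mul_Lq μ Real.HolderConjugate.two_two hf hg
  have h2 := pow_le_pow_left' h 2
  refine h2.trans_eq ?_
  rw [mul_pow, ← ENNReal.rpow_natCast, ← ENNReal.rpow_natCast, ← ENNReal.rpow_mul,
    ← ENNReal.rpow_mul]
  norm_num

/-! ### The heat semigroup applied to a function -/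

open ComplexConjugate in
/-- The heat semigroup of the Landau Hamiltonian: `(exp(-t (P - A)²) u)(x)`. -/
noncomputable def heatInt (lam t : ℝ) (u : Plane → ℂ) (x : Plane) : ℂ :=
  ∫ y, conj (heatKernel lam t x y) * u y

theorem memLp_heatKernel {lam t : ℝ} (hl : 0 < lam) (ht : 0 < t) (x : Plane) :
    MemLp (heatKernel lam t x) 2 volume := by
  refine (memLp_gaussian (heatRate_pos hl ht) x).of_le_mul (c := heatAmp lam t)
    (contDiff_heatKernel lam t x).continuous.aestronglyMeasurable
    (Filter.Eventually.of_forall fun y => ?_)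
  rw [norm_heatKernel hl ht, Real.norm_of_nonneg (Real.exp_pos _).le]

open ComplexConjugate in
/-- A weak solution can be tested against the heat kernel. -/
theorem IsWeakSolution.integral_heatKernel {lam E : ℝ} {u F : Plane → ℂ}
    (h : IsWeakSolution lam E u F) (hu : MemLp u 2 (volume : Measure Plane))
    (hF : MemLp F 2 (volume : Measure Plane)) (hl : 0 < lam) {t : ℝ} (ht : 0 < t) (x : Plane) :
    ∫ y, conj (schrodingerExpr lam (fun _ => 0) (heatKernel lam t x) y +
      E * heatKernel lam t x y) * u y = heatInt lam t F x := by
  set b := heatRate lam t with hb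
  have hb0 : 0 < b := heatRate_pos hl ht
  set a := heatAmp lam t with ha
  have ha0 : 0 < a := heatAmp_pos hl ht
  set m := 2 * b + lam / 2 with hm
  have hm0 : 0 < m := by positivity
  have hfac : ∀ j y, ‖heatFactor lam t x j y‖ ≤ m * ‖y - x‖ := by
    intro j y
    unfold heatFactor
    refine (norm_sub_le _ _).trans ?_
    rw [norm_mul, Complex.norm_I, Complex.norm_real, Complex.norm_real, mul_one, Real.norm_eq_abs,
      Real.norm_eq_abs, abs_mul (2 * _), abs_mul (lam / 2),
      abs_of_pos (by positivity : 0 < 2 * heatRate lam t),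
      abs_of_pos (by positivity : 0 < lam / 2), hm, add_mul]
    have h1 : |planePerp (y - x) j| ≤ ‖y - x‖ := by
      fin_cases j
      · simpa [planePerp, abs_sub_comm] using abs_coord_sub_le x y 1
      · simpa [planePerp] using abs_coord_sub_le x y 0
    exact add_le_add (mul_le_mul_of_nonneg_left (abs_coord_sub_le x y j) (by positivity))
      (mul_le_mul_of_nonneg_left h1 (by positivity))
  refine h.integral_eq hu hF (contDiff_heatKernel lam t x)
    (memLp_poly_gaussian hb0 (a * (1 + m + m ^ 2 + 2 * b)) x) ?_ ?_ ?_
  all_goals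
    intros
  · rename_i y
    rw [norm_heatKernel hl ht]
    refine mul_le_mul_of_nonneg_right ?_ (Real.exp_pos _).le
    have : 1 ≤ (1 + m + m ^ 2 + 2 * b) * (1 + ‖y - x‖ ^ 2) := by
      nlinarith [sq_nonneg ‖y - x‖, mul_pos hm0 hm0]
    calc a = a * 1 := (mul_one a).symm
      _ ≤ a * ((1 + m + m ^ 2 + 2 * b) * (1 + ‖y - x‖ ^ 2)) := by gcongr
      _ = _ := by ring
  · rename_i j y
    rw [magMomentum_heatKernel, norm_mul, norm_heatKernel hl ht]
    have : m * ‖y - x‖ ≤ (1 + m + m ^ 2 + 2 * b) * (1 + ‖y - x‖ ^ 2) := by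
      have h1 : ‖y - x‖ ≤ 1 + ‖y - x‖ ^ 2 := by nlinarith [sq_nonneg (‖y - x‖ - 1)]
      calc m * ‖y - x‖ ≤ m * (1 + ‖y - x‖ ^ 2) := by gcongr
        _ ≤ _ := by
          apply mul_le_mul_of_nonneg_right _ (by positivity)
          nlinarith [mul_pos hm0 hm0]
    calc _ ≤ (m * ‖y - x‖) * (a * Real.exp (-(b * ‖y - x‖ ^ 2))) := by
          gcongr; exact hfac j y
      _ ≤ ((1 + m + m ^ 2 + 2 * b) * (1 + ‖y - x‖ ^ 2)) *
          (a * Real.exp (-(b * ‖y - x‖ ^ 2))) := by gcongr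
      _ = _ := by ring
  · rename_i j y
    rw [magMomentum_magMomentum_heatKernel, norm_mul, norm_heatKernel hl ht]
    have h1 : ‖heatFactor lam t x j y ^ 2 + 2 * (heatRate lam t : ℂ)‖ ≤
        m ^ 2 * ‖y - x‖ ^ 2 + 2 * b := by
      refine (norm_add_le _ _).trans (add_le_add ?_ ?_)
      · rw [norm_pow, ← mul_pow]
        exact pow_le_pow_left₀ (norm_nonneg _) (hfac j y) 2
      · rw [norm_mul, Complex.norm_real, Real.norm_of_nonneg hb0.le]; simp
    have h2 : m ^ 2 * ‖y - x‖ ^ 2 + 2 * b ≤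
        (1 + m + m ^ 2 + 2 * b) * (1 + ‖y - x‖ ^ 2) := by
      have : 0 ≤ ‖y - x‖ ^ 2 := by positivity
      nlinarith [mul_nonneg hm0.le this, mul_nonneg hb0.le this, mul_pos hm0 hm0]
    calc _ ≤ ((1 + m + m ^ 2 + 2 * b) * (1 + ‖y - x‖ ^ 2)) *
          (a * Real.exp (-(b * ‖y - x‖ ^ 2))) := by
          gcongr; exact h1.trans h2
      _ = _ := by ring

open ComplexConjugate in
/-- A weak solution of `((P - A)² + E) u = F` solves `-∂ₜ (exp(-tE) Sₜ u) = exp(-tE) Sₜ F`, where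
`Sₜ` is the heat semigroup: the heat kernel is used as a test function. -/
theorem IsWeakSolution.hasDerivAt_heatInt {lam E : ℝ} {u F : Plane → ℂ}
    (h : IsWeakSolution lam E u F) (hu : MemLp u 2 (volume : Measure Plane))
    (hF : MemLp F 2 (volume : Measure Plane)) (hl : 0 < lam) {t : ℝ} (ht : 0 < t) (x : Plane) :
    HasDerivAt (fun t => (Real.exp (-(t * E)) : ℂ) * heatInt lam t u x)
      (-((Real.exp (-(t * E)) : ℂ) * heatInt lam t F x)) t := by
  have hcK : ∀ s, Continuous fun y => conj (heatKernel lam s x y) := fun s =>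
    Complex.continuous_conj.comp (contDiff_heatKernel lam s x).continuous
  have hcS : ∀ s, Continuous fun y => (heatSymbol lam s x y : ℂ) := fun s => by
    apply Complex.continuous_ofReal.comp
    unfold heatSymbol
    fun_prop
  have hpos : ∀ s ∈ Set.Icc (t / 2) (3 * t / 2), 0 < s := fun s hs => by
    have := hs.1; linarith
  -- uniform bounds of the coefficients near `t`
  obtain ⟨A, hA⟩ := (isCompact_Icc (a := t / 2) (b := 3 * t / 2)).exists_bound_of_continuousOn
    (f := heatAmp lam)
    fun s hs => (hasDerivAt_heatAmp hl (hpos s hs)).continuousAt.continuousWithinAt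
  obtain ⟨B, hB⟩ := (isCompact_Icc (a := t / 2) (b := 3 * t / 2)).exists_bound_of_continuousOn
    (f := heatRate lam)
    fun s hs => (hasDerivAt_heatRate hl (hpos s hs)).continuousAt.continuousWithinAt
  have ht' : t ∈ Set.Icc (t / 2) (3 * t / 2) := ⟨by linarith, by linarith⟩
  have hA0 : 0 ≤ A := (norm_nonneg _).trans (hA t ht')
  have hB0 : 0 ≤ B := (norm_nonneg _).trans (hB t ht')
  have hsym : ∀ s ∈ Set.Icc (t / 2) (3 * t / 2), ∀ y,
      |heatSymbol lam s x y| ≤ (4 * B + (lam ^ 2 / 4 + 4 * B ^ 2)) * (1 + ‖y - x‖ ^ 2) := by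
    intro s hs y
    have h1 : |heatRate lam s| ≤ B := hB s hs
    have h2 : heatRate lam s ^ 2 ≤ B ^ 2 := sq_le_sq' (abs_le.1 h1).1 (abs_le.1 h1).2
    have h3 : |lam ^ 2 / 4 - 4 * heatRate lam s ^ 2| ≤ lam ^ 2 / 4 + 4 * B ^ 2 := by
      rw [abs_le]; constructor <;> nlinarith [sq_nonneg lam, sq_nonneg (heatRate lam s)]
    have h4 : 0 ≤ ‖y - x‖ ^ 2 := by positivity
    unfold heatSymbol
    refine (abs_add_le _ _).trans ?_
    rw [abs_mul, abs_mul, abs_of_nonneg h4, abs_of_nonneg (by norm_num : (0 : ℝ) ≤ 4)]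
    have h5 := mul_le_mul_of_nonneg_right h3 h4
    nlinarith [sq_nonneg lam, sq_nonneg B]
  set C := A * (4 * B + (lam ^ 2 / 4 + 4 * B ^ 2)) with hC
  have hnK : ∀ s ∈ Set.Icc (t / 2) (3 * t / 2), ∀ y,
      ‖heatKernel lam s x y‖ ≤ A * Real.exp (-(lam / 4 * ‖y - x‖ ^ 2)) := by
    intro s hs y
    rw [norm_heatKernel hl (hpos s hs)]
    have h1 : heatAmp lam s ≤ A := (le_abs_self _).trans (hA s hs)
    have h2 := heatRate_ge hl (hpos s hs)
    gcongr
  have hd : HasDerivAt (fun s => heatInt lam s u x)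
      (∫ y, -((heatSymbol lam t x y : ℂ) * conj (heatKernel lam t x y)) * u y) t := by
    refine (hasDerivAt_integral_of_dominated_loc_of_deriv_le
      (F := fun s y => conj (heatKernel lam s x y) * u y)
      (F' := fun s y => -((heatSymbol lam s x y : ℂ) * conj (heatKernel lam s x y)) * u y)
      (s := Set.Icc (t / 2) (3 * t / 2))
      (bound := fun y => (C * (1 + ‖y - x‖ ^ 2) * Real.exp (-(lam / 4 * ‖y - x‖ ^ 2))) * ‖u y‖)
      (Icc_mem_nhds (by linarith) (by linarith)) ?_ ?_ ?_ ?_ ?_ ?_).2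
    · exact Filter.Eventually.of_forall fun s => (hcK s).aestronglyMeasurable.mul hu.1
    · exact MemLp.integrable_mul (memLp_heatKernel hl ht x).star hu
    · exact ((hcS t).mul (hcK t)).neg.aestronglyMeasurable.mul hu.1
    · refine Filter.Eventually.of_forall fun y s hs => ?_
      rw [norm_mul, norm_neg, norm_mul, RCLike.norm_conj, Complex.norm_real, Real.norm_eq_abs]
      refine mul_le_mul_of_nonneg_right ?_ (norm_nonneg _)
      calc _ ≤ ((4 * B + (lam ^ 2 / 4 + 4 * B ^ 2)) * (1 + ‖y - x‖ ^ 2)) *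
            (A * Real.exp (-(lam / 4 * ‖y - x‖ ^ 2))) :=
            mul_le_mul (hsym s hs y) (hnK s hs y) (norm_nonneg _) (by positivity)
        _ = _ := by rw [hC]; ring
    · exact MemLp.integrable_mul (memLp_poly_gaussian (by linarith) C x) hu.norm
    · refine Filter.Eventually.of_forall fun y s hs => ?_
      have h1 := (hasDerivAt_heatKernel hl (hpos s hs) x y)
      have h2 := (Complex.conjCLE.toContinuousLinearMap.hasFDerivAt
        (x := heatKernel lam s x y)).comp_hasDerivAt s h1
      have h3 := h2.mul_const (u y)
      refine h3.congr_deriv ?_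
      simp
  have hweak := h.integral_heatKernel hu hF hl ht x
  have hsplit : ∫ y, conj (schrodingerExpr lam (fun _ => 0) (heatKernel lam t x) y +
      E * heatKernel lam t x y) * u y =
      (∫ y, (heatSymbol lam t x y : ℂ) * conj (heatKernel lam t x y) * u y) +
        E * heatInt lam t u x := by
    rw [heatInt, ← integral_const_mul, ← integral_add]
    · refine integral_congr_ae (Filter.Eventually.of_forall fun y => ?_)
      simp only [schrodingerExpr_heatKernel, map_add, map_mul, Complex.conj_ofReal]
      ring
    · have hg : MemLp (fun y => (heatSymbol lam t x y : ℂ) * conj (heatKernel lam t x y)) 2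
          volume := by
        refine (memLp_poly_gaussian (by linarith : 0 < lam / 4) C x).of_le
          ((hcS t).mul (hcK t)).aestronglyMeasurable (Filter.Eventually.of_forall fun y => ?_)
        rw [norm_mul, RCLike.norm_conj, Complex.norm_real, Real.norm_eq_abs]
        refine le_trans ?_ (Real.le_norm_self _)
        calc _ ≤ ((4 * B + (lam ^ 2 / 4 + 4 * B ^ 2)) * (1 + ‖y - x‖ ^ 2)) *
            (A * Real.exp (-(lam / 4 * ‖y - x‖ ^ 2))) :=
            mul_le_mul (hsym t ht' y) (hnK t ht' y) (norm_nonneg _) (by positivity)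
          _ = _ := by rw [hC]; ring
      exact MemLp.integrable_mul hg hu
    · exact (MemLp.integrable_mul (memLp_heatKernel hl ht x).star hu).const_mul _
  have he : HasDerivAt (fun t : ℝ => (Real.exp (-(t * E)) : ℂ))
      ((Real.exp (-(t * E)) * -(1 * E) : ℝ) : ℂ) t :=
    (((hasDerivAt_id t).mul_const E).neg.exp).ofReal_comp
  have hfin := he.mul hd
  refine hfin.congr_deriv ?_
  rw [← hweak, hsplit]
  simp_rw [neg_mul]
  rw [integral_neg]
  push_cast
  ring

/-! ### Bounds for the resolvent kernel -/

/-- The heat kernel bound that remains after the Gaussian `exp(-lam/4 |y - x|²)` has been split off: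
`|K(x, y)| = heatMajorant (y - x) * exp(-lam/4 |y - x|²)`. -/
noncomputable def heatMajorant (lam t : ℝ) (z : Plane) : ℝ :=
  heatAmp lam t * Real.exp (-(Real.pi * heatAmp lam t * Real.exp (-(lam * t))) * ‖z‖ ^ 2)

theorem norm_heatKernel_eq {lam t : ℝ} (hl : 0 < lam) (ht : 0 < t) (x y : Plane) :
    ‖heatKernel lam t x y‖ =
      heatMajorant lam t (y - x) * Real.exp (-(lam / 4 * ‖y - x‖ ^ 2)) := by
  rw [norm_heatKernel hl ht, heatMajorant, mul_assoc, ← Real.exp_add, heatRate_eq hl ht]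
  congr 2; ring

theorem heatMajorant_nonneg {lam t : ℝ} (hl : 0 < lam) (ht : 0 < t) (z : Plane) :
    0 ≤ heatMajorant lam t z :=
  mul_nonneg (heatAmp_pos hl ht).le (Real.exp_pos _).le

theorem lintegral_gaussian_plane {b : ℝ} (hb : 0 < b) :
    ∫⁻ v : Plane, ENNReal.ofReal (Real.exp (-b * ‖v‖ ^ 2)) = ENNReal.ofReal (Real.pi / b) := by
  rw [← integral_gaussian_plane hb, ofReal_integral_eq_lintegral_ofReal
    (integrable_gaussian_plane hb) (Filter.Eventually.of_forall fun _ => (Real.exp_pos _).le)]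

/-- The `L¹` norm of the majorant. Its growth `exp(lam t)`, the price for splitting off the full
Gaussian, is beaten by the factor `exp(-tE)` of the Laplace transform exactly when `lam < E`. -/
theorem lintegral_heatMajorant {lam t : ℝ} (hl : 0 < lam) (ht : 0 < t) :
    ∫⁻ z, ENNReal.ofReal (heatMajorant lam t z) = ENNReal.ofReal (Real.exp (lam * t)) := by
  have ha := heatAmp_pos hl ht
  have hp := Real.pi_pos
  simp_rw [heatMajorant, ENNReal.ofReal_mul ha.le]
  rw [lintegral_const_mul _ (by fun_prop), lintegral_gaussian_plane (by positivity),
    ← ENNReal.ofReal_mul ha.le]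
  congr 1
  rw [Real.exp_neg]
  field_simp

/-- The square of the `L²` norm of the majorant. -/
theorem lintegral_heatMajorant_sq {lam t : ℝ} (hl : 0 < lam) (ht : 0 < t) :
    ∫⁻ z, ENNReal.ofReal (heatMajorant lam t z) ^ 2 =
      ENNReal.ofReal (heatAmp lam t * Real.exp (lam * t) / 2) := by
  have ha := heatAmp_pos hl ht
  have hp := Real.pi_pos
  have h1 : ∀ z : Plane, ENNReal.ofReal (heatMajorant lam t z) ^ 2 =
      ENNReal.ofReal (heatAmp lam t ^ 2) * ENNReal.ofReal (Real.exp
        (-(2 * (Real.pi * heatAmp lam t * Real.exp (-(lam * t)))) * ‖z‖ ^ 2)) := fun z => by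
    rw [← ENNReal.ofReal_pow (heatMajorant_nonneg hl ht z), ← ENNReal.ofReal_mul (by positivity),
      heatMajorant, mul_pow, ← Real.exp_nat_mul]
    congr 3; push_cast; ring
  simp_rw [h1]
  rw [lintegral_const_mul _ (by fun_prop), lintegral_gaussian_plane (by positivity),
    ← ENNReal.ofReal_mul (by positivity)]
  congr 1
  rw [Real.exp_neg]
  field_simp

/-- The `L²` norm of the majorant is bounded by `√lam + 1/√t`: the singularity at `t = 0` is
integrable, and there is no growth for large `t`. -/
theorem heatAmp_mul_exp_le {lam t : ℝ} (hl : 0 < lam) (ht : 0 < t) :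
    heatAmp lam t * Real.exp (lam * t) / 2 ≤ (√lam + t ^ (-(1 / 2) : ℝ)) ^ 2 := by
  have hs := sinh_mul_pos hl ht
  have h1 : (t ^ (-(1 / 2) : ℝ)) ^ 2 = 1 / t := by
    rw [← Real.rpow_natCast, ← Real.rpow_mul ht.le]
    norm_num
    exact Real.rpow_neg_one t
  have h2 : 0 ≤ t ^ (-(1 / 2) : ℝ) := Real.rpow_nonneg ht.le _
  have h3 : lam + 1 / t ≤ (√lam + t ^ (-(1 / 2) : ℝ)) ^ 2 := by
    rw [add_sq, Real.sq_sqrt hl.le, h1]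
    have := mul_nonneg (Real.sqrt_nonneg lam) h2
    linarith
  refine le_trans ?_ h3
  set s := lam * t with hsdef
  have hs0 : 0 < s := mul_pos hl ht
  have h4 : s * Real.exp s ≤ 2 * (s + 1) * Real.sinh s := by
    have h5 : s + 1 ≤ Real.exp s := Real.add_one_le_exp s
    have h6 : (s + 1) * Real.exp (-s) ≤ Real.exp s := by
      calc (s + 1) * Real.exp (-s) ≤ Real.exp s * 1 := by
            gcongr
            exact Real.exp_le_one_iff.2 (by linarith)
        _ = _ := mul_one _
    rw [Real.sinh_eq]
    nlinarith
  have h7 : 2 * (s + 1) * Real.sinh s ≤ 8 * Real.pi * (s + 1) * Real.sinh s := by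
    have : 3 < Real.pi := Real.pi_gt_three
    gcongr
    linarith
  have h8 : heatAmp lam t * Real.exp s / 2 = s * Real.exp s / (8 * Real.pi * t * Real.sinh s) := by
    rw [heatAmp, ← hsdef, hsdef]
    have := Real.pi_pos
    field_simp
    norm_num
  have hp := Real.pi_pos
  rw [h8, div_le_iff₀ (by positivity)]
  have h9 : (lam + 1 / t) * (8 * Real.pi * t * Real.sinh s) =
      8 * Real.pi * (s + 1) * Real.sinh s := by
    rw [hsdef]; field_simp
  rw [h9]
  exact h4.trans h7

theorem eLpNorm_two_sq {F : Plane → ℂ} : eLpNorm F 2 volume ^ 2 = ∫⁻ y, ‖F y‖ₑ ^ 2 := by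
  rw [eLpNorm_eq_lintegral_rpow_enorm_toReal (by norm_num) (by norm_num), ← ENNReal.rpow_natCast,
    ← ENNReal.rpow_mul]
  norm_num

theorem measurable_heatAmp (lam : ℝ) : Measurable (heatAmp lam) := by
  unfold heatAmp; fun_prop

theorem measurable_heatRate (lam : ℝ) : Measurable (heatRate lam) := by
  unfold heatRate; fun_prop

theorem measurable_heatMajorant (lam : ℝ) :
    Measurable fun p : ℝ × Plane => heatMajorant lam p.1 p.2 := by
  have := measurable_heatAmp lam
  unfold heatMajorant; fun_prop

theorem measurable_heatKernel (lam : ℝ) :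
    Measurable fun p : Plane × ℝ × Plane => heatKernel lam p.2.1 p.1 p.2.2 := by
  have := measurable_heatAmp lam
  have := measurable_heatRate lam
  unfold heatKernel; fun_prop

/-- Integral over time of the heat majorants; together with the Gaussian factor this dominates the
kernel of the resolvent `((P - A)² + E)⁻¹`. -/
noncomputable def resMajorant (lam E : ℝ) (z : Plane) : ENNReal :=
  ∫⁻ t in Set.Ioi (0 : ℝ), ENNReal.ofReal (Real.exp (-(t * E)) * heatMajorant lam t z)

theorem measurable_resMajorant_integrand (lam E : ℝ) : Measurable fun p : ℝ × Plane =>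
    ENNReal.ofReal (Real.exp (-(p.1 * E)) * heatMajorant lam p.1 p.2) := by
  have := measurable_heatMajorant lam
  fun_prop

theorem measurable_resMajorant (lam E : ℝ) : Measurable (resMajorant lam E) :=
  ((measurable_resMajorant_integrand lam E).comp measurable_swap).lintegral_prod_right'

theorem lintegral_rpow_mul_exp {a r : ℝ} (ha : 0 < a) (hr : 0 < r) :
    ∫⁻ t in Set.Ioi (0 : ℝ), ENNReal.ofReal (t ^ (a - 1) * Real.exp (-(r * t))) =
      ENNReal.ofReal ((1 / r) ^ a * Real.Gamma a) := by
  have h := Real.integral_rpow_mul_exp_neg_mul_Ioi ha hr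
  have hG := Real.Gamma_pos_of_pos ha
  rw [← h, ofReal_integral_eq_lintegral_ofReal]
  · apply Integrable.of_integral_ne_zero
    rw [h]; positivity
  · filter_upwards [ae_restrict_mem measurableSet_Ioi] with t ht
    have : 0 < t := ht
    positivity

theorem lintegral_resMajorant {lam E : ℝ} (hl : 0 < lam) (hE : lam < E) :
    ∫⁻ z, resMajorant lam E z = ENNReal.ofReal (1 / (E - lam)) := by
  unfold resMajorant
  rw [lintegral_lintegral_swap (by
    exact ((measurable_resMajorant_integrand lam E).comp measurable_swap).aemeasurable)]
  have h1 := lintegral_rpow_mul_exp one_pos (sub_pos.2 hE)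
  rw [Real.rpow_one, Real.Gamma_one, mul_one] at h1
  rw [← h1]
  refine setLIntegral_congr_fun measurableSet_Ioi fun t ht => ?_
  simp_rw [ENNReal.ofReal_mul (Real.exp_pos (-(t * E))).le]
  rw [lintegral_const_mul _ (by
    exact ((measurable_heatMajorant lam).comp measurable_prodMk_left).ennreal_ofReal),
    lintegral_heatMajorant hl ht, ← ENNReal.ofReal_mul (Real.exp_pos _).le, ← Real.exp_add]
  congr 1
  simp only [sub_self, Real.rpow_zero, one_mul]
  congr 1; ring

/-- An upper bound for the `L²` norm of the majorant of the resolvent kernel. -/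
noncomputable def resConst (lam E : ℝ) : ℝ := √lam / E + (1 / E) ^ (1 / 2 : ℝ) * √Real.pi

theorem resConst_nonneg {lam E : ℝ} (hE : 0 < E) : 0 ≤ resConst lam E := by
  unfold resConst; positivity

/-- Pointwise bound by the `L²` norm: Cauchy–Schwarz at each time, then the Laplace transform in
time of `√lam + 1/√t`. -/
theorem lintegral_resMajorant_mul_le {lam E : ℝ} (hl : 0 < lam) (hE : 0 < E) {F : Plane → ℂ}
    (hF : AEStronglyMeasurable F volume) (x : Plane) :
    ∫⁻ y, resMajorant lam E (y - x) * ‖F y‖ₑ ≤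
      ENNReal.ofReal (resConst lam E) * eLpNorm F 2 volume := by
  have hm := measurable_resMajorant_integrand lam E
  have e1 : ∀ y, resMajorant lam E (y - x) * ‖F y‖ₑ = ∫⁻ t in Set.Ioi (0 : ℝ),
      ENNReal.ofReal (Real.exp (-(t * E)) * heatMajorant lam t (y - x)) * ‖F y‖ₑ := fun y => by
    rw [resMajorant, lintegral_mul_const _ (by exact hm.comp measurable_prodMk_right)]
  simp_rw [e1]
  have hshift : Measurable fun p : Plane × ℝ => (p.2, p.1 - x) := by fun_prop
  rw [lintegral_lintegral_swap (by
    exact (hm.comp hshift).aemeasurable.mul hF.enorm.comp_fst)]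
  have hinner : ∀ t : ℝ, 0 < t → ∫⁻ y,
      ENNReal.ofReal (Real.exp (-(t * E)) * heatMajorant lam t (y - x)) * ‖F y‖ₑ ≤
      ENNReal.ofReal (Real.exp (-(t * E)) * (√lam + t ^ (-(1 / 2) : ℝ))) *
        eLpNorm F 2 volume := by
    intro t ht
    have hmaj : Measurable fun y : Plane => ENNReal.ofReal (heatMajorant lam t (y - x)) :=
      ((measurable_heatMajorant lam).comp (measurable_prodMk_left.comp
        (measurable_id.sub_const x))).ennreal_ofReal
    have hpos : 0 ≤ √lam + t ^ (-(1 / 2) : ℝ) :=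
      add_nonneg (Real.sqrt_nonneg _) (Real.rpow_nonneg ht.le _)
    simp_rw [ENNReal.ofReal_mul (Real.exp_pos (-(t * E))).le, mul_assoc]
    rw [lintegral_const_mul'' _ (by exact hmaj.aemeasurable.mul hF.enorm)]
    refine mul_le_mul_right ?_ _
    rw [← ENNReal.pow_le_pow_left_iff (n := 2) two_ne_zero, mul_pow, eLpNorm_two_sq]
    refine (lintegral_mul_sq_le hmaj.aemeasurable hF.enorm).trans ?_
    refine mul_le_mul_left ?_ _
    rw [lintegral_sub_right_eq_self (fun z => ENNReal.ofReal (heatMajorant lam t z) ^ 2) x,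
      lintegral_heatMajorant_sq hl ht, ← ENNReal.ofReal_pow hpos]
    exact ENNReal.ofReal_le_ofReal (heatAmp_mul_exp_le hl ht)
  refine (setLIntegral_mono' measurableSet_Ioi fun t ht => hinner t ht).trans ?_
  rw [lintegral_mul_const _ (by fun_prop)]
  refine mul_le_mul_left (le_of_eq ?_) _
  have h1 := lintegral_rpow_mul_exp one_pos hE
  have h2 := lintegral_rpow_mul_exp one_half_pos hE
  rw [Real.rpow_one, Real.Gamma_one, mul_one] at h1
  rw [Real.Gamma_one_half_eq] at h2
  have e2 : ∀ t ∈ Set.Ioi (0 : ℝ),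
      ENNReal.ofReal (Real.exp (-(t * E)) * (√lam + t ^ (-(1 / 2) : ℝ))) =
      ENNReal.ofReal (√lam) * ENNReal.ofReal (t ^ ((1 : ℝ) - 1) * Real.exp (-(E * t))) +
        ENNReal.ofReal (t ^ ((1 / 2 : ℝ) - 1) * Real.exp (-(E * t))) := by
    intro t ht
    have ht' : 0 ≤ t := le_of_lt ht
    rw [← ENNReal.ofReal_mul (Real.sqrt_nonneg _), ← ENNReal.ofReal_add (by positivity)
      (by positivity)]
    congr 1
    rw [sub_self, Real.rpow_zero, mul_comm E t]
    norm_num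
    ring
  rw [setLIntegral_congr_fun measurableSet_Ioi e2, lintegral_add_left (by fun_prop),
    lintegral_const_mul _ (by fun_prop), h1, h2, ← ENNReal.ofReal_mul (Real.sqrt_nonneg _),
    ← ENNReal.ofReal_add (by positivity) (by positivity), resConst]
  congr 1
  ring

/-- Young's inequality `‖g * f‖₂ ≤ ‖g‖₁ ‖f‖₂` for lower integrals. -/
theorem lintegral_sq_lintegral_mul_le {g f : Plane → ENNReal} (hg : Measurable g)
    (hf : AEMeasurable f volume) :
    ∫⁻ x, (∫⁻ y, g (y - x) * f y) ^ 2 ≤ (∫⁻ z, g z) ^ 2 * ∫⁻ y, f y ^ 2 := by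
  have hroot : ∀ a : ENNReal, a = a ^ (1 / 2 : ℝ) * a ^ (1 / 2 : ℝ) := fun a => by
    rw [← ENNReal.rpow_add_of_nonneg _ _ (by norm_num) (by norm_num)]; norm_num
  have hg2 : ∀ x : Plane, Measurable fun y => g (y - x) ^ (1 / 2 : ℝ) := fun x => by fun_prop
  have h1 : ∀ x, (∫⁻ y, g (y - x) * f y) ^ 2 ≤ (∫⁻ z, g z) * ∫⁻ y, g (y - x) * f y ^ 2 := by
    intro x
    have e1 : ∀ y, g (y - x) * f y =
        g (y - x) ^ (1 / 2 : ℝ) * (g (y - x) ^ (1 / 2 : ℝ) * f y) := fun y => by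
      rw [← mul_assoc, ← hroot]
    simp_rw [e1]
    have hgf : AEMeasurable (fun y => g (y - x) ^ (1 / 2 : ℝ) * f y) volume :=
      (hg2 x).aemeasurable.mul hf
    refine (lintegral_mul_sq_le (hg2 x).aemeasurable hgf).trans_eq ?_
    have e2 : ∀ y, (g (y - x) ^ (1 / 2 : ℝ)) ^ 2 = g (y - x) := fun y => by
      rw [pow_two, ← hroot]
    simp_rw [mul_pow, e2]
    rw [lintegral_sub_right_eq_self]
  refine (lintegral_mono h1).trans ?_
  have hgm : Measurable fun p : Plane × Plane => g (p.2 - p.1) := by fun_prop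
  have hjoint : AEMeasurable (Function.uncurry fun x y : Plane => g (y - x) * f y ^ 2)
      (volume.prod volume) :=
    hgm.aemeasurable.mul (hf.pow_const 2).comp_snd
  rw [lintegral_const_mul'' _ (by exact hjoint.lintegral_prod_right'),
    lintegral_lintegral_swap hjoint]
  have e3 : ∀ y, ∫⁻ x, g (y - x) * f y ^ 2 = (∫⁻ z, g z) * f y ^ 2 := fun y => by
    rw [lintegral_mul_const _ (by fun_prop), lintegral_sub_left_eq_self]
  simp_rw [e3]
  rw [lintegral_const_mul'' _ (hf.pow_const 2), pow_two, mul_assoc]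

/-! ### The resolvent of the Landau Hamiltonian as an integral operator -/

/-- The measure `dt dy` on `(0, ∞) × ℝ²`. -/
noncomputable def timeSpace : Measure (ℝ × Plane) :=
  (volume.restrict (Set.Ioi (0 : ℝ))).prod volume

open ComplexConjugate in
/-- The integrand in `((P - A)² + E)⁻¹ F = ∫ exp(-tE) exp(-t (P - A)²) F dt`. -/
noncomputable def resIntegrand (lam E : ℝ) (F : Plane → ℂ) (x : Plane) (w : ℝ × Plane) : ℂ :=
  (Real.exp (-(w.1 * E)) : ℂ) * conj (heatKernel lam w.1 x w.2) * F w.2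

/-- The function `((P - A)² + E)⁻¹ F`, defined pointwise by the integral kernel. -/
noncomputable def landauResolvent (lam E : ℝ) (F : Plane → ℂ) (x : Plane) : ℂ :=
  ∫ w, resIntegrand lam E F x w ∂timeSpace

theorem aestronglyMeasurable_resIntegrand (lam E : ℝ) {F : Plane → ℂ}
    (hF : AEStronglyMeasurable F volume) (x : Plane) :
    AEStronglyMeasurable (resIntegrand lam E F x) timeSpace := by
  have h1 : Measurable fun w : ℝ × Plane => heatKernel lam w.1 x w.2 := by
    have := measurable_heatAmp lam
    have := measurable_heatRate lam
    unfold heatKernel; fun_prop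
  have h0 : Measurable fun w : ℝ × Plane => (Real.exp (-(w.1 * E)) : ℂ) := by fun_prop
  have h2 : Measurable fun w : ℝ × Plane =>
      (Real.exp (-(w.1 * E)) : ℂ) * (starRingEnd ℂ) (heatKernel lam w.1 x w.2) :=
    h0.mul (Complex.continuous_conj.measurable.comp h1)
  exact h2.aestronglyMeasurable.mul hF.comp_snd

/-- The pointwise bound for the resolvent kernel applied to a function that lives at distance at
least `d` from the point. -/
theorem lintegral_enorm_resIntegrand_le {lam E : ℝ} (hl : 0 < lam) {F : Plane → ℂ}
    (hF : AEStronglyMeasurable F volume) (x : Plane) {d : ℝ} (hd : 0 ≤ d)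
    (hsupp : ∀ y, F y ≠ 0 → d ≤ ‖y - x‖) :
    ∫⁻ w, ‖resIntegrand lam E F x w‖ₑ ∂timeSpace ≤
      ENNReal.ofReal (Real.exp (-(lam / 4) * d ^ 2)) *
        ∫⁻ y, resMajorant lam E (y - x) * ‖F y‖ₑ := by
  have hm := measurable_resMajorant_integrand lam E
  have hshift : Measurable fun y : Plane => resMajorant lam E (y - x) :=
    (measurable_resMajorant lam E).comp (measurable_id.sub_const x)
  unfold timeSpace
  rw [lintegral_prod_symm _ (aestronglyMeasurable_resIntegrand lam E hF x).enorm,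
    ← lintegral_const_mul'' _ (by exact hshift.aemeasurable.mul hF.enorm)]
  refine lintegral_mono fun y => ?_
  rw [← mul_assoc, resMajorant, ← lintegral_const_mul _ (by exact hm.comp measurable_prodMk_right),
    ← lintegral_mul_const _ (by exact (hm.comp measurable_prodMk_right).const_mul _)]
  refine setLIntegral_mono' measurableSet_Ioi fun t ht => ?_
  by_cases hy : F y = 0
  · simp [resIntegrand, hy]
  have hr := hsupp y hy
  rw [resIntegrand, enorm_mul]
  refine mul_le_mul_left ?_ _
  rw [← ofReal_norm, ← ENNReal.ofReal_mul (Real.exp_pos _).le]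
  apply ENNReal.ofReal_le_ofReal
  rw [norm_mul, RCLike.norm_conj, norm_heatKernel_eq hl ht, Complex.norm_real,
    Real.norm_of_nonneg (Real.exp_pos _).le]
  have h1 : Real.exp (-(lam / 4 * ‖y - x‖ ^ 2)) ≤ Real.exp (-(lam / 4) * d ^ 2) := by
    apply Real.exp_le_exp.2
    have : d ^ 2 ≤ ‖y - x‖ ^ 2 := pow_le_pow_left₀ hd hr 2
    nlinarith
  have h2 := heatMajorant_nonneg hl ht (y - x)
  calc _ ≤ Real.exp (-(t * E)) * (heatMajorant lam t (y - x) *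
        Real.exp (-(lam / 4) * d ^ 2)) := by gcongr
    _ = _ := by ring

theorem lintegral_enorm_resIntegrand_le_eLpNorm {lam E : ℝ} (hl : 0 < lam) (hE : 0 < E)
    {F : Plane → ℂ} (hF : AEStronglyMeasurable F volume) (x : Plane) {d : ℝ} (hd : 0 ≤ d)
    (hsupp : ∀ y, F y ≠ 0 → d ≤ ‖y - x‖) :
    ∫⁻ w, ‖resIntegrand lam E F x w‖ₑ ∂timeSpace ≤
      ENNReal.ofReal (Real.exp (-(lam / 4) * d ^ 2) * resConst lam E) * eLpNorm F 2 volume := by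
  rw [ENNReal.ofReal_mul (Real.exp_pos _).le, mul_assoc]
  exact (lintegral_enorm_resIntegrand_le hl hF x hd hsupp).trans
    (mul_le_mul_right (lintegral_resMajorant_mul_le hl hE hF x) _)

theorem integrable_resIntegrand {lam E : ℝ} (hl : 0 < lam) (hE : 0 < E) {F : Plane → ℂ}
    (hF : MemLp F 2 (volume : Measure Plane)) (x : Plane) :
    Integrable (resIntegrand lam E F x) timeSpace :=
  ⟨aestronglyMeasurable_resIntegrand lam E hF.1 x,
    (lintegral_enorm_resIntegrand_le_eLpNorm hl hE hF.1 x le_rfl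
      (fun _ _ => norm_nonneg _)).trans_lt (ENNReal.mul_lt_top ENNReal.ofReal_lt_top hF.2)⟩

/-- Pointwise Gaussian decay of `((P - A)² + E)⁻¹ F` away from the support of `F`. -/
theorem norm_landauResolvent_le {lam E : ℝ} (hl : 0 < lam) (hE : 0 < E) {F : Plane → ℂ}
    (hF : MemLp F 2 (volume : Measure Plane)) (x : Plane) {d : ℝ} (hd : 0 ≤ d)
    (hsupp : ∀ y, F y ≠ 0 → d ≤ ‖y - x‖) :
    ‖landauResolvent lam E F x‖ ≤
      Real.exp (-(lam / 4) * d ^ 2) * resConst lam E * (eLpNorm F 2 volume).toReal := by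
  have h1 := lintegral_enorm_resIntegrand_le_eLpNorm hl hE hF.1 x hd hsupp
  have h2 := (enorm_integral_le_lintegral_enorm (resIntegrand lam E F x)
    (μ := timeSpace)).trans h1
  have h3 := ENNReal.toReal_mono (ENNReal.mul_lt_top ENNReal.ofReal_lt_top hF.2).ne h2
  rw [ENNReal.toReal_mul, ENNReal.toReal_ofReal (mul_nonneg (Real.exp_pos _).le
    (resConst_nonneg hE)), toReal_enorm] at h3
  exact h3

/-! ### Inverting the Landau Hamiltonian by the heat semigroup -/

instance : SFinite timeSpace := by unfold timeSpace; infer_instance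

theorem integral_resIntegrand (lam E : ℝ) (F : Plane → ℂ) (x : Plane) (t : ℝ) :
    ∫ y, resIntegrand lam E F x (t, y) = (Real.exp (-(t * E)) : ℂ) * heatInt lam t F x := by
  simp only [resIntegrand, heatInt, mul_assoc]
  rw [integral_const_mul]

theorem integrableOn_heatInt {lam E : ℝ} (hl : 0 < lam) (hE : 0 < E) {F : Plane → ℂ}
    (hF : MemLp F 2 (volume : Measure Plane)) (x : Plane) :
    IntegrableOn (fun t : ℝ => (Real.exp (-(t * E)) : ℂ) * heatInt lam t F x) (Set.Ioi 0) := by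
  have h := (integrable_resIntegrand hl hE hF x).integral_prod_left
  simp_rw [integral_resIntegrand] at h
  exact h

theorem landauResolvent_eq_integral {lam E : ℝ} (hl : 0 < lam) (hE : 0 < E) {F : Plane → ℂ}
    (hF : MemLp F 2 (volume : Measure Plane)) (x : Plane) :
    landauResolvent lam E F x =
      ∫ t in Set.Ioi (0 : ℝ), (Real.exp (-(t * E)) : ℂ) * heatInt lam t F x := by
  simp_rw [landauResolvent, ← integral_resIntegrand]
  exact integral_prod _ (integrable_resIntegrand hl hE hF x)

theorem landauResolvent_congr {lam E : ℝ} {F F' : Plane → ℂ} (h : F =ᵐ[volume] F') (x : Plane) :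
    landauResolvent lam E F x = landauResolvent lam E F' x := by
  refine integral_congr_ae ?_
  have h1 : ∀ᵐ w ∂timeSpace, F w.2 = F' w.2 := Measure.quasiMeasurePreserving_snd.ae h
  filter_upwards [h1] with w hw
  rw [resIntegrand, resIntegrand, hw]

section weak

variable {lam E : ℝ} {u F : Plane → ℂ}

/-- The orbit `exp(-tE) Sₜ u` has a limit, since its derivative is integrable, and the limit is
zero, since the orbit itself is integrable. -/
theorem IsWeakSolution.tendsto_atTop (h : IsWeakSolution lam E u F) (hl : 0 < lam) (hE : 0 < E)
    (hu : MemLp u 2 (volume : Measure Plane)) (hF : MemLp F 2 (volume : Measure Plane))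
    (x : Plane) :
    Filter.Tendsto (fun t : ℝ => (Real.exp (-(t * E)) : ℂ) * heatInt lam t u x) Filter.atTop
      (nhds 0) :=
  tendsto_zero_of_hasDerivAt_of_integrableOn_Ioi (a := 0)
    (fun _ ht => h.hasDerivAt_heatInt hu hF hl ht x) (integrableOn_heatInt hl hE hF x).neg
    (integrableOn_heatInt hl hE hu x)

/-- A square integrable weak solution of the homogeneous equation is annihilated by the heat
semigroup. -/
theorem IsWeakSolution.heatInt_eq_zero (h : IsWeakSolution lam E u 0) (hl : 0 < lam) (hE : 0 < E)
    (hu : MemLp u 2 (volume : Measure Plane)) {t : ℝ} (ht : 0 < t) (x : Plane) :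
    heatInt lam t u x = 0 := by
  have h0 : MemLp (0 : Plane → ℂ) 2 (volume : Measure Plane) := MemLp.zero
  have hF : ∀ s, heatInt lam s (0 : Plane → ℂ) x = 0 := fun s => by simp [heatInt]
  have h1 := integral_Ioi_of_hasDerivAt_of_tendsto' (a := t)
    (fun s hs => h.hasDerivAt_heatInt hu h0 hl (lt_of_lt_of_le ht hs) x)
    (by simp [hF]) (h.tendsto_atTop hl hE hu h0 x)
  simp only [hF, mul_zero, neg_zero, integral_zero, zero_sub] at h1
  have h2 := neg_eq_zero.1 h1.symm
  exact (mul_eq_zero.1 h2).resolve_left (Complex.ofReal_ne_zero.2 (Real.exp_pos _).ne')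

end weak

theorem tendsto_heatRate {lam : ℝ} (hl : 0 < lam) :
    Filter.Tendsto (heatRate lam) (nhdsWithin 0 (Set.Ioi 0)) Filter.atTop := by
  have h1 : Filter.Tendsto (fun t : ℝ => 4 * Real.sinh (lam * t)) (nhdsWithin 0 (Set.Ioi 0))
      (nhdsWithin 0 (Set.Ioi 0)) := by
    refine tendsto_nhdsWithin_of_tendsto_nhds_of_eventually_within _ ?_ ?_
    · have : Continuous fun t : ℝ => 4 * Real.sinh (lam * t) := by fun_prop
      have h2 := this.tendsto 0
      simp only [mul_zero, Real.sinh_zero] at h2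
      exact h2.mono_left nhdsWithin_le_nhds
    · filter_upwards [self_mem_nhdsWithin] with t ht
      have := sinh_mul_pos hl ht
      simpa using this
  have h2 : Filter.Tendsto (fun t : ℝ => lam * Real.cosh (lam * t)) (nhdsWithin 0 (Set.Ioi 0))
      (nhds lam) := by
    have : Continuous fun t : ℝ => lam * Real.cosh (lam * t) := by fun_prop
    have h2 := this.tendsto 0
    simp only [mul_zero, Real.cosh_zero, mul_one] at h2
    exact h2.mono_left nhdsWithin_le_nhds
  exact Filter.Tendsto.pos_mul_atTop hl h2 (tendsto_inv_nhdsGT_zero.comp h1)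

/-- The heat semigroup tends to the identity as time tends to zero. -/
theorem tendsto_heatInt {lam : ℝ} (hl : 0 < lam) {f : Plane → ℂ} (hf : Continuous f)
    (hfc : HasCompactSupport f) (x : Plane) :
    Filter.Tendsto (fun t => heatInt lam t f x) (nhdsWithin 0 (Set.Ioi 0)) (nhds (f x)) := by
  -- the heat kernel is `1 / cosh (lam t)` times a standard Gaussian mollifier times a phase `ph`
  let ph : Plane → ℂ := fun y =>
    Complex.exp (-(((lam / 2 * (x 0 * y 1 - x 1 * y 0) : ℝ) : ℂ) * Complex.I))
  have hph : Continuous ph := by fun_prop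
  have hphx : ph x = 1 := by
    simp only [ph]; rw [mul_comm (x 0), sub_self]; simp
  have hint : Integrable (fun y => ph y * f y) :=
    (hph.mul hf).integrable_of_hasCompactSupport hfc.mul_left
  have h1 := Real.tendsto_integral_gaussian_smul' hint (v := x) (hph.mul hf).continuousAt
  have h2 : Filter.Tendsto (fun t => heatRate lam t / Real.pi ^ 2) (nhdsWithin 0 (Set.Ioi 0))
      Filter.atTop := (tendsto_heatRate hl).atTop_div_const (by positivity)
  have h3 := h1.comp h2
  rw [hphx, one_mul] at h3
  have h4 : Filter.Tendsto (fun t : ℝ => (((Real.cosh (lam * t))⁻¹ : ℝ) : ℂ))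
      (nhdsWithin 0 (Set.Ioi 0)) (nhds 1) := by
    have : Continuous fun t : ℝ => (((Real.cosh (lam * t))⁻¹ : ℝ) : ℂ) :=
      Complex.continuous_ofReal.comp ((by fun_prop : Continuous fun t : ℝ =>
        Real.cosh (lam * t)).inv₀ fun t => (Real.cosh_pos _).ne')
    have h2 := this.tendsto 0
    simp only [mul_zero, Real.cosh_zero, inv_one, Complex.ofReal_one] at h2
    exact h2.mono_left nhdsWithin_le_nhds
  have h5 := h4.mul h3
  rw [one_mul] at h5
  refine h5.congr' ?_
  filter_upwards [self_mem_nhdsWithin] with t ht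
  simp only [Function.comp_apply]
  rw [heatInt, ← integral_const_mul]
  refine integral_congr_ae (Filter.Eventually.of_forall fun y => ?_)
  have hfin : ((Module.finrank ℝ Plane : ℂ) / 2) = 1 := by simp
  simp only [hfin, Complex.cpow_one, smul_eq_mul, heatKernel, map_mul, Complex.conj_ofReal,
    ← Complex.exp_conj, map_add, Complex.conj_I, ph]
  have hamp : (((Real.cosh (lam * t))⁻¹ : ℝ) : ℂ) *
      ((Real.pi : ℂ) * ((heatRate lam t / Real.pi ^ 2 : ℝ) : ℂ)) = (heatAmp lam t : ℂ) := by
    rw [← Complex.ofReal_mul, ← Complex.ofReal_mul]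
    congr 1
    have hs := sinh_mul_pos hl ht
    have hp := Real.pi_pos
    have hc := Real.cosh_pos (lam * t)
    rw [heatRate, heatAmp]
    field_simp
  rw [Complex.exp_add, ← hamp, norm_sub_rev]
  have hexp : Complex.exp (((-(heatRate lam t * ‖y - x‖ ^ 2) : ℝ) : ℂ)) =
      Complex.exp (-(Real.pi : ℂ) ^ 2 * ((heatRate lam t / Real.pi ^ 2 : ℝ) : ℂ) *
        (‖y - x‖ : ℂ) ^ 2) := by
    congr 1
    have hp : (Real.pi : ℂ) ≠ 0 := Complex.ofReal_ne_zero.2 Real.pi_ne_zero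
    push_cast
    field_simp
  rw [hexp]
  have hneg : ∀ a : ℂ, a * -Complex.I = -(a * Complex.I) := fun a => by ring
  rw [hneg]
  ring

/-- Classical solutions are weak solutions. -/
theorem isWeakSolution_testFunction {lam E : ℝ} {f : Plane → ℂ} (hf : ContDiff ℝ ∞ f)
    (hfc : HasCompactSupport f) :
    IsWeakSolution lam E f fun y => schrodingerExpr lam (fun _ => 0) f y + E * f y := by
  intro g hg hgc
  have hcH : Continuous (schrodingerExpr lam (fun _ => 0) g) :=
    (schrodingerExpr_zero_contDiff hg).continuous
  have hcf : Continuous (schrodingerExpr lam (fun _ => 0) f) :=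
    (schrodingerExpr_zero_contDiff hf).continuous
  have i1 : Integrable fun y => (starRingEnd ℂ) (schrodingerExpr lam (fun _ => 0) g y) * f y :=
    ((Complex.continuous_conj.comp hcH).mul hf.continuous).integrable_of_hasCompactSupport
      hfc.mul_left
  have i2 : Integrable fun y => (E : ℂ) * ((starRingEnd ℂ) (g y) * f y) :=
    (continuous_const.mul ((Complex.continuous_conj.comp hg.continuous).mul
      hf.continuous)).integrable_of_hasCompactSupport hfc.mul_left.mul_left
  have i3 : Integrable fun y => (starRingEnd ℂ) (g y) * schrodingerExpr lam (fun _ => 0) f y :=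
    ((Complex.continuous_conj.comp hg.continuous).mul hcf).integrable_of_hasCompactSupport
      (schrodingerExpr_hasCompactSupport hfc).mul_left
  have e1 : ∀ y, (starRingEnd ℂ) (schrodingerExpr lam (fun _ => 0) g y + E * g y) * f y =
      (starRingEnd ℂ) (schrodingerExpr lam (fun _ => 0) g y) * f y +
        (E : ℂ) * ((starRingEnd ℂ) (g y) * f y) := fun y => by
    rw [map_add, map_mul, Complex.conj_ofReal]; ring
  have e2 : ∀ y, (starRingEnd ℂ) (g y) * (schrodingerExpr lam (fun _ => 0) f y + E * f y) =
      (starRingEnd ℂ) (g y) * schrodingerExpr lam (fun _ => 0) f y +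
        (E : ℂ) * ((starRingEnd ℂ) (g y) * f y) := fun y => by ring
  simp_rw [e1, e2]
  rw [integral_add i1 i2, integral_add i3 i2,
    integral_conj_schrodingerExpr_mul continuous_const hg hf hfc]

theorem memLp_schrodingerExpr_add {lam E : ℝ} {f : Plane → ℂ} (hf : ContDiff ℝ ∞ f)
    (hfc : HasCompactSupport f) :
    MemLp (fun y => schrodingerExpr lam (fun _ => 0) f y + E * f y) 2 (volume : Measure Plane) :=
  testFunction_memLp ((schrodingerExpr_zero_contDiff hf).continuous.add
    (continuous_const.mul hf.continuous))
    ((schrodingerExpr_hasCompactSupport hfc).add hfc.mul_left)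

/-- The integral operator inverts `(P - A)² + E` on test functions. -/
theorem landauResolvent_testFunction {lam E : ℝ} (hl : 0 < lam) (hE : 0 < E) {f : Plane → ℂ}
    (hf : ContDiff ℝ ∞ f) (hfc : HasCompactSupport f) (x : Plane) :
    landauResolvent lam E (fun y => schrodingerExpr lam (fun _ => 0) f y + E * f y) x = f x := by
  have hu := testFunction_memLp hf.continuous hfc
  have hF := memLp_schrodingerExpr_add (lam := lam) (E := E) hf hfc
  have hw := isWeakSolution_testFunction (lam := lam) (E := E) hf hfc
  rw [landauResolvent_eq_integral hl hE hF]
  -- the semigroup orbit, extended by its limit `f x` at time zero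
  set s : ℝ → ℂ := fun t => (Real.exp (-(t * E)) : ℂ) * heatInt lam t f x with hs
  set s' : ℝ → ℂ := Function.update s 0 (f x) with hs'
  have heq : ∀ t : ℝ, t ≠ 0 → s' =ᶠ[nhds t] s := fun t ht => by
    filter_upwards [isOpen_ne.mem_nhds ht] with r hr
    exact Function.update_of_ne hr _ _
  have hcont : ContinuousWithinAt s' (Set.Ici 0) 0 := by
    rw [← continuousWithinAt_Ioi_iff_Ici, hs', continuousWithinAt_update_same]
    have h1 : Filter.Tendsto s (nhdsWithin 0 (Set.Ioi 0)) (nhds (1 * f x)) := by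
      refine Filter.Tendsto.mul ?_ (tendsto_heatInt hl hf.continuous hfc x)
      have : Continuous fun t : ℝ => ((Real.exp (-(t * E)) : ℝ) : ℂ) := by fun_prop
      have h2 := this.tendsto 0
      simp only [zero_mul, neg_zero, Real.exp_zero, Complex.ofReal_one] at h2
      exact h2.mono_left nhdsWithin_le_nhds
    rw [one_mul] at h1
    exact h1.mono_left (nhdsWithin_mono _ Set.sdiff_subset)
  have hder : ∀ t ∈ Set.Ioi (0 : ℝ), HasDerivAt s' (-((Real.exp (-(t * E)) : ℂ) *
      heatInt lam t (fun y => schrodingerExpr lam (fun _ => 0) f y + E * f y) x)) t := fun t ht =>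
    (hw.hasDerivAt_heatInt hu hF hl ht x).congr_of_eventuallyEq (heq t (ne_of_gt ht))
  have hlim : Filter.Tendsto s' Filter.atTop (nhds 0) := by
    refine (hw.tendsto_atTop hl hE hu hF x).congr' ?_
    filter_upwards [Filter.eventually_gt_atTop 0] with t ht
    exact (heq t (ne_of_gt ht)).self_of_nhds.symm
  have h := integral_Ioi_of_hasDerivAt_of_tendsto hcont hder
    (integrableOn_heatInt hl hE hF x).neg hlim
  rw [integral_neg, zero_sub, neg_inj] at h
  rw [h, hs', Function.update_self]

/-- The adjoint relation for the resolvent kernel, by Fubini: if the heat semigroup annihilates `u`,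
then `u` is orthogonal to the range of the integral operator. -/
theorem integral_conj_landauResolvent_mul {lam E : ℝ} (hl : 0 < lam) (hE : lam < E)
    {u F : Plane → ℂ} (hu : MemLp u 2 (volume : Measure Plane))
    (hF : MemLp F 2 (volume : Measure Plane)) (h : ∀ t > 0, ∀ x, heatInt lam t u x = 0) :
    ∫ x, (starRingEnd ℂ) (landauResolvent lam E F x) * u x = 0 := by
  set Φ : Plane → ℝ × Plane → ℂ := fun x w =>
    (starRingEnd ℂ) (resIntegrand lam E F x w) * u x with hΦ
  have hmeas : AEStronglyMeasurable (Function.uncurry Φ) (volume.prod timeSpace) := by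
    have h1 := measurable_heatKernel lam
    have h0 : Measurable fun p : Plane × ℝ × Plane => (Real.exp (-(p.2.1 * E)) : ℂ) := by fun_prop
    have h2 : Measurable fun p : Plane × ℝ × Plane =>
        (Real.exp (-(p.2.1 * E)) : ℂ) * (starRingEnd ℂ) (heatKernel lam p.2.1 p.1 p.2.2) :=
      h0.mul (Complex.continuous_conj.measurable.comp h1)
    have h3 : AEStronglyMeasurable (fun w : ℝ × Plane => F w.2) timeSpace := hF.1.comp_snd
    have h4 : AEStronglyMeasurable (fun p : Plane × ℝ × Plane => F p.2.2)
        (volume.prod timeSpace) := h3.comp_snd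
    exact (Complex.continuous_conj.comp_aestronglyMeasurable
      (h2.aestronglyMeasurable.mul h4)).mul hu.1.comp_fst
  have hbound : ∫⁻ x, (∫⁻ y, resMajorant lam E (y - x) * ‖F y‖ₑ) * ‖u x‖ₑ < ⊤ := by
    have hshift : AEMeasurable (fun x => ∫⁻ y, resMajorant lam E (y - x) * ‖F y‖ₑ) volume := by
      have hm := measurable_resMajorant lam E
      have hmm : Measurable fun p : Plane × Plane => resMajorant lam E (p.2 - p.1) := by fun_prop
      exact (hmm.aemeasurable.mul hF.1.enorm.comp_snd).lintegral_prod_right'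
    have h1 := lintegral_mul_sq_le hshift hu.1.enorm
    have h2 := lintegral_sq_lintegral_mul_le (measurable_resMajorant lam E) hF.1.enorm
    rw [lintegral_resMajorant hl hE, ← eLpNorm_two_sq] at h2
    have h3 : (∫⁻ x, (∫⁻ y, resMajorant lam E (y - x) * ‖F y‖ₑ) ^ 2) * ∫⁻ x, ‖u x‖ₑ ^ 2 < ⊤ := by
      rw [← eLpNorm_two_sq]
      exact ENNReal.mul_lt_top (h2.trans_lt (ENNReal.mul_lt_top (by simp)
        (ENNReal.pow_lt_top hF.2))) (ENNReal.pow_lt_top hu.2)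
    have h4 := h1.trans_lt h3
    by_contra hcon
    rw [not_lt_top_iff] at hcon
    rw [hcon] at h4
    simp at h4
  have hint : Integrable (Function.uncurry Φ) (volume.prod timeSpace) := by
    refine ⟨hmeas, ?_⟩
    rw [HasFiniteIntegral, lintegral_prod _ hmeas.enorm]
    refine lt_of_le_of_lt (lintegral_mono fun x => ?_) hbound
    simp only [Function.uncurry_apply_pair, hΦ, enorm_mul, RCLike.enorm_conj]
    rw [lintegral_mul_const'' _ (aestronglyMeasurable_resIntegrand lam E hF.1 x).enorm]
    refine mul_le_mul_left ?_ _
    simpa using lintegral_enorm_resIntegrand_le hl hF.1 x le_rfl (fun _ _ => norm_nonneg _)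
  calc ∫ x, (starRingEnd ℂ) (landauResolvent lam E F x) * u x = ∫ x, ∫ w, Φ x w ∂timeSpace := by
        refine integral_congr_ae (Filter.Eventually.of_forall fun x => ?_)
        simp only [hΦ, landauResolvent]
        rw [integral_mul_const, integral_conj]
    _ = ∫ w, (∫ x, Φ x w) ∂timeSpace := integral_integral_swap hint
    _ = ∫ w : ℝ × Plane, (0 : ℂ) ∂timeSpace := by
        refine integral_congr_ae ?_
        have hpos : ∀ᵐ w ∂timeSpace, 0 < w.1 :=
          Measure.quasiMeasurePreserving_fst.ae (ae_restrict_mem measurableSet_Ioi)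
        filter_upwards [hpos] with w hw
        have e1 : ∀ x, Φ x w = ((Real.exp (-(w.1 * E)) : ℂ) * (starRingEnd ℂ) (F w.2)) *
            ((starRingEnd ℂ) (heatKernel lam w.1 w.2 x) * u x) := fun x => by
          simp only [hΦ, resIntegrand, map_mul, Complex.conj_ofReal, Complex.conj_conj]
          rw [conj_heatKernel lam w.1 w.2 x]
          ring
        simp_rw [e1]
        rw [integral_const_mul]
        have := h w.1 hw w.2
        rw [heatInt] at this
        rw [this, mul_zero]
    _ = 0 := by simp

/-- Essential self-adjointness of the Landau Hamiltonian on test functions: `-E` is not in the point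
spectrum of the adjoint. -/
theorem IsWeakSolution.eq_zero {lam E : ℝ} {u : PlaneL2} (h : IsWeakSolution lam E u 0)
    (hl : 0 < lam) (hE : lam < E) : u = 0 := by
  have hE0 := hl.trans hE
  refine eq_zero_of_forall_integral_conj_mul fun f hf hfc => ?_
  rw [← integral_conj_landauResolvent_mul hl hE (Lp.memLp u)
    (memLp_schrodingerExpr_add (lam := lam) (E := E) hf hfc)
    fun t ht x => h.heatInt_eq_zero hl hE0 (Lp.memLp u) ht x]
  simp_rw [landauResolvent_testFunction hl hE0 hf hfc]

/-! ### The resolvent of the closed operator -/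

theorem landauResolvent_add {lam E : ℝ} (hl : 0 < lam) (hE : 0 < E) {F G : Plane → ℂ}
    (hF : MemLp F 2 (volume : Measure Plane)) (hG : MemLp G 2 (volume : Measure Plane))
    (x : Plane) : landauResolvent lam E (F + G) x =
      landauResolvent lam E F x + landauResolvent lam E G x := by
  rw [landauResolvent, landauResolvent, landauResolvent,
    ← integral_add (integrable_resIntegrand hl hE hF x) (integrable_resIntegrand hl hE hG x)]
  simp only [resIntegrand, Pi.add_apply, mul_add]

theorem landauResolvent_smul {lam E : ℝ} (c : ℂ) (F : Plane → ℂ) (x : Plane) :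
    landauResolvent lam E (c • F) x = c * landauResolvent lam E F x := by
  rw [landauResolvent, landauResolvent, ← integral_const_mul]
  simp only [resIntegrand, Pi.smul_apply, smul_eq_mul]
  congr 1
  ext w
  ring

theorem norm_landauResolvent_le_norm {lam E : ℝ} (hl : 0 < lam) (hE : 0 < E) (F : PlaneL2)
    (x : Plane) : ‖landauResolvent lam E F x‖ ≤ resConst lam E * ‖F‖ := by
  have h := norm_landauResolvent_le hl hE (Lp.memLp F) x le_rfl (fun _ _ => norm_nonneg _)
  simpa [Lp.norm_def] using h

/-- Evaluation of `((P - A)² + E)⁻¹ F` at the point `x`, a bounded functional of `F ∈ L²`. -/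
noncomputable def resFunctional {lam E : ℝ} (hl : 0 < lam) (hE : 0 < E) (x : Plane) :
    PlaneL2 →L[ℂ] ℂ :=
  LinearMap.mkContinuous
    { toFun := fun F => landauResolvent lam E F x
      map_add' := fun F G => by
        rw [landauResolvent_congr (Lp.coeFn_add F G),
          landauResolvent_add hl hE (Lp.memLp F) (Lp.memLp G)]
      map_smul' := fun c F => by
        rw [landauResolvent_congr (Lp.coeFn_smul c F), landauResolvent_smul]
        rfl } (resConst lam E) fun F => norm_landauResolvent_le_norm hl hE F x

theorem resFunctional_apply {lam E : ℝ} (hl : 0 < lam) (hE : 0 < E) (x : Plane) (F : PlaneL2) :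
    resFunctional hl hE x F = landauResolvent lam E F x := rfl

/-- On the core, the integral operator recovers the test function from `(P - A)² f + E f`. -/
theorem eq_landauResolvent_of_mem_coreGraph {lam E : ℝ} (hl : 0 < lam) (hE : 0 < E)
    {p : PlaneL2 × PlaneL2} (hp : p ∈ coreGraph lam fun _ => 0) :
    Continuous (landauResolvent lam E (p.2 + (E : ℂ) • p.1 : PlaneL2)) ∧
      p.1 =ᵐ[volume] landauResolvent lam E (p.2 + (E : ℂ) • p.1 : PlaneL2) := by
  obtain ⟨f, hf, hfc, h1, h2⟩ := hp
  have h3 : ((p.2 + (E : ℂ) • p.1 : PlaneL2) : Plane → ℂ) =ᵐ[volume]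
      fun y => schrodingerExpr lam (fun _ => 0) f y + E * f y := by
    filter_upwards [h1, h2, Lp.coeFn_add p.2 ((E : ℂ) • p.1), Lp.coeFn_smul (E : ℂ) p.1]
      with y e1 e2 e3 e4
    rw [e3, Pi.add_apply, e4, Pi.smul_apply, e1, e2, smul_eq_mul]
  have h4 : landauResolvent lam E (p.2 + (E : ℂ) • p.1 : PlaneL2) = f := by
    funext x
    rw [landauResolvent_congr h3, landauResolvent_testFunction hl hE hf hfc]
  rw [h4]
  exact ⟨hf.continuous, h1⟩

/-- Elements of the closed graph inherit from the core the representation by the integral operator: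
on the core it holds everywhere, and evaluation at a point is `L²`-bounded uniformly in the
point. -/
theorem eq_landauResolvent_of_mem_graph {lam E : ℝ} (hl : 0 < lam) (hE : 0 < E) {ψ η : PlaneL2}
    (h : (ψ, η) ∈ (magneticHamiltonian lam fun _ => 0).graph) :
    Continuous (landauResolvent lam E (η + (E : ℂ) • ψ : PlaneL2)) ∧
      ψ =ᵐ[volume] landauResolvent lam E (η + (E : ℂ) • ψ : PlaneL2) := by
  rw [magneticHamiltonian_graph continuous_const] at h
  obtain ⟨p, hp, hlim⟩ := mem_closure_iff_seq_limit.1 h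
  have hcore := fun n => eq_landauResolvent_of_mem_coreGraph hl hE (hp n)
  have hF : Filter.Tendsto (fun n => (p n).2 + (E : ℂ) • (p n).1) Filter.atTop
      (nhds (η + (E : ℂ) • ψ)) := by
    have hc : Continuous fun q : PlaneL2 × PlaneL2 => q.2 + (E : ℂ) • q.1 := by fun_prop
    exact (hc.tendsto (ψ, η)).comp hlim
  constructor
  · have hunif : TendstoUniformly
        (fun n => landauResolvent lam E ((p n).2 + (E : ℂ) • (p n).1 : PlaneL2))
        (landauResolvent lam E (η + (E : ℂ) • ψ : PlaneL2)) Filter.atTop := by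
      rw [Metric.tendstoUniformly_iff]
      intro ε hε
      have h0 : Filter.Tendsto (fun n => resConst lam E *
          ‖(η + (E : ℂ) • ψ) - ((p n).2 + (E : ℂ) • (p n).1)‖) Filter.atTop (nhds 0) := by
        have := ((tendsto_const_nhds (x := η + (E : ℂ) • ψ)).sub hF).norm.const_mul (resConst lam E)
        simpa using this
      filter_upwards [h0.eventually_lt_const hε] with n hn x
      rw [dist_eq_norm, ← resFunctional_apply hl hE, ← resFunctional_apply hl hE, ← map_sub]
      exact (norm_landauResolvent_le_norm hl hE _ x).trans_lt hn
    exact hunif.continuous (Filter.Frequently.of_forall fun n => (hcore n).1)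
  · have h1 : Filter.Tendsto (fun n => (p n).1) Filter.atTop (nhds ψ) :=
      (continuous_fst.tendsto (ψ, η)).comp hlim
    obtain ⟨ns, hns, hae⟩ := (tendstoInMeasure_of_tendsto_Lp h1).exists_seq_tendsto_ae
    filter_upwards [hae, ae_all_iff.2 fun n => (hcore n).2] with x hx hx2
    refine tendsto_nhds_unique hx ?_
    simp_rw [hx2, ← resFunctional_apply hl hE]
    exact (((resFunctional hl hE x).continuous.tendsto _).comp hF).comp hns.tendsto_atTop

/-- Below the bottom of the spectrum, the closure of the Landau Hamiltonian has a resolvent, given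
by the heat kernel. -/
theorem exists_isResolventAt_landau {lam E : ℝ} (hl : 0 < lam) (hE : lam < E) :
    ∃ R : PlaneL2 →L[ℂ] PlaneL2,
      IsResolventAt (magneticHamiltonian lam fun _ => 0) ((-E : ℝ) : ℂ) R ∧ ‖R‖ ≤ 1 / E ∧
      ∀ F : PlaneL2, Continuous (landauResolvent lam E F) ∧
        R F =ᵐ[volume] landauResolvent lam E F := by
  have hE0 : 0 < E := hl.trans hE
  set T := magneticHamiltonian lam fun _ => 0
  have hgr : T.graph = (coreGraph lam fun _ => 0).topologicalClosure :=
    magneticHamiltonian_graph continuous_const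
  have hcl : IsClosed (T.graph : Set (PlaneL2 × PlaneL2)) := by
    rw [hgr]; exact Submodule.isClosed_topologicalClosure _
  have : CompleteSpace T.graph := hcl.completeSpace_coe
  let A : T.graph →L[ℂ] PlaneL2 :=
    (ContinuousLinearMap.snd ℂ PlaneL2 PlaneL2 +
      (E : ℂ) • ContinuousLinearMap.fst ℂ PlaneL2 PlaneL2).comp T.graph.subtypeL
  have hA : ∀ p : T.graph, A p = p.1.2 + (E : ℂ) • p.1.1 := fun p => rfl
  have hlow : ∀ p : T.graph, E * ‖p.1.1‖ ≤ ‖A p‖ := by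
    intro p
    have h1 := magneticHamiltonian_zero_nonneg (lam := lam) (ψ := p.1.1) (η := p.1.2) p.2
    have h2 : (inner ℂ p.1.1 (A p)).re = (inner ℂ p.1.1 p.1.2).re + E * ‖p.1.1‖ ^ 2 := by
      rw [hA, inner_add_right, inner_smul_right, inner_self_eq_norm_sq_to_K, Complex.add_re]
      congr 1
      rw [Complex.re_ofReal_mul]
      norm_cast
    have h3 := (Complex.re_le_norm _).trans (norm_inner_le_norm (𝕜 := ℂ) p.1.1 (A p))
    rcases (norm_nonneg p.1.1).eq_or_lt with h0 | h0
    · rw [← h0, mul_zero]; exact norm_nonneg _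
    · refine le_of_mul_le_mul_left ?_ h0
      nlinarith
  have hanti : AntilipschitzWith (Real.toNNReal (max (1 / E) 2)) A := by
    refine A.antilipschitz_of_bound fun p => ?_
    rw [Real.coe_toNNReal _ (le_max_of_le_right zero_le_two)]
    have h1 := hlow p
    have h2 : ‖p.1.1‖ ≤ 1 / E * ‖A p‖ := by
      rw [one_div, ← div_eq_inv_mul, le_div_iff₀ hE0]; linarith
    have h3 : ‖p.1.2‖ ≤ 2 * ‖A p‖ := by
      have e1 : p.1.2 = A p - (E : ℂ) • p.1.1 := by rw [hA]; abel
      have h4 := norm_sub_le (A p) ((E : ℂ) • p.1.1)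
      rw [← e1, norm_smul, Complex.norm_real, Real.norm_of_nonneg hE0.le] at h4
      linarith
    rw [Submodule.coe_norm, Prod.norm_def]
    exact max_le (h2.trans (mul_le_mul_of_nonneg_right (le_max_left _ _) (norm_nonneg _)))
      (h3.trans (mul_le_mul_of_nonneg_right (le_max_right _ _) (norm_nonneg _)))
  have hclr : IsClosed (A.range : Set PlaneL2) :=
    hanti.isClosed_range A.uniformContinuous
  have : CompleteSpace A.range := hclr.completeSpace_coe
  -- a vector orthogonal to the (closed) range is a weak solution of the homogeneous equation
  have hsurj : A.range = ⊤ := by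
    rw [← Submodule.orthogonal_eq_bot_iff, Submodule.eq_bot_iff]
    intro u hu
    refine IsWeakSolution.eq_zero (lam := lam) (E := E) (fun f hf hfc => ?_) hl hE
    have hmem := toLp_mem_coreGraph (lam := lam) (V := fun _ => 0) continuous_const hf hfc
    have hmem2 := Submodule.le_topologicalClosure _ hmem
    rw [← hgr] at hmem2
    have h1 := (Submodule.mem_orthogonal _ _).1 hu _ ⟨⟨_, hmem2⟩, rfl⟩
    have h2 : ((A ⟨_, hmem2⟩ : PlaneL2) : Plane → ℂ) =ᵐ[volume]
        fun y => schrodingerExpr lam (fun _ => 0) f y + E * f y := by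
      rw [hA]
      have h3 := MemLp.coeFn_toLp (testFunction_memLp hf.continuous hfc)
      have h4 := MemLp.coeFn_toLp (testFunction_memLp
        (schrodingerExpr_continuous (lam := lam) (V := fun _ => 0) continuous_const hf)
        (schrodingerExpr_hasCompactSupport hfc))
      filter_upwards [h3, h4, Lp.coeFn_add (MemLp.toLp _ (testFunction_memLp
        (schrodingerExpr_continuous (lam := lam) (V := fun _ => 0) continuous_const hf)
        (schrodingerExpr_hasCompactSupport hfc)))
        ((E : ℂ) • MemLp.toLp _ (testFunction_memLp hf.continuous hfc)),
        Lp.coeFn_smul (E : ℂ) (MemLp.toLp _ (testFunction_memLp hf.continuous hfc))]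
        with y e1 e2 e3 e4
      rw [e3, Pi.add_apply, e4, Pi.smul_apply, e1, e2, smul_eq_mul]
    have h3 := inner_eq_integral_conj_mul h2 (Filter.EventuallyEq.refl _ (u : Plane → ℂ))
    rw [← h3]
    simpa using h1
  let e : T.graph ≃ₗ[ℂ] PlaneL2 := LinearEquiv.ofBijective A.toLinearMap
    ⟨hanti.injective, LinearMap.range_eq_top.1 hsurj⟩
  have he : ∀ p, e p = A p := fun p => rfl
  let R : PlaneL2 →L[ℂ] PlaneL2 := LinearMap.mkContinuous
    ((LinearMap.fst ℂ PlaneL2 PlaneL2).comp (T.graph.subtype.comp e.symm.toLinearMap)) (1 / E)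
    fun F => by
      have h1 := hlow (e.symm F)
      rw [← he, LinearEquiv.apply_symm_apply] at h1
      change ‖(e.symm F).1.1‖ ≤ _
      rw [one_div, ← div_eq_inv_mul, le_div_iff₀ hE0]; linarith
  have hR : ∀ F, R F = (e.symm F).1.1 := fun F => rfl
  refine ⟨R, fun ψ η => ⟨fun h => ?_, fun h => ?_⟩,
    LinearMap.mkContinuous_norm_le _ (by positivity) _, fun F => ?_⟩
  · have h1 : η - ((-E : ℝ) : ℂ) • ψ = e ⟨(ψ, η), h⟩ := by
      rw [he, hA]; push_cast; rw [neg_smul, sub_neg_eq_add]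
    rw [h1, hR, LinearEquiv.symm_apply_apply]
  · have h1 := he (e.symm (η - ((-E : ℝ) : ℂ) • ψ))
    rw [LinearEquiv.apply_symm_apply, hA, ← hR, h] at h1
    push_cast at h1
    rw [neg_smul, sub_neg_eq_add, add_left_inj] at h1
    have h2 := (e.symm (η - ((-E : ℝ) : ℂ) • ψ)).2
    have h3 : (e.symm (η - ((-E : ℝ) : ℂ) • ψ)).1 = (ψ, η) := by
      refine Prod.ext (by rw [← hR, h]) ?_
      push_cast; rw [neg_smul, sub_neg_eq_add]; exact h1.symm
    rwa [h3] at h2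
  · have h1 := he (e.symm F)
    rw [LinearEquiv.apply_symm_apply, hA] at h1
    have h2 := eq_landauResolvent_of_mem_graph hl hE0 (ψ := (e.symm F).1.1) (η := (e.symm F).1.2)
      (e.symm F).2
    rw [← h1] at h2
    exact h2

/-! ### Compactness of the resolvent against a compactly supported potential -/

/-- An operator that maps weakly convergent sequences of the unit ball to norm convergent ones is
compact, by the sequential Banach–Alaoglu theorem. -/
theorem isCompactOperator_of_weak_tendsto {H : Type*} [NormedAddCommGroup H]
    [InnerProductSpace ℂ H] [CompleteSpace H] [TopologicalSpace.SeparableSpace H] (K : H →L[ℂ] H)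
    (h : ∀ (u : ℕ → H) (a : H), (∀ n, ‖u n‖ ≤ 1) → ‖a‖ ≤ 1 →
      (∀ l : H →L[ℂ] ℂ, Filter.Tendsto (fun n => l (u n)) Filter.atTop (nhds (l a))) →
      Filter.Tendsto (fun n => K (u n)) Filter.atTop (nhds (K a))) : IsCompactOperator K := by
  refine (isCompactOperator_iff_image_closedBall_subset_compact (K : H →ₗ[ℂ] H) one_pos).2
    ⟨K '' Metric.closedBall 0 1, ?_, subset_rfl⟩
  refine IsSeqCompact.isCompact fun w hw => ?_
  choose u hu huw using hw
  have hu1 : ∀ n, ‖u n‖ ≤ 1 := fun n => by simpa using hu n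
  obtain ⟨f, hf, ns, hns, hlim⟩ := WeakDual.isSeqCompact_closedBall ℂ H 0 1
    (x := fun n => StrongDual.toWeakDual (InnerProductSpace.toDual ℂ H (u n)))
    (fun n => by simpa using hu1 n)
  set a := (InnerProductSpace.toDual ℂ H).symm (WeakDual.toStrongDual f) with ha
  have ha1 : ‖a‖ ≤ 1 := by
    rw [ha, LinearIsometryEquiv.norm_map]; simpa using hf
  refine ⟨K a, ⟨a, by simpa using ha1, rfl⟩, ns, hns, ?_⟩
  have hw : w ∘ ns = fun n => K (u (ns n)) := by funext n; exact (huw _).symm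
  rw [hw]
  refine h _ a (fun n => hu1 _) ha1 fun l => ?_
  set b := (InnerProductSpace.toDual ℂ H).symm l with hb
  have hl : ∀ c, l c = (starRingEnd ℂ) (inner ℂ c b) := fun c => by
    rw [inner_conj_symm, hb, InnerProductSpace.toDual_symm_apply]
  have h1 : Filter.Tendsto (fun n => inner ℂ (u (ns n)) b) Filter.atTop (nhds (inner ℂ a b)) := by
    have h2 := ((WeakDual.eval_continuous b).tendsto f).comp hlim
    rw [ha, InnerProductSpace.toDual_symm_apply]
    exact h2
  simp_rw [hl]
  exact (Complex.continuous_conj.tendsto _).comp h1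

instance : SecondCountableTopology PlaneL2 :=
  have : Fact ((2 : ENNReal) ≠ ⊤) := ⟨by norm_num⟩
  inferInstance

/-- Dominated convergence in `L²`. -/
theorem tendsto_PlaneL2_of_dominated {u : ℕ → PlaneL2} {a : PlaneL2} {g : Plane → ℝ}
    (hg : MemLp g 2 (volume : Measure Plane)) (hb : ∀ n, ∀ᵐ x, ‖u n x‖ ≤ g x)
    (hlim : ∀ᵐ x, Filter.Tendsto (fun n => u n x) Filter.atTop (nhds (a x))) :
    Filter.Tendsto u Filter.atTop (nhds a) := by
  have hab : ∀ᵐ x, ‖a x‖ ≤ g x := by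
    filter_upwards [ae_all_iff.2 hb, hlim] with x h1 h2
    exact le_of_tendsto h2.norm (Filter.Eventually.of_forall h1)
  rw [tendsto_iff_norm_sub_tendsto_zero]
  have hsq : ∀ n, ‖u n - a‖ ^ 2 = ∫ x, ‖u n x - a x‖ ^ 2 := fun n => by
    have h1 := inner_eq_integral_conj_mul (Lp.coeFn_sub (u n) a) (Lp.coeFn_sub (u n) a)
    have h2 : ∀ x, (starRingEnd ℂ) ((⇑(u n) - ⇑a) x) * (⇑(u n) - ⇑a) x =
        ((‖u n x - a x‖ ^ 2 : ℝ) : ℂ) := fun x => by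
      rw [mul_comm, Complex.mul_conj, Complex.normSq_eq_norm_sq]; rfl
    simp_rw [h2] at h1
    rw [integral_complex_ofReal, inner_self_eq_norm_sq_to_K] at h1
    exact Complex.ofReal_injective (by rw [Complex.ofReal_pow]; exact h1)
  have h1 : Filter.Tendsto (fun n => ∫ x, ‖u n x - a x‖ ^ 2) Filter.atTop
      (nhds (∫ _ : Plane, (0 : ℝ))) := by
    refine tendsto_integral_of_dominated_convergence (fun x => (2 * g x) ^ 2) (fun n => ?_) ?_
      (fun n => ?_) ?_
    · exact ((Lp.aestronglyMeasurable _).sub (Lp.aestronglyMeasurable _)).norm.pow 2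
    · exact (hg.const_mul 2).integrable_sq
    · filter_upwards [hb n, hab] with x h1 h2
      rw [Real.norm_of_nonneg (by positivity)]
      refine pow_le_pow_left₀ (norm_nonneg _) ((norm_sub_le _ _).trans ?_) 2
      linarith
    · filter_upwards [hlim] with x hx
      have := ((hx.sub_const (a x)).norm).pow 2
      simpa using this
  rw [integral_zero] at h1
  simp_rw [← hsq] at h1
  have h2 := h1.sqrt
  simpa using h2

/-- For `V` of compact support, `((P - A)² + E)⁻¹ V` is compact: weak convergence of `u n` gives
pointwise convergence of the images, because evaluation at a point is a bounded functional, and the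
images of the unit ball are dominated by one Gaussian. -/
theorem isCompactOperator_resolvent_mul_mulOp {lam E : ℝ} (hl : 0 < lam) (hE : 0 < E)
    {R : PlaneL2 →L[ℂ] PlaneL2} (hR : ∀ F : PlaneL2, R F =ᵐ[volume] landauResolvent lam E F)
    {V : Plane → ℝ} {hV : Continuous V} {C : ℝ} {hC : ∀ x, |V x| ≤ C} {r : ℝ}
    (hsupp : ∀ x, V x ≠ 0 → ‖x‖ ≤ r) : IsCompactOperator (R * mulOp V hV hC) := by
  have hC0 : 0 ≤ C := (abs_nonneg _).trans (hC 0)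
  refine isCompactOperator_of_weak_tendsto _ fun u a hu ha hlim => ?_
  set M := mulOp V hV hC with hM
  have hbase := memLp_gaussian (b := lam / 8) (by linarith) 0
  refine tendsto_PlaneL2_of_dominated
    (hbase.const_mul (Real.exp (lam / 4 * r ^ 2) * resConst lam E * C)) (fun n => ?_) ?_
  · have h1 : ∀ x, landauResolvent lam E (M (u n)) x =
        landauResolvent lam E (fun y => (V y : ℂ) * u n y) x :=
      fun x => landauResolvent_congr (mulOp_coeFn _) x
    have h2 := memLp_ofReal_mul hV hC (Lp.memLp (u n))
    have h3 : (eLpNorm (fun y => (V y : ℂ) * u n y) 2 volume).toReal ≤ C := by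
      rw [← eLpNorm_congr_ae (mulOp_coeFn (hV := hV) (hC := hC) (u n)), ← Lp.norm_def]
      exact (norm_mulOp_apply_le _).trans (by nlinarith [hu n])
    filter_upwards [hR (M (u n))] with x hx
    rw [mul_apply_eq_comp, hx, h1]
    have h4 := norm_landauResolvent_le hl hE h2 x (le_max_left 0 (‖x‖ - r)) fun y hy => by
      have hVy : V y ≠ 0 := fun h => hy (by rw [h]; simp)
      have := hsupp y hVy
      have h5 := norm_sub_norm_le x y
      rw [norm_sub_rev] at h5
      exact max_le (norm_nonneg _) (by linarith)
    refine h4.trans ?_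
    have h5 : Real.exp (-(lam / 4) * max 0 (‖x‖ - r) ^ 2) ≤
        Real.exp (lam / 4 * r ^ 2) * Real.exp (-(lam / 8 * ‖x - 0‖ ^ 2)) := by
      rw [← Real.exp_add, sub_zero]
      apply Real.exp_le_exp.2
      have h6 : ‖x‖ ^ 2 / 2 - r ^ 2 ≤ max 0 (‖x‖ - r) ^ 2 := by
        rcases le_total (‖x‖ - r) 0 with h | h
        · rw [max_eq_left h]; nlinarith [norm_nonneg x]
        · rw [max_eq_right h]; nlinarith [sq_nonneg (‖x‖ - 2 * r)]
      nlinarith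
    have h7 := resConst_nonneg (lam := lam) hE
    calc _ ≤ (Real.exp (lam / 4 * r ^ 2) * Real.exp (-(lam / 8 * ‖x - 0‖ ^ 2))) *
          resConst lam E * C := by gcongr
      _ = _ := by ring
  · filter_upwards [ae_all_iff.2 fun n => hR (M (u n)), hR (M a)] with x h1 h2
    simp_rw [mul_apply_eq_comp]
    rw [h2]
    simp_rw [h1]
    exact hlim ((resFunctional hl hE x).comp M)

/-! ### Gaussian decay in `L²` -/

/-- If the supports of `W` and `V` are at distance `D`, then `W ((P - A)² + E)⁻¹ V` is of order
`exp(-(lam / 4) D²)`. -/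
theorem norm_mulOp_resolvent_mulOp_le {lam E : ℝ} (hl : 0 < lam) (hE : lam < E)
    {R : PlaneL2 →L[ℂ] PlaneL2} (hR : ∀ F : PlaneL2, R F =ᵐ[volume] landauResolvent lam E F)
    {V W : Plane → ℝ} {hV : Continuous V} {C : ℝ} {hC : ∀ x, |V x| ≤ C} {hW : Continuous W} {B : ℝ}
    {hB : ∀ x, |W x| ≤ B} {D : ℝ} (hD : 0 ≤ D)
    (hsep : ∀ x y, W x ≠ 0 → V y ≠ 0 → D ≤ ‖y - x‖) (φ : PlaneL2) :
    ‖mulOp W hW hB (R (mulOp V hV hC φ))‖ ≤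
      B * Real.exp (-(lam / 4) * D ^ 2) * (1 / (E - lam)) * ‖mulOp V hV hC φ‖ := by
  have hB0 : 0 ≤ B := (abs_nonneg _).trans (hB 0)
  have hE' : 0 ≤ 1 / (E - lam) := by have := sub_pos.2 hE; positivity
  have hF := memLp_ofReal_mul hV hC (Lp.memLp φ)
  set F : Plane → ℂ := fun y => (V y : ℂ) * φ y with hFdef
  set k : ENNReal := ENNReal.ofReal (B * Real.exp (-(lam / 4) * D ^ 2)) with hk
  -- pointwise domination by a convolution, to which Young's inequality applies
  have hpt : ∀ᵐ x, ‖mulOp W hW hB (R (mulOp V hV hC φ)) x‖ₑ ≤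
      k * ∫⁻ y, resMajorant lam E (y - x) * ‖F y‖ₑ := by
    filter_upwards [mulOp_coeFn (hV := hW) (hC := hB) (R (mulOp V hV hC φ)),
      hR (mulOp V hV hC φ)] with x h1 h2
    rw [h1, h2, landauResolvent_congr (mulOp_coeFn φ)]
    by_cases hx : W x = 0
    · simp [hx]
    have h3 := lintegral_enorm_resIntegrand_le (E := E) hl hF.1 x hD fun y hy =>
      hsep x y hx fun h => hy (by simp [hFdef, h])
    have h4 := (enorm_integral_le_lintegral_enorm (resIntegrand lam E F x)
      (μ := timeSpace)).trans h3
    rw [enorm_mul, hk, ENNReal.ofReal_mul hB0, mul_assoc]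
    refine mul_le_mul' ?_ h4
    rw [← ofReal_norm, Complex.norm_real]
    exact ENNReal.ofReal_le_ofReal (hB x)
  have hsq : eLpNorm (mulOp W hW hB (R (mulOp V hV hC φ))) 2 volume ^ 2 ≤
      (k * ENNReal.ofReal (1 / (E - lam)) * eLpNorm F 2 volume) ^ 2 := by
    rw [eLpNorm_two_sq]
    calc _ ≤ ∫⁻ x, k ^ 2 * (∫⁻ y, resMajorant lam E (y - x) * ‖F y‖ₑ) ^ 2 := by
          refine lintegral_mono_ae ?_
          filter_upwards [hpt] with x hx
          rw [← mul_pow]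
          exact pow_le_pow_left' hx 2
      _ = k ^ 2 * ∫⁻ x, (∫⁻ y, resMajorant lam E (y - x) * ‖F y‖ₑ) ^ 2 :=
          lintegral_const_mul' _ _ (by simp [hk])
      _ ≤ k ^ 2 * ((∫⁻ z, resMajorant lam E z) ^ 2 * ∫⁻ y, ‖F y‖ₑ ^ 2) :=
          mul_le_mul_right (lintegral_sq_lintegral_mul_le (measurable_resMajorant lam E)
            hF.1.enorm) _
      _ = _ := by rw [lintegral_resMajorant hl hE, ← eLpNorm_two_sq]; ring
  rw [ENNReal.pow_le_pow_left_iff two_ne_zero] at hsq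
  have h5 := ENNReal.toReal_mono (ENNReal.mul_ne_top (ENNReal.mul_ne_top (by simp [hk]) (by simp))
    hF.2.ne) hsq
  rw [ENNReal.toReal_mul, ENNReal.toReal_mul, ENNReal.toReal_ofReal hE', hk,
    ENNReal.toReal_ofReal (by positivity), ← Lp.norm_def,
    ← eLpNorm_congr_ae (mulOp_coeFn (hV := hV) (hC := hC) φ), ← Lp.norm_def] at h5
  exact h5

/-! ### Perturbation of the ground state -/

/-- The resolvent bound of a semibounded operator below its lower bound. -/
theorem IsResolventAt.norm_le {T : PlaneL2 →ₗ.[ℂ] PlaneL2} {μ e : ℝ} {R : PlaneL2 →L[ℂ] PlaneL2}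
    (h : IsResolventAt T (μ : ℂ) R)
    (hbelow : ∀ ψ η, (ψ, η) ∈ T.graph → e * ‖ψ‖ ^ 2 ≤ (inner ℂ ψ η).re) (hμ : μ < e) :
    ‖R‖ ≤ 1 / (e - μ) := by
  have hpos : 0 < e - μ := sub_pos.2 hμ
  refine ContinuousLinearMap.opNorm_le_bound _ (by positivity) fun g => ?_
  have h1 := hbelow _ _ (h.apply_mem_graph g)
  have h2 : (inner ℂ (R g) ((μ : ℂ) • R g)).re = μ * ‖R g‖ ^ 2 := by
    rw [inner_smul_right, inner_self_eq_norm_sq_to_K, Complex.re_ofReal_mul]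
    norm_cast
  rw [inner_add_right, Complex.add_re, h2] at h1
  have h3 := (Complex.re_le_norm _).trans (norm_inner_le_norm (𝕜 := ℂ) (R g) g)
  rw [one_div, ← div_eq_inv_mul, le_div_iff₀ hpos]
  rcases (norm_nonneg (R g)).eq_or_lt with h0 | h0
  · rw [← h0, zero_mul]; exact norm_nonneg _
  · refine le_of_mul_le_mul_left ?_ h0
    nlinarith

theorem IsPerturbation.trans {T T' T'' : PlaneL2 →ₗ.[ℂ] PlaneL2}
    {A B : PlaneL2 →L[ℂ] PlaneL2} (h : IsPerturbation T T' A) (h' : IsPerturbation T' T'' B) :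
    IsPerturbation T T'' (A + B) := by
  intro ψ η
  rw [h', h, add_apply, sub_sub, add_comm (A ψ)]

/-- An eigenvector of `T + M` solves the resolvent equation of `T`. -/
theorem IsPerturbation.eigenvector_eq {T T' : PlaneL2 →ₗ.[ℂ] PlaneL2}
    {M R : PlaneL2 →L[ℂ] PlaneL2} {z : ℂ} {φ : PlaneL2} (hM : IsPerturbation T T' M)
    (h : IsResolventAt T z R) (hφ : (φ, z • φ) ∈ T'.graph) : φ = -R (M φ) := by
  have h1 := (h _ _).1 ((hM _ _).1 hφ)
  rw [sub_right_comm, sub_self, zero_sub, map_neg] at h1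
  exact h1.symm

section ground

variable {T T' : PlaneL2 →ₗ.[ℂ] PlaneL2} {B : PlaneL2 →L[ℂ] PlaneL2} {e₀ M : ℝ} {φ₀ : PlaneL2}

/-- The variational upper bound, with the unperturbed ground state as trial function. -/
theorem IsPerturbation.groundEnergy_le (hB : IsPerturbation T T' B) (hT' : GraphSymmetric T')
    (h₀ : IsGroundState T e₀ φ₀) (hneg : ∀ ψ, (inner ℂ ψ (B ψ)).re ≤ 0) {e : ℝ}
    (he : IsGroundEnergy T' e) : e ≤ e₀ := by
  obtain ⟨-, hn, heig⟩ := h₀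
  have h1 : (φ₀, (e₀ : ℂ) • φ₀ + B φ₀) ∈ T'.graph := by
    rw [hB, add_sub_cancel_right]; exact satisfiesEigenEq_iff.1 heig
  have h2 := hT'.le_re_inner he.2 h1
  have h3 : (inner ℂ φ₀ ((e₀ : ℂ) • φ₀)).re = e₀ := by
    rw [inner_smul_right, inner_self_eq_norm_sq_to_K, Complex.re_ofReal_mul, hn]
    simp
  rw [inner_add_right, Complex.add_re, h3, hn] at h2
  have := hneg φ₀
  linarith

theorem IsPerturbation.le_re_inner (hB : IsPerturbation T T' B) (hT : GraphSymmetric T)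
    (h₀ : IsGroundEnergy T e₀) (hM : ∀ ψ, |(inner ℂ ψ (B ψ)).re| ≤ M * ‖ψ‖ ^ 2)
    {ψ η : PlaneL2} (h : (ψ, η) ∈ T'.graph) : (e₀ - M) * ‖ψ‖ ^ 2 ≤ (inner ℂ ψ η).re := by
  have h1 := hT.le_re_inner h₀.2 ((hB _ _).1 h)
  rw [inner_sub_right, Complex.sub_re] at h1
  have := (abs_le.1 (hM ψ)).1
  linarith

/-- A perturbation of norm at most `M` lowers the bottom of the spectrum by at most `M`. -/
theorem IsPerturbation.exists_isResolventAt_of_lt (hB : IsPerturbation T T' B)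
    (hT : GraphSymmetric T) (h₀ : IsGroundEnergy T e₀) (hM : ‖B‖ ≤ M) {μ : ℝ} (hμ : μ < e₀ - M) :
    ∃ R, IsResolventAt T' (μ : ℂ) R := by
  have hM0 := (norm_nonneg B).trans hM
  obtain ⟨R, hR⟩ := exists_resolvent_of_lt h₀.2 (show μ < e₀ by linarith)
  refine hB.exists_isResolventAt hR (isUnit_one_add_of_norm_lt_one ?_)
  have hpos : 0 < e₀ - μ := by linarith
  have h1 := hR.norm_le (fun _ _ h => hT.le_re_inner h₀.2 h) (show μ < e₀ by linarith)
  calc ‖R * B‖ ≤ ‖R‖ * ‖B‖ := norm_mul_le _ _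
    _ ≤ 1 / (e₀ - μ) * M := by gcongr
    _ < 1 := by rw [one_div, ← div_eq_inv_mul, div_lt_one hpos]; linarith

theorem IsPerturbation.le_groundEnergy (hB : IsPerturbation T T' B) (hT : GraphSymmetric T)
    (h₀ : IsGroundEnergy T e₀) (hM : ‖B‖ ≤ M) {e : ℝ} (he : IsGroundEnergy T' e) : e₀ - M ≤ e := by
  by_contra! h
  exact he.1 (mem_opResolventSet_iff.2 (hB.exists_isResolventAt_of_lt hT h₀ hM h))

/-- Stability of a simple isolated ground state: a normalized eigenvector of `T + B` below the
ground energy of `T`, with non-negative overlap with the ground state `φ₀` of `T`, is close to `φ₀`. Its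
component orthogonal to `φ₀` is controlled by the gap. -/
theorem IsPerturbation.norm_sub_le_of_gap (hB : IsPerturbation T T' B) (hT : GraphSymmetric T)
    (h₀ : IsGroundState T e₀ φ₀) {c : ℝ} (hc : 0 < c) (hgap : HasSimpleGap T e₀ φ₀ c)
    {e : ℝ} (he : e ≤ e₀) {φ : PlaneL2} (hn : ‖φ‖ = 1) (hφ : (φ, (e : ℂ) • φ) ∈ T'.graph)
    (him : (inner ℂ φ₀ φ).im = 0) (hre : 0 ≤ (inner ℂ φ₀ φ).re) :
    ‖φ - φ₀‖ ≤ 4 / c * ‖B φ‖ := by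
  obtain ⟨hg₀, hn₀, heig₀⟩ := h₀
  have hμ : e - 1 < e₀ := by linarith
  obtain ⟨R, hR⟩ := exists_resolvent_of_lt hg₀.2 hμ
  set α : ℝ := (inner ℂ φ₀ φ).re with hα
  have hin : inner ℂ φ₀ φ = (α : ℂ) := Complex.ext rfl (by simpa using him)
  have hin' : inner ℂ φ φ₀ = (α : ℂ) := by rw [← inner_conj_symm, hin, Complex.conj_ofReal]
  have hself : inner ℂ φ₀ φ₀ = (1 : ℂ) := by
    rw [inner_self_eq_norm_sq_to_K, hn₀]; simp
  have hgr₀ := satisfiesEigenEq_iff.1 heig₀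
  have hgr := (hB _ _).1 hφ
  -- the overlap of `φ₀` with `B φ`, from the symmetry of `T`
  have hov : inner ℂ φ₀ (B φ) = ((e - e₀ : ℝ) : ℂ) * α := by
    have h1 := hT _ _ _ _ hgr₀ hgr
    rw [inner_sub_right, inner_smul_right, inner_smul_left, hin, Complex.conj_ofReal] at h1
    push_cast
    linear_combination -h1
  -- the components of `B φ` and of `φ` orthogonal to `φ₀`; they satisfy `(T - (e - 1)) q = q - b`
  set b : PlaneL2 := B φ - (inner ℂ φ₀ (B φ)) • φ₀ with hb
  set q : PlaneL2 := φ - (α : ℂ) • φ₀ with hq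
  have hbn : ‖b‖ ≤ 2 * ‖B φ‖ := by
    have h1 := norm_sub_le (B φ) ((inner ℂ φ₀ (B φ)) • φ₀)
    have h2 := norm_inner_le_norm (𝕜 := ℂ) φ₀ (B φ)
    rw [norm_smul, hn₀, mul_one] at h1
    rw [hn₀, one_mul] at h2
    linarith
  have hperp : inner ℂ φ₀ (q - b) = 0 := by
    rw [hq, hb, inner_sub_right, inner_sub_right, inner_sub_right, inner_smul_right,
      inner_smul_right, hself, hin]
    ring
  have hRq : R (q - b) = q := by
    have h1 : (q, (e : ℂ) • φ - B φ - (α : ℂ) • (e₀ : ℂ) • φ₀) ∈ T.graph :=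
      T.graph.sub_mem hgr (T.graph.smul_mem (α : ℂ) hgr₀)
    have h2 : q - b =
        (e : ℂ) • φ - B φ - (α : ℂ) • (e₀ : ℂ) • φ₀ - ((e - 1 : ℝ) : ℂ) • q := by
      rw [hb, hov, hq]; push_cast; module
    rw [h2]
    exact (hR _ _).1 h1
  have hq1 := norm_resolvent_le_of_gap hT hg₀ hgap hc hμ hR hperp
  have hpos : 0 < e₀ + c - (e - 1) := by linarith
  rw [hRq, ← div_eq_inv_mul, le_div_iff₀ hpos] at hq1
  have hq2 : c * ‖q‖ ≤ 2 * ‖B φ‖ := by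
    have h1 := norm_sub_le q b
    nlinarith [norm_nonneg q]
  have hα1 : α ≤ 1 := by
    have h1 := norm_inner_le_norm (𝕜 := ℂ) φ₀ φ
    rw [hin, hn₀, hn, Complex.norm_real, Real.norm_of_nonneg hre, one_mul] at h1
    exact h1
  have hqsq : ‖q‖ ^ 2 = 1 - α ^ 2 := by
    rw [hq, norm_sub_sq (𝕜 := ℂ), inner_smul_right, hin', norm_smul, hn, hn₀, Complex.norm_real,
      Real.norm_of_nonneg hre, ← Complex.ofReal_mul]
    change 1 ^ 2 - 2 * (((α * α : ℝ) : ℂ)).re + _ = _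
    rw [Complex.ofReal_re]; ring
  have hdsq : ‖φ - φ₀‖ ^ 2 = 2 - 2 * α := by
    rw [norm_sub_sq (𝕜 := ℂ), hin', hn, hn₀]
    change 1 ^ 2 - 2 * ((α : ℂ)).re + _ = _
    rw [Complex.ofReal_re]; ring
  have hd : ‖φ - φ₀‖ ≤ 2 * ‖q‖ := by
    refine le_of_sq_le_sq ?_ (by positivity)
    nlinarith
  rw [div_mul_eq_mul_div, le_div_iff₀ hc]
  nlinarith

end ground

/-! ### Magnetic Schrödinger operators with a compactly supported well -/

section well

variable {lam : ℝ} {V U : Plane → ℝ} {e₀ M C : ℝ} {φ₀ : PlaneL2}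

theorem magneticHamiltonian_isPerturbation_zero (hV : Continuous V) (hC : ∀ x, |V x| ≤ C) :
    IsPerturbation (magneticHamiltonian lam fun _ => 0) (magneticHamiltonian lam V)
      (mulOp V hV hC) :=
  magneticHamiltonian_isPerturbation continuous_const hV hC fun x => by rw [zero_add]

/-- Below the Landau spectrum, a negative bounded perturbation of a compactly supported well that
has a ground state again has a ground state. -/
theorem exists_isGroundState_add (hl : 0 < lam) (hV : Continuous V) (hC : ∀ x, |V x| ≤ C) {r : ℝ}
    (hsupp : ∀ x, V x ≠ 0 → ‖x‖ ≤ r) (hU : Continuous U) (hM : ∀ x, |U x| ≤ M)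
    (hneg : ∀ x, U x ≤ 0) (h₀ : IsGroundState (magneticHamiltonian lam V) e₀ φ₀)
    (he₀ : lam < -e₀) (hMe : M < -e₀) :
    ∃ e : ℝ, (∃ φ : PlaneL2, IsGroundState (magneticHamiltonian lam fun x => V x + U x) e φ) ∧
      |e - e₀| ≤ M := by
  have hT := magneticHamiltonian_symmetric (lam := lam) hV
  have hT' := magneticHamiltonian_symmetric (lam := lam) (hV.add hU)
  have hA := magneticHamiltonian_isPerturbation_zero (lam := lam) hV hC
  have hB : IsPerturbation (magneticHamiltonian lam V) (magneticHamiltonian lam fun x => V x + U x)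
    (mulOp U hU hM) := magneticHamiltonian_isPerturbation hV hU hM fun _ => rfl
  have hnorm : ‖mulOp U hU hM‖ ≤ M := norm_mulOp_le
  have hM0 : 0 ≤ M := (norm_nonneg _).trans hnorm
  have : Nontrivial PlaneL2 := ⟨φ₀, 0, fun h => by have := h₀.2.1; simp [h] at this⟩
  have hlow := fun ψ η h => hB.le_re_inner hT h₀.1 abs_re_inner_mulOp_le (ψ := ψ) (η := η) h
  obtain ⟨R', hR'⟩ := hB.exists_isResolventAt_of_lt hT h₀.1 hnorm (sub_one_lt (e₀ - M))
  obtain ⟨e, he⟩ := exists_isGroundEnergy hT' hR' fun ψ η h =>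
    le_trans (by nlinarith [sq_nonneg ‖ψ‖]) (hlow ψ η h)
  have hle := hB.groundEnergy_le hT' h₀ (re_inner_mulOp_nonpos hneg) he
  have hge := hB.le_groundEnergy hT h₀.1 hnorm he
  refine ⟨e, ?_, abs_le.2 ⟨by linarith, by linarith⟩⟩
  obtain ⟨R, hR, hRn, hRF⟩ := exists_isResolventAt_landau hl (show lam < -e by linarith)
  rw [neg_neg] at hR
  have hE : 0 < -e := by linarith
  have hRB : ‖R * mulOp U hU hM‖ < 1 :=
    calc _ ≤ ‖R‖ * ‖mulOp U hU hM‖ := norm_mul_le _ _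
      _ ≤ 1 / -e * M := by gcongr
      _ < 1 := by rw [one_div, ← div_eq_inv_mul, div_lt_one hE]; linarith
  obtain ⟨ψ, hψ0, hψ⟩ := (hA.trans hB).exists_eigenvector hR
    (isCompactOperator_resolvent_mul_mulOp hl hE (fun F => (hRF F).2) hsupp) hRB he.1
  refine ⟨((‖ψ‖⁻¹ : ℝ) : ℂ) • ψ, he, ?_, ?_⟩
  · rw [norm_smul, Complex.norm_real, norm_inv, norm_norm,
      inv_mul_cancel₀ (norm_ne_zero_iff.2 hψ0)]
  · rw [satisfiesEigenEq_iff, smul_comm]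
    exact Submodule.smul_mem _ (((‖ψ‖⁻¹ : ℝ) : ℂ)) hψ

/-- An eigenfunction `φ` below the Landau spectrum equals `-((P - A)² - e)⁻¹ (V φ)`, which is
continuous and decays like a Gaussian away from the support of `V`. -/
theorem exists_continuous_eigenfunction (hl : 0 < lam) (hV : Continuous V) (hC : ∀ x, |V x| ≤ C)
    {e : ℝ} {φ : PlaneL2} (hn : ‖φ‖ = 1)
    (hφ : SatisfiesEigenEq (magneticHamiltonian lam V) e φ) (he : lam < -e) :
    ∃ f : Plane → ℂ, Continuous f ∧ φ =ᵐ[volume] f ∧ ∀ x, ‖f x‖ ≤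
      Real.exp (-(lam / 4) * Metric.infDist x (tsupport V) ^ 2) * resConst lam (-e) * C := by
  have hE : 0 < -e := hl.trans he
  obtain ⟨R, hR, -, hRF⟩ := exists_isResolventAt_landau hl he
  rw [neg_neg] at hR
  set F := mulOp V hV hC φ with hF
  have h1 : φ = -R F := (magneticHamiltonian_isPerturbation_zero hV hC).eigenvector_eq hR
    (satisfiesEigenEq_iff.1 hφ)
  refine ⟨fun x => -landauResolvent lam (-e) F x, (hRF F).1.neg, ?_, fun x => ?_⟩
  · rw [h1]
    filter_upwards [Lp.coeFn_neg (R F), (hRF F).2] with x h2 h3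
    rw [h2, Pi.neg_apply, h3]
  · rw [norm_neg, landauResolvent_congr (mulOp_coeFn φ)]
    have hd : 0 ≤ Metric.infDist x (tsupport V) := Metric.infDist_nonneg
    refine (norm_landauResolvent_le hl hE (memLp_ofReal_mul hV hC (Lp.memLp φ)) x hd
      fun y hy => ?_).trans ?_
    · have hyV : y ∈ tsupport V := subset_tsupport V fun h => hy (by simp [h])
      have h2 := Metric.infDist_le_dist_of_mem (x := x) hyV
      rwa [dist_comm, dist_eq_norm] at h2
    · have h2 : (eLpNorm (fun y => (V y : ℂ) * φ y) 2 volume).toReal ≤ C := by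
        rw [← eLpNorm_congr_ae (mulOp_coeFn (hV := hV) (hC := hC) φ), ← Lp.norm_def]
        exact norm_mulOp_apply_le φ |>.trans_eq (by rw [hn, mul_one])
      have h3 := resConst_nonneg (lam := lam) hE
      gcongr

/-- A potential `U` at distance `D` from the well `V` barely acts on an eigenfunction `φ` of the
perturbed Hamiltonian: in `U φ = -U R (V φ) - U R (U φ)`, with `R = ((P - A)² - e)⁻¹`, the first
term is of order `exp(-(lam / 4) D²)` and the second is at most `‖U φ‖ / 2`. -/
theorem norm_mulOp_eigenfunction_le (hl : 0 < lam) (hV : Continuous V) (hC : ∀ x, |V x| ≤ C)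
    (hU : Continuous U) (hM : ∀ x, |U x| ≤ M) {D : ℝ} (hD : 0 ≤ D)
    (hsep : ∀ x y, U x ≠ 0 → V y ≠ 0 → D ≤ ‖y - x‖) {e : ℝ} {φ : PlaneL2} (hn : ‖φ‖ = 1)
    (hφ : SatisfiesEigenEq (magneticHamiltonian lam fun x => V x + U x) e φ) (he : lam < -e)
    (hMe : 2 * M ≤ -e) :
    ‖mulOp U hU hM φ‖ ≤ 2 * (M * Real.exp (-(lam / 4) * D ^ 2) * (1 / (-e - lam)) * C) := by
  have hE : 0 < -e := hl.trans he
  have hM0 : 0 ≤ M := (abs_nonneg _).trans (hM 0)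
  obtain ⟨R, hR, hRn, hRF⟩ := exists_isResolventAt_landau hl he
  rw [neg_neg] at hR
  have hA := magneticHamiltonian_isPerturbation_zero (lam := lam) hV hC
  have hB : IsPerturbation (magneticHamiltonian lam V) (magneticHamiltonian lam fun x => V x + U x)
    (mulOp U hU hM) := magneticHamiltonian_isPerturbation hV hU hM fun _ => rfl
  have h1 := (hA.trans hB).eigenvector_eq hR (satisfiesEigenEq_iff.1 hφ)
  rw [add_apply, map_add, neg_add] at h1
  have h2 : mulOp U hU hM φ =
      -mulOp U hU hM (R (mulOp V hV hC φ)) - mulOp U hU hM (R (mulOp U hU hM φ)) := by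
    conv_lhs => rw [h1]
    rw [map_add, map_neg, map_neg, sub_eq_add_neg]
  have h3 := norm_mulOp_resolvent_mulOp_le hl he (fun F => (hRF F).2) (hV := hV) (hC := hC)
    (hW := hU) (hB := hM) hD hsep φ
  have h4 : ‖mulOp V hV hC φ‖ ≤ C := norm_mulOp_apply_le φ |>.trans_eq (by rw [hn, mul_one])
  have hE' : 0 ≤ 1 / (-e - lam) := by have := sub_pos.2 he; positivity
  have h5 : ‖mulOp U hU hM (R (mulOp V hV hC φ))‖ ≤
      M * Real.exp (-(lam / 4) * D ^ 2) * (1 / (-e - lam)) * C :=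
    h3.trans (mul_le_mul_of_nonneg_left h4 (by positivity))
  have h6 : ‖mulOp U hU hM (R (mulOp U hU hM φ))‖ ≤ 1 / 2 * ‖mulOp U hU hM φ‖ := by
    have h7 : M * (1 / -e) ≤ 1 / 2 := by
      rw [mul_one_div, div_le_div_iff₀ hE two_pos]; linarith
    calc _ ≤ M * ‖R (mulOp U hU hM φ)‖ := norm_mulOp_apply_le _
      _ ≤ M * (1 / -e * ‖mulOp U hU hM φ‖) := by
          gcongr
          exact (R.le_opNorm _).trans (mul_le_mul_of_nonneg_right hRn (norm_nonneg _))
      _ = M * (1 / -e) * ‖mulOp U hU hM φ‖ := by ring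
      _ ≤ _ := by gcongr
  have h8 := norm_sub_le (-mulOp U hU hM (R (mulOp V hV hC φ)))
    (mulOp U hU hM (R (mulOp U hU hM φ)))
  rw [← h2, norm_neg] at h8
  linarith

end well

/-- For energies of order `lam²`, the constant in the pointwise bound is uniform in `lam`. -/
theorem resConst_le {lam E c : ℝ} (hc : 0 < c) (hl : 1 ≤ lam) (hE : c * lam ^ 2 ≤ E) :
    resConst lam E ≤ 1 / c + (1 / c) ^ (1 / 2 : ℝ) * √Real.pi := by
  have h0 : 0 < c * lam ^ 2 := by positivity
  have hE0 : 0 < E := h0.trans_le hE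
  have hcE : c ≤ E := by nlinarith [one_le_pow₀ hl (n := 2)]
  have hs : √lam ≤ lam := Real.sqrt_le_iff.2 ⟨by linarith, by nlinarith⟩
  unfold resConst
  refine add_le_add ?_ ?_
  · rw [div_le_div_iff₀ hE0 hc, one_mul, mul_comm]
    have h1 : √lam ≤ lam ^ 2 := hs.trans (by nlinarith)
    exact (mul_le_mul_of_nonneg_left h1 hc.le).trans hE
  · have h1 : 1 / E ≤ 1 / c := one_div_le_one_div_of_le hc hcE
    have h2 : 0 ≤ 1 / E := by positivity
    gcongr

theorem mainTheorem8 (c₁ C₁ : ℝ) (hc₁ : 0 < c₁) (hC₁ : 0 < C₁) :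
    -- constants depending only on `c₁`, `C₁`
    ∃ C₂ τ₀ Λ₀ : ℝ, 0 < C₂ ∧ 0 < τ₀ ∧ 0 < Λ₀ ∧
      ∀ r₀ cgap : ℝ, 0 < r₀ → 0 < cgap →
      -- a constant depending only on `c₁`, `C₁`, `r₀`, `cgap`
      ∃ C : ℝ, 0 < C ∧
        ∀ (v W : Plane → ℝ) (D τ lam e₀ : ℝ) (φ₀ : PlaneL2),
          ContDiff ℝ ∞ v → ContDiff ℝ ∞ W →
          (∀ x, |v x| ≤ C₁) → (∀ x, |W x| ≤ C₁) →
          (∀ x, v x ≤ 0) → (∀ x, W x ≤ 0) →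
          (∀ x y, ‖x‖ = ‖y‖ → v x = v y) →
          tsupport v ⊆ Metric.ball 0 r₀ →
          tsupport W ⊆ (Metric.ball 0 (r₀ + D))ᶜ →
          C₂ ≤ D → 0 < τ → τ < τ₀ → Λ₀ ≤ lam →
          IsGroundState (magneticHamiltonian lam (fun x => lam ^ 2 * v x)) e₀ φ₀ →
          -C₁ * lam ^ 2 ≤ e₀ → e₀ ≤ -c₁ * lam ^ 2 →
          HasSimpleGap (magneticHamiltonian lam (fun x => lam ^ 2 * v x)) e₀ φ₀ cgap →
          -- the perturbed Hamiltonian has a ground state eigenpair, and its energy is close to `e₀`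
          (∃ e : ℝ,
            (∃ φ : PlaneL2,
              IsGroundState (magneticHamiltonian lam (fun x => lam ^ 2 * v x + τ * W x)) e φ) ∧
            |e - e₀| ≤ (⨆ x, |W x|) * τ) ∧
          -- Gaussian bound, for the continuous representative of `φ₀`
          (∃ f : Plane → ℂ, Continuous f ∧ φ₀ =ᵐ[volume] f ∧
            ∀ x ∈ tsupport W,
              ‖f x‖ ≤ C * lam ^ 2 * Real.exp (-(lam / 4) * Metric.infDist x (tsupport v) ^ 2)) ∧
          -- every ground state whose phase is normalized by `⟨φ₀, φ⟩ ≥ 0` is close to `φ₀`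
          (∀ (e : ℝ) (φ : PlaneL2),
            IsGroundState (magneticHamiltonian lam (fun x => lam ^ 2 * v x + τ * W x)) e φ →
            (inner ℂ φ₀ φ).im = 0 → 0 ≤ (inner ℂ φ₀ φ).re →
            ‖φ - φ₀‖ ≤ C * τ * lam ^ 2 * Real.exp (-(lam / 4) * D ^ 2)) := by
  -- `τ₀` makes `τ W` at most half of the binding energy `-e₀ ≥ c₁ lam²`, and `Λ₀` makes the Landau
  -- energy `lam` at most half of it
  refine ⟨1, c₁ / (2 * C₁), max 1 (2 / c₁), one_pos, by positivity, by positivity,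
    fun r₀ cgap hr₀ hcgap => ?_⟩
  set K : ℝ := 1 / c₁ + (1 / c₁) ^ (1 / 2 : ℝ) * √Real.pi with hK
  have hK0 : 0 < K := by positivity
  refine ⟨K * C₁ + 16 * C₁ ^ 2 / (cgap * c₁), by positivity, ?_⟩
  intro v W D τ lam e₀ φ₀ hv hW hvC hWC hv0 hW0 _ hvs hWs hD hτ hτ₀ hlam h₀ _ he₀ hgap
  have hl1 : 1 ≤ lam := (le_max_left _ _).trans hlam
  have hl2 : 2 / c₁ ≤ lam := (le_max_right _ _).trans hlam
  have hl : 0 < lam := by linarith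
  rw [div_le_iff₀ hc₁] at hl2
  have hτC : C₁ * τ ≤ c₁ / 2 := by
    rw [lt_div_iff₀ (by positivity)] at hτ₀; linarith
  have hc₁l : c₁ ≤ c₁ * lam ^ 2 := by nlinarith [one_le_pow₀ hl1 (n := 2)]
  have hll : 2 * lam ≤ c₁ * lam ^ 2 := by nlinarith
  have hcV : Continuous fun x => lam ^ 2 * v x := continuous_const.mul hv.continuous
  have hVC : ∀ x, |lam ^ 2 * v x| ≤ lam ^ 2 * C₁ := fun x => by
    rw [abs_mul, abs_of_nonneg (sq_nonneg lam)]
    exact mul_le_mul_of_nonneg_left (hvC x) (sq_nonneg _)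
  have hcU : Continuous fun x => τ * W x := continuous_const.mul hW.continuous
  have hbdd : BddAbove (Set.range fun x => |W x|) := ⟨C₁, by rintro _ ⟨x, rfl⟩; exact hWC x⟩
  have hUM : ∀ x, |τ * W x| ≤ (⨆ x, |W x|) * τ := fun x => by
    rw [abs_mul, abs_of_pos hτ, mul_comm]
    exact mul_le_mul_of_nonneg_right (le_ciSup hbdd x) hτ.le
  have hMC : (⨆ x, |W x|) * τ ≤ C₁ * τ := mul_le_mul_of_nonneg_right (ciSup_le hWC) hτ.le
  have hU0 : ∀ x, τ * W x ≤ 0 := fun x => mul_nonpos_of_nonneg_of_nonpos hτ.le (hW0 x)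
  have hts : tsupport (fun x => lam ^ 2 * v x) = tsupport v := by
    rw [tsupport, tsupport]
    congr 1
    ext x
    simp [hl.ne']
  have hVs : ∀ x, lam ^ 2 * v x ≠ 0 → ‖x‖ < r₀ := fun x hx => by
    have h1 := hvs (subset_tsupport v (show v x ≠ 0 from fun h => hx (by rw [h, mul_zero])))
    simpa using h1
  have hsep : ∀ x y, τ * W x ≠ 0 → lam ^ 2 * v y ≠ 0 → D ≤ ‖y - x‖ := fun x y hx hy => by
    have h1 := hWs (subset_tsupport W (show W x ≠ 0 from fun h => hx (by rw [h, mul_zero])))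
    have h2 : r₀ + D ≤ ‖x‖ := by simpa using h1
    have h3 := hVs y hy
    have h4 := norm_sub_norm_le x y
    rw [norm_sub_rev] at h4
    linarith
  refine ⟨?_, ?_, ?_⟩
  · exact exists_isGroundState_add hl hcV hVC (fun x hx => (hVs x hx).le) hcU hUM hU0 h₀
      (by linarith) (by linarith)
  · obtain ⟨f, hf, hae, hb⟩ := exists_continuous_eigenfunction hl hcV hVC h₀.2.1 h₀.2.2
      (by linarith)
    refine ⟨f, hf, hae, fun x _ => (hb x).trans ?_⟩
    rw [hts]
    have h1 : resConst lam (-e₀) ≤ K := resConst_le hc₁ hl1 (by linarith)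
    have h2 : 0 ≤ 16 * C₁ ^ 2 / (cgap * c₁) := by positivity
    calc _ ≤ Real.exp (-(lam / 4) * Metric.infDist x (tsupport v) ^ 2) * K * (lam ^ 2 * C₁) := by
          gcongr
      _ = K * C₁ * lam ^ 2 * Real.exp (-(lam / 4) * Metric.infDist x (tsupport v) ^ 2) := by ring
      _ ≤ _ := by gcongr; linarith
  · intro e φ hφ him hre
    have hT := magneticHamiltonian_symmetric (lam := lam) hcV
    have hT' := magneticHamiltonian_symmetric (lam := lam) (hcV.add hcU)
    have hB : IsPerturbation (magneticHamiltonian lam fun x => lam ^ 2 * v x)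
      (magneticHamiltonian lam fun x => lam ^ 2 * v x + τ * W x) (mulOp _ hcU hUM) :=
      magneticHamiltonian_isPerturbation hcV hcU hUM fun _ => rfl
    have hle := hB.groundEnergy_le hT' h₀ (re_inner_mulOp_nonpos hU0) hφ.1
    have h1 := hB.norm_sub_le_of_gap hT h₀ hcgap hgap hle hφ.2.1 (satisfiesEigenEq_iff.1 hφ.2.2)
      him hre
    have h2 := norm_mulOp_eigenfunction_le hl hcV hVC hcU hUM (by linarith) hsep hφ.2.1 hφ.2.2
      (by linarith) (by linarith)
    have h3 : 1 / (-e - lam) * lam ^ 2 ≤ 2 / c₁ := by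
      rw [one_div_mul_eq_div, div_le_div_iff₀ (by linarith) hc₁]
      linarith
    have h4 : 0 ≤ 1 / (-e - lam) := by
      have : 0 < -e - lam := by linarith
      positivity
    calc _ ≤ 4 / cgap * _ := h1
      _ ≤ 4 / cgap * (2 * (C₁ * τ * Real.exp (-(lam / 4) * D ^ 2) * (1 / (-e - lam)) *
          (lam ^ 2 * C₁))) := by
          refine (mul_le_mul_of_nonneg_left h2 (by positivity)).trans ?_
          gcongr
      _ = 8 * C₁ ^ 2 / cgap * τ * Real.exp (-(lam / 4) * D ^ 2) *
          (1 / (-e - lam) * lam ^ 2) := by ring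
      _ ≤ 8 * C₁ ^ 2 / cgap * τ * Real.exp (-(lam / 4) * D ^ 2) * (2 / c₁) := by gcongr
      _ = 16 * C₁ ^ 2 / (cgap * c₁) * τ * 1 * Real.exp (-(lam / 4) * D ^ 2) := by
          field_simp; ring
      _ ≤ _ := by
          have : (1 : ℝ) ≤ lam ^ 2 := one_le_pow₀ hl1
          have h5 : 0 ≤ K * C₁ := by positivity
          gcongr
          linarith
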